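/- **Setting.** We work with finitary type theories in the sense of Bauer and Haselwarter. A signature assigns to each symbol $\mathsf S$ an arity $(c,[(c_1,n_1),\dots,(c_k,n_k)])$ with $c\in\{\mathsf{Ty},\mathsf{Tm}\}$ and $c_i\in\{\mathsf{Ty},\mathsf{Tm},\mathsf{EqTy},\mathsf{EqTm}\}$, where the $i$-th argument has class $c_i$ and binds $n_i$ variables; a metavariable has an arity $(c,n)$ and is an object metavariable if $c\in\{\mathsf{Ty},\mathsf{Tm}\}$, an equality metavariable otherwise. Expressions are built from variables, symbols applied to arguments, object metavariables applied to terms, and a dummy argument $\star$ of class $\mathsf{EqTy}$ or $\mathsf{EqTm}$; arguments may be abstracted, $\{x\}e$. Judgement theses are $A\ \mathsf{type}$, $t:A$, $A\equiv B$, $s\equiv t:A$; boundary theses are $\Box\ \mathsf{type}$, $\Box:A$, $A\equiv B\ \mathsf{by}\ \Box$, $s\equiv t:A\ \mathsf{by}\ \Box$; both may be abstracted, $\{x{:}A\}\mathcal J$. Filling a boundary $\mathcal B$ with a head $e$ gives the judgement $\mathcal B[e]$. A metavariable context $\Xi=[\mathsf M_1{:}\mathcal B_1,\dots,\mathsf M_n{:}\mathcal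 B_n]$ lists distinct metavariables with closed abstracted boundaries, where $\mathcal B_i$ mentions only $\mathsf M_1,\dots,\mathsf M_{i-1}$; $|\Xi|$ is the set of its metavariables and $\mathrm{objmv}(\Xi)$ the set of its object metavariables; $\mathrm{mv}(e)$ is the set of metavariables occurring in $e$. Hypothetical judgements and boundaries have the forms $\Theta;\Gamma\vdash\mathcal J$ and $\Theta;\Gamma\vdash\mathcal B$, where $\Theta$ is a metavariable context and $\Gamma$ a variable context. The generic application $\widehat{\mathsf M}$ of $\mathsf M$ is $\{\vec x\}\mathsf M(\vec x)$ for an object metavariable and $\{\vec x\}\star$ for an equality metavariable. An instantiation $I=\langle\mathsf M_1\mapsto e_1,\dots,\mathsf M_n\mapsto e_n\rangle$ of $\Xi$ over $\Theta;\Gamma$ consists of arguments over $\Theta;\Gamma$ of matching arities. It acts on syntax by substituting its arguments for the metavariables, with $I_*(\mathsf M(\vec t))=e[I_*\vec t/\vec x]$ if $I(\mathsf M)=\{\vec x\}e$. Let $I_{(i)}$ be the restriction of $I$ to $\mathsf M_1,\dots,\mathsf M_{i-1}$. The instantiation $I$ is derivable if $\Theta;\Gamma\vdash (I_{(i)*}\mathcal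 B_i)[e_i]$ is derivable for all $i$. A raw rule $\Xi\Longrightarrow\mathcal B[e]$ is a judgement $\Xi;[\,]\vdash\mathcal B[e]$ with non-abstracted $\mathcal B$; it is an object rule if $\mathcal B$ is $\Box\ \mathsf{type}$ or $\Box:A$. A raw type theory is a family of raw rules. It determines derivability by the usual structural rules (variables, metavariables and their congruence, abstraction, reflexivity, symmetry, transitivity, conversion, well-formedness of boundaries), the instantiations of its raw rules (with premises $\Theta;\Gamma\vdash(I_{(i)*}\mathcal B_i)[e_i]$ for all $i$ and $\Theta;\Gamma\vdash I_*\mathcal B$, and conclusion $\Theta;\Gamma\vdash I_*(\mathcal B[e])$), and the corresponding congruence rules for its object rules. A metavariable context $\Xi$ is well formed, $\vdash\Xi\ \mathsf{mctx}$, if each $[\mathsf M_1{:}\mathcal B_1,\dots,\mathsf M_{i-1}{:}\mathcal B_{i-1}];[\,]\vdash\mathcal B_i$ is derivable. A raw rule $\Xi\Longrightarrow\mathcal B[e]$ is derivable if $\Xi;[\,]\vdash\mathcal B[e]$ is, and finitary if $\vdash\Xi\ \mathsf{mctx}$ and $\Xi;[\,]\vdash\mathcal B$ are derivable. A raw type theory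 is standard if all its rules are finitary, each of its object rules is a symbol rule, i.e. of the form $[\mathsf M_1{:}\mathcal B_1,\dots,\mathsf M_n{:}\mathcal B_n]\Longrightarrow\mathcal B[\mathsf S(\widehat{\mathsf M}_1,\dots,\widehat{\mathsf M}_n)]$ for a symbol $\mathsf S$, and each symbol has precisely one such rule. **Naturality for variables.** In a standard type theory, the relation $\Theta;\Gamma\Vdash\mathcal J$ on object judgements is inductively generated as follows: - $\Theta;\Gamma\Vdash \mathsf a:\Gamma(\mathsf a)$ for each variable $\mathsf a$ of $\Gamma$. - If $\Theta;\Gamma,\mathsf a{:}A\Vdash\mathcal J[\mathsf a/x]$ with $\mathsf a$ fresh, then $\Theta;\Gamma\Vdash\{x{:}A\}\mathcal J$. - If $\Theta(\mathsf M)=\{x_1{:}A_1\}\cdots\{x_m{:}A_m\}\mathcal B$ with $\mathcal B$ an object boundary thesis, and $\Theta;\Gamma\Vdash t_j:A_j[t_1/x_1,\dots,t_{j-1}/x_{j-1}]$ for all $j$, then $\Theta;\Gamma\Vdash(\mathcal B[\vec t/\vec x])[\mathsf M(\vec t)]$. - If $[\mathsf M_1{:}\mathcal B_1,\dots,\mathsf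 M_n{:}\mathcal B_n]\Longrightarrow\mathcal B[\mathsf S(\widehat{\mathsf M}_1,\dots,\widehat{\mathsf M}_n)]$ is the rule for $\mathsf S$, $I=\langle\mathsf M_1\mapsto e_1,\dots,\mathsf M_n\mapsto e_n\rangle$, and $\Theta;\Gamma\Vdash(I_{(i)*}\mathcal B_i)[e_i]$ for each object boundary $\mathcal B_i$, then $\Theta;\Gamma\Vdash\mathcal B'[\mathsf S(e_1,\dots,e_n)]$ for every boundary thesis $\mathcal B'$ of the class of $\mathsf S$. A rule $\Xi\Longrightarrow\mathcal B[p]$ is natural for variables if $\Xi;[\,]\Vdash\mathcal B[p]$. **Patterns.** A pattern is a type metavariable $\mathsf M()$ without arguments, or an application $\mathsf S(q_1,\dots,q_n)$ of a type or term symbol to argument patterns with $\mathrm{mv}(q_i)\cap\mathrm{mv}(q_j)=\emptyset$ for $i\ne j$. An argument pattern is a generic application $\widehat{\mathsf M}$ or a pattern. **Object-invertibility.** Let $I$ be an instantiation of $\Xi=[\mathsf M_1{:}\mathcal B_1,\dots,\mathsf M_n{:}\mathcal B_n]$ over $\Theta;[\,]$ with $|\Xi|\cap|\Theta|=\emptyset$,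 and let $\mathsf M_{i_1},\dots,\mathsf M_{i_m}$ be the equality metavariables of $\Xi$, in order. The equational residue is the metavariable context $\mathrm{Res}_\Xi(I)=[\Theta,\mathsf M_{i_1}{:}I_{(i_1)*}\mathcal B_{i_1},\dots,\mathsf M_{i_m}{:}I_{(i_m)*}\mathcal B_{i_m}]$. The residual instantiation $I^{r}$ of $\Xi$ over $\mathrm{Res}_\Xi(I);[\,]$ is given by $I^r(\mathsf M_i)=I(\mathsf M_i)$ for object metavariables and $I^r(\mathsf M_i)=\widehat{\mathsf M}_i$ for equality metavariables. A derivable raw rule $\Xi\Longrightarrow\mathcal J$ is object-invertible if, for every $\Theta$ with $\vdash\Theta\ \mathsf{mctx}$ and $|\Xi|\cap|\Theta|=\emptyset$ and every instantiation $I$ of $\Xi$ over $\Theta;[\,]$ such that $\Theta;[\,]\vdash I_*\mathcal J$ is derivable, the residual instantiation $I^r$ is derivable. **Statement.** In a standard type theory, consider a derivable finitary object rule $\Xi\Longrightarrow\mathcal B[p]$ which is natural for variables. If $p$ is a pattern and $\mathrm{mv}(p)=\mathrm{objmv}(\Xi)$, then the rule is object-invertible. -/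

import Mathlib

universe u v

/-! Raw and standard finitary type theories.

Variables are well-scoped: `n` in the types below counts the variables in scope. Variable `i` is the
`i`-th one counted from the outside, so the variable bound last is `Fin.last`. Variables of a variable
context and abstracted variables are handled uniformly, hence passing from `x` to a fresh free variable
is the identity. Metavariables are names that carry their arity. -/

namespace FTT

/-- The two kinds of objects: types and terms. -/
inductive Srt where
  | ty
  | tm
  deriving DecidableEq

/-- The four classes: `obj ty` (types), `obj tm` (terms), `eq ty` (type equations),
`eq tm` (term equations). -/
inductive Cls where
  | obj (s : Srt)
  | eq (s : Srt)
  deriving DecidableEq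

/-- Metavariable arity `(c, n)`, also the arity of an argument binding `n` variables. -/
structure Arity where
  cls : Cls
  num : ℕ
  deriving DecidableEq

/-- Metavariables: countably many for each arity. -/
structure MV where
  ar : Arity
  name : ℕ
  deriving DecidableEq

/-- A metavariable is an object metavariable when its class is `obj`. -/
def MV.isObj (M : MV) : Bool :=
  match M.ar.cls with
  | .obj _ => true
  | .eq _ => false

/-- A signature assigns to each symbol its class, its number of arguments, and their arities. -/
structure Signature where
  Sym : Type u
  srt : Sym → Srt
  num : Sym → ℕ
  arg : (S : Sym) → Fin (num S) → Arity

/-- Expressions and arguments with `n` variables in scope, of arity `(c, m)`. Those with `m = 0` and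
class `obj ty`, `obj tm` are the type and term expressions. -/
inductive Arg (Sg : Signature.{u}) : ℕ → Cls → ℕ → Type u where
  | var {n : ℕ} (i : Fin n) : Arg Sg n (.obj .tm) 0
  | symb {n : ℕ} (S : Sg.Sym) (e : (i : Fin (Sg.num S)) → Arg Sg n (Sg.arg S i).cls (Sg.arg S i).num) :
      Arg Sg n (.obj (Sg.srt S)) 0
  /-- The application of the object metavariable `⟨⟨.obj s, m⟩, x⟩` to `m` terms. -/
  | mvar {n : ℕ} (s : Srt) (m x : ℕ) (t : Fin m → Arg Sg n (.obj .tm) 0) : Arg Sg n (.obj s) 0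
  | dummy {n : ℕ} (s : Srt) : Arg Sg n (.eq s) 0
  | abs {n : ℕ} {c : Cls} {m : ℕ} (e : Arg Sg (n + 1) c m) : Arg Sg n c (m + 1)

/-- Type expressions. -/
abbrev Ty (Sg : Signature.{u}) (n : ℕ) : Type u := Arg Sg n (.obj .ty) 0

/-- Term expressions. -/
abbrev Tm (Sg : Signature.{u}) (n : ℕ) : Type u := Arg Sg n (.obj .tm) 0

variable {Sg : Signature.{u}}

/-! ### Variables, substitution, occurrences of metavariables -/

/-- Extension of a finite sequence by one last entry. -/
def extend {α : Type*} {n : ℕ} (f : Fin n → α) (a : α) : Fin (n + 1) → α :=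
  Fin.snoc (α := fun _ => α) f a

/-- A renaming of variables lifted under one binder. -/
def liftRen {n k : ℕ} (r : Fin n → Fin k) : Fin (n + 1) → Fin (k + 1) :=
  extend (fun i => (r i).castSucc) (Fin.last k)

/-- Renaming of variables. -/
def Arg.ren : {n : ℕ} → {c : Cls} → {m : ℕ} → Arg Sg n c m → {k : ℕ} → (Fin n → Fin k) → Arg Sg k c m
  | _, _, _, .var i, _, r => .var (r i)
  | _, _, _, .symb S e, _, r => .symb S (fun i => (e i).ren r)
  | _, _, _, .mvar s m x t, _, r => .mvar s m x (fun j => (t j).ren r)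
  | _, _, _, .dummy s, _, _ => .dummy s
  | _, _, _, .abs e, _, r => .abs (e.ren (liftRen r))

/-- Weakening by one variable. -/
def Arg.wk {n : ℕ} {c : Cls} {m : ℕ} (e : Arg Sg n c m) : Arg Sg (n + 1) c m :=
  e.ren Fin.castSucc

/-- A substitution lifted under one binder. -/
def liftSub {n k : ℕ} (f : Fin n → Tm Sg k) : Fin (n + 1) → Tm Sg (k + 1) :=
  extend (fun i => (f i).wk) (.var (Fin.last k))

/-- Simultaneous substitution of terms for all variables. -/
def Arg.sub : {n : ℕ} → {c : Cls} → {m : ℕ} → Arg Sg n c m → {k : ℕ} → (Fin n → Tm Sg k) → Arg Sg k c m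
  | _, _, _, .var i, _, f => f i
  | _, _, _, .symb S e, _, f => .symb S (fun i => (e i).sub f)
  | _, _, _, .mvar s m x t, _, f => .mvar s m x (fun j => (t j).sub f)
  | _, _, _, .dummy s, _, _ => .dummy s
  | _, _, _, .abs e, _, f => .abs (e.sub (liftSub f))

/-- For `e = {x₁}⋯{xₘ} e'`, the result of substituting `t₁, …, tₘ` for `x₁, …, xₘ` in `e'`, and `f`
for the variables in scope of `e`. -/
def Arg.apply {c : Cls} {k : ℕ} :
    {m : ℕ} → {n : ℕ} → Arg Sg n c m → (Fin n → Tm Sg k) → (Fin m → Tm Sg k) → Arg Sg k c 0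
  | 0, _, e, f, _ => e.sub f
  | _ + 1, _, .abs e, f, t => e.apply (extend f (t 0)) (fun j => t j.succ)

/-- The set of metavariables occurring in an argument. -/
def Arg.mv : {n : ℕ} → {c : Cls} → {m : ℕ} → Arg Sg n c m → Set MV
  | _, _, _, .var _ => ∅
  | _, _, _, .symb _ e => ⋃ i, (e i).mv
  | _, _, _, .mvar s m x t => insert ⟨⟨.obj s, m⟩, x⟩ (⋃ j, (t j).mv)
  | _, _, _, .dummy _ => ∅
  | _, _, _, .abs e => e.mv

/-- `M(t₁, …, tₘ)`, which is the dummy expression if `M` is an equality metavariable. -/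
def MV.app {n : ℕ} : (M : MV) → (Fin M.ar.num → Tm Sg n) → Arg Sg n M.ar.cls 0
  | ⟨⟨.obj s, m⟩, x⟩, t => .mvar s m x t
  | ⟨⟨.eq s, _⟩, _⟩, _ => .dummy s

/-- `{x₁}⋯{xₘ} f(x₁, …, xₘ)`, where the body `f` is given in any scope `k` that contains the `m`
bound variables. -/
def lams {c : Cls} : (m : ℕ) → {n : ℕ} → ((k : ℕ) → (Fin n → Fin k) → (Fin m → Fin k) → Arg Sg k c 0) →
    Arg Sg n c m
  | 0, n, f => f n id Fin.elim0
  | m + 1, n, f =>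
      .abs (lams m (n := n + 1) (fun k r xs =>
        f k (fun i => r i.castSucc) (Fin.cons (α := fun _ => Fin k) (r (Fin.last n)) xs)))

/-- The generic application of `M`: `{x₁}⋯{xₘ} M(x₁, …, xₘ)` for an object metavariable and
`{x₁}⋯{xₘ} ⋆` for an equality metavariable. -/
def MV.gen (M : MV) {n : ℕ} : Arg Sg n M.ar.cls M.ar.num :=
  lams M.ar.num (fun _ _ xs => M.app (fun j => .var (xs j)))

/-! ### Judgements and boundaries -/

/-- Judgement theses. The dummy heads of the two equations are left implicit. -/
inductive Thesis (Sg : Signature.{u}) (n : ℕ) : Cls → Type u where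
  | isTy (A : Ty Sg n) : Thesis Sg n (.obj .ty)
  | ofTy (t : Tm Sg n) (A : Ty Sg n) : Thesis Sg n (.obj .tm)
  | eqTy (A B : Ty Sg n) : Thesis Sg n (.eq .ty)
  | eqTm (s t : Tm Sg n) (A : Ty Sg n) : Thesis Sg n (.eq .tm)

/-- Abstracted judgements. -/
inductive Judg (Sg : Signature.{u}) : ℕ → Cls → ℕ → Type u where
  | thesis {n : ℕ} {c : Cls} (J : Thesis Sg n c) : Judg Sg n c 0
  | abs {n : ℕ} {c : Cls} {m : ℕ} (A : Ty Sg n) (J : Judg Sg (n + 1) c m) : Judg Sg n c (m + 1)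

/-- Boundary theses. -/
inductive BThesis (Sg : Signature.{u}) (n : ℕ) : Cls → Type u where
  | isTy : BThesis Sg n (.obj .ty)
  | ofTy (A : Ty Sg n) : BThesis Sg n (.obj .tm)
  | eqTy (A B : Ty Sg n) : BThesis Sg n (.eq .ty)
  | eqTm (s t : Tm Sg n) (A : Ty Sg n) : BThesis Sg n (.eq .tm)

/-- Abstracted boundaries of arity `(c, m)`. -/
inductive Bdry (Sg : Signature.{u}) : ℕ → Cls → ℕ → Type u where
  | thesis {n : ℕ} {c : Cls} (B : BThesis Sg n c) : Bdry Sg n c 0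
  | abs {n : ℕ} {c : Cls} {m : ℕ} (A : Ty Sg n) (B : Bdry Sg (n + 1) c m) : Bdry Sg n c (m + 1)

/-- Filling a boundary thesis with a head. -/
def BThesis.plug {n : ℕ} : {c : Cls} → BThesis Sg n c → Arg Sg n c 0 → Thesis Sg n c
  | _, .isTy, e => .isTy e
  | _, .ofTy A, e => .ofTy e A
  | _, .eqTy A B, _ => .eqTy A B
  | _, .eqTm s t A, _ => .eqTm s t A

/-- Filling an object boundary thesis with an equation. -/
def BThesis.plugEq {n : ℕ} : {s : Srt} → BThesis Sg n (.obj s) → Arg Sg n (.obj s) 0 →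
    Arg Sg n (.obj s) 0 → Thesis Sg n (.eq s)
  | _, .isTy, e, e' => .eqTy e e'
  | _, .ofTy A, e, e' => .eqTm e e' A

/-- Filling an abstracted boundary with a head. -/
def Bdry.plug : {n : ℕ} → {c : Cls} → {m : ℕ} → Bdry Sg n c m → Arg Sg n c m → Judg Sg n c m
  | _, _, _, .thesis B, e => .thesis (B.plug e)
  | _, _, _, .abs A B, .abs e => .abs A (B.plug e)

/-- Filling an abstracted object boundary with an equation. -/
def Bdry.plugEq {s : Srt} : {n : ℕ} → {m : ℕ} → Bdry Sg n (.obj s) m → Arg Sg n (.obj s) m →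
    Arg Sg n (.obj s) m → Judg Sg n (.eq s) m
  | _, _, .thesis B, e, e' => .thesis (B.plugEq e e')
  | _, _, .abs A B, .abs e, .abs e' => .abs A (B.plugEq e e')

/-- For boundaries `□ : A` and `□ : A'` the equation `A ≡ A'`; nothing for other boundaries. -/
def BThesis.tyEq {n : ℕ} : {c : Cls} → BThesis Sg n c → BThesis Sg n c → Option (Thesis Sg n (.eq .ty))
  | _, .ofTy A, .ofTy A' => some (.eqTy A A')
  | _, _, _ => none

def BThesis.sub {n k : ℕ} (f : Fin n → Tm Sg k) : {c : Cls} → BThesis Sg n c → BThesis Sg k c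
  | _, .isTy => .isTy
  | _, .ofTy A => .ofTy (A.sub f)
  | _, .eqTy A B => .eqTy (A.sub f) (B.sub f)
  | _, .eqTm s t A => .eqTm (s.sub f) (t.sub f) (A.sub f)

/-- For `{x₁ : A₁}⋯{xₘ : Aₘ} B`, the type `A_j[t₁/x₁, …, t_{j-1}/x_{j-1}]` (and `f` substituted for
the variables in scope). -/
def Bdry.argTy {c : Cls} {k : ℕ} :
    {n : ℕ} → {m : ℕ} → Bdry Sg n c m → (Fin n → Tm Sg k) → (Fin m → Tm Sg k) → Fin m → Ty Sg k
  | _, _, .thesis _, _, _ => Fin.elim0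
  | _, _, .abs A B, f, t =>
      Fin.cons (α := fun _ => Ty Sg k) (A.sub f) (B.argTy (extend f (t 0)) (fun j => t j.succ))

/-- For `{x₁ : A₁}⋯{xₘ : Aₘ} B`, the boundary thesis `B[t₁/x₁, …, tₘ/xₘ]` (and `f` substituted for
the variables in scope). -/
def Bdry.apply {c : Cls} {k : ℕ} :
    {n : ℕ} → {m : ℕ} → Bdry Sg n c m → (Fin n → Tm Sg k) → (Fin m → Tm Sg k) → BThesis Sg k c
  | _, _, .thesis B, f, _ => B.sub f
  | _, _, .abs _ B, f, t => B.apply (extend f (t 0)) (fun j => t j.succ)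

def Thesis.mv {n : ℕ} : {c : Cls} → Thesis Sg n c → Set MV
  | _, .isTy A => A.mv
  | _, .ofTy t A => t.mv ∪ A.mv
  | _, .eqTy A B => A.mv ∪ B.mv
  | _, .eqTm s t A => s.mv ∪ t.mv ∪ A.mv

def Judg.mv : {n : ℕ} → {c : Cls} → {m : ℕ} → Judg Sg n c m → Set MV
  | _, _, _, .thesis J => J.mv
  | _, _, _, .abs A J => A.mv ∪ J.mv

def BThesis.mv {n : ℕ} : {c : Cls} → BThesis Sg n c → Set MV
  | _, .isTy => ∅
  | _, .ofTy A => A.mv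
  | _, .eqTy A B => A.mv ∪ B.mv
  | _, .eqTm s t A => s.mv ∪ t.mv ∪ A.mv

def Bdry.mv : {n : ℕ} → {c : Cls} → {m : ℕ} → Bdry Sg n c m → Set MV
  | _, _, _, .thesis B => B.mv
  | _, _, _, .abs A B => A.mv ∪ B.mv

/-- Metavariable contexts `[M₁ : 𝓑₁, …, Mₙ : 𝓑ₙ]`; the boundaries are closed. -/
abbrev MCtx (Sg : Signature.{u}) : Type u := List (Σ M : MV, Bdry Sg 0 M.ar.cls M.ar.num)

/-- The list of metavariables of a metavariable context. -/
def MCtx.names (X : MCtx Sg) : List MV := X.map (fun p => p.1)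

/-- The set of metavariables of a metavariable context. -/
def MCtx.dom (X : MCtx Sg) : Set MV := {M | M ∈ X.names}

/-- The set of object metavariables of a metavariable context. -/
def MCtx.objmv (X : MCtx Sg) : Set MV := {M | M ∈ X.names ∧ M.isObj = true}

/-- Syntactic well-formedness: the metavariables are distinct, and each boundary mentions only the
preceding ones. -/
def MCtx.Valid (X : MCtx Sg) : Prop :=
  X.names.Nodup ∧ ∀ (X₁ : MCtx Sg) (M : MV) (B : Bdry Sg 0 M.ar.cls M.ar.num) (X₂ : MCtx Sg),
    X = X₁ ++ ⟨M, B⟩ :: X₂ → B.mv ⊆ X₁.dom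

/-- Variable contexts with `n` variables. -/
inductive Ctx (Sg : Signature.{u}) : ℕ → Type u where
  | nil : Ctx Sg 0
  | snoc {n : ℕ} (G : Ctx Sg n) (A : Ty Sg n) : Ctx Sg (n + 1)

/-- The type of the `i`-th variable, weakened to the whole context. -/
def Ctx.get : {n : ℕ} → Ctx Sg n → Fin n → Ty Sg n
  | _, .nil => Fin.elim0
  | _, .snoc G A => extend (fun j => (G.get j).wk) A.wk

def Ctx.mv : {n : ℕ} → Ctx Sg n → Set MV
  | _, .nil => ∅
  | _, .snoc G A => G.mv ∪ A.mv

/-- Hypothetical judgements `X; G ⊢ J` and hypothetical boundaries `X; G ⊢ B`. -/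
inductive Hyp (Sg : Signature.{u}) : Type u where
  | judg (X : MCtx Sg) {n : ℕ} (G : Ctx Sg n) {c : Cls} {m : ℕ} (J : Judg Sg n c m)
  | bdry (X : MCtx Sg) {n : ℕ} (G : Ctx Sg n) {c : Cls} {m : ℕ} (B : Bdry Sg n c m)

/-- A hypothetical judgement or boundary with an unabstracted thesis. -/
abbrev Hyp.thesis (X : MCtx Sg) {n : ℕ} (G : Ctx Sg n) {c : Cls} (J : Thesis Sg n c) : Hyp Sg :=
  .judg X G (.thesis J)

/-- Syntactic validity of hypothetical judgements and boundaries. -/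
def Hyp.Valid : Hyp Sg → Prop
  | .judg X G J => X.Valid ∧ G.mv ⊆ X.dom ∧ J.mv ⊆ X.dom
  | .bdry X G B => X.Valid ∧ G.mv ⊆ X.dom ∧ B.mv ⊆ X.dom

/-! ### Instantiations -/

/-- Finite maps from metavariables to arguments of the same arity with `g` variables in scope. -/
def Inst (Sg : Signature.{u}) (g : ℕ) : Type u := (M : MV) → Option (Arg Sg g M.ar.cls M.ar.num)

/-- `I` is an instantiation of `Y` over the metavariable context `X` and `g` variables. -/
def Inst.Over {g : ℕ} (I : Inst Sg g) (Y X : MCtx Sg) : Prop :=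
  (∀ M, (I M).isSome ↔ M ∈ Y.names) ∧
    ∀ (M : MV) (e : Arg Sg g M.ar.cls M.ar.num), I M = some e → e.mv ⊆ X.dom

/-- Restriction of an instantiation to the metavariables of `Y`. -/
def Inst.restrict {g : ℕ} (I : Inst Sg g) (Y : MCtx Sg) : Inst Sg g :=
  fun M => if M ∈ Y.names then I M else none

/-- The action of an instantiation over `g` variables on an expression with `d` variables in scope.
The result lives in a scope `n` that contains the former through `a` and the latter through `r`. -/
def Arg.act {g : ℕ} (I : Inst Sg g) : {d : ℕ} → {c : Cls} → {m : ℕ} → Arg Sg d c m →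
    {n : ℕ} → (Fin g → Fin n) → (Fin d → Fin n) → Arg Sg n c m
  | _, _, _, .var i, _, _, r => .var (r i)
  | _, _, _, .symb S e, _, a, r => .symb S (fun i => (e i).act I a r)
  | _, _, _, .mvar s m x t, _, a, r =>
      match I ⟨⟨.obj s, m⟩, x⟩ with
      | some e => e.apply (fun i => .var (a i)) (fun j => (t j).act I a r)
      | none => .mvar s m x (fun j => (t j).act I a r)
  | _, _, _, .dummy s, _, _, _ => .dummy s
  | _, _, _, .abs e, _, a, r => .abs (e.act I (fun i => (a i).castSucc) (liftRen r))

def BThesis.act {g d n : ℕ} (I : Inst Sg g) (a : Fin g → Fin n) (r : Fin d → Fin n) :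
    {c : Cls} → BThesis Sg d c → BThesis Sg n c
  | _, .isTy => .isTy
  | _, .ofTy A => .ofTy (A.act I a r)
  | _, .eqTy A B => .eqTy (A.act I a r) (B.act I a r)
  | _, .eqTm s t A => .eqTm (s.act I a r) (t.act I a r) (A.act I a r)

def Bdry.act {g : ℕ} (I : Inst Sg g) : {d : ℕ} → {c : Cls} → {m : ℕ} → Bdry Sg d c m →
    {n : ℕ} → (Fin g → Fin n) → (Fin d → Fin n) → Bdry Sg n c m
  | _, _, _, .thesis B, _, a, r => .thesis (B.act I a r)
  | _, _, _, .abs A B, _, a, r => .abs (A.act I a r) (B.act I (fun i => (a i).castSucc) (liftRen r))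

/-- The action on closed arguments. -/
def Inst.onArg {g : ℕ} (I : Inst Sg g) {c : Cls} {m : ℕ} (e : Arg Sg 0 c m) : Arg Sg g c m :=
  e.act I id Fin.elim0

/-- The action on closed boundary theses. -/
def Inst.onBThesis {g : ℕ} (I : Inst Sg g) {c : Cls} (B : BThesis Sg 0 c) : BThesis Sg g c :=
  B.act I id Fin.elim0

/-- The action on closed abstracted boundaries. -/
def Inst.onBdry {g : ℕ} (I : Inst Sg g) {c : Cls} {m : ℕ} (B : Bdry Sg 0 c m) : Bdry Sg g c m :=
  B.act I id Fin.elim0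

/-- For `Y = [M₁ : 𝓑₁, …, Mₙ : 𝓑ₙ]` and `I = ⟨M₁ ↦ e₁, …, Mₙ ↦ eₙ⟩`, the judgements
`X; G ⊢ (I₍ᵢ₎ 𝓑ᵢ)[eᵢ]` for `i = 1, …, n`. -/
def Inst.premises {g : ℕ} (I : Inst Sg g) (Y X : MCtx Sg) (G : Ctx Sg g) : Set (Hyp Sg) :=
  {p | ∃ (Y₁ : MCtx Sg) (M : MV) (B : Bdry Sg 0 M.ar.cls M.ar.num) (Y₂ : MCtx Sg)
      (e : Arg Sg g M.ar.cls M.ar.num),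
    Y = Y₁ ++ ⟨M, B⟩ :: Y₂ ∧ I M = some e ∧ p = .judg X G (((I.restrict Y₁).onBdry B).plug e)}

/-- With `J = ⟨M₁ ↦ e'₁, …, Mₙ ↦ e'ₙ⟩` in addition, the judgements `X; G ⊢ (I₍ᵢ₎ 𝓑ᵢ)[eᵢ ≡ e'ᵢ]` for
the object boundaries `𝓑ᵢ`. -/
def Inst.eqPremises {g : ℕ} (I J : Inst Sg g) (Y X : MCtx Sg) (G : Ctx Sg g) : Set (Hyp Sg) :=
  {p | ∃ (Y₁ : MCtx Sg) (s : Srt) (m x : ℕ) (B : Bdry Sg 0 (.obj s) m) (Y₂ : MCtx Sg)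
      (e e' : Arg Sg g (.obj s) m),
    Y = Y₁ ++ ⟨⟨⟨.obj s, m⟩, x⟩, B⟩ :: Y₂ ∧ I ⟨⟨.obj s, m⟩, x⟩ = some e ∧
      J ⟨⟨.obj s, m⟩, x⟩ = some e' ∧ p = .judg X G (((I.restrict Y₁).onBdry B).plugEq e e')}

/-! ### Raw rules, raw type theories, derivability -/

/-- Raw rules `prem ⟹ bdry[head]` with a conclusion of class `c`. -/
structure RawRule (Sg : Signature.{u}) (c : Cls) where
  prem : MCtx Sg
  bdry : BThesis Sg 0 c
  head : Arg Sg 0 c 0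
  valid : (Hyp.thesis prem .nil (bdry.plug head)).Valid

/-- The conclusion of a raw rule, as a hypothetical judgement over its premises. -/
def RawRule.judgement {c : Cls} (R : RawRule Sg c) : Hyp Sg :=
  .thesis R.prem .nil (R.bdry.plug R.head)

/-- A raw type theory: a family of raw rules, sorted by the class of the conclusion. -/
structure RawTheory (Sg : Signature.{u}) where
  Idx : Cls → Type v
  rule : {c : Cls} → Idx c → RawRule Sg c

/-- The closure rules of the deductive system associated with `T`, given by the finite set of premises
and the conclusion. -/
inductive ClosureRule (T : RawTheory.{u, v} Sg) : Set (Hyp Sg) → Hyp Sg → Prop where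
  | var (X : MCtx Sg) {n : ℕ} (G : Ctx Sg n) (i : Fin n) :
      ClosureRule T ∅ (.thesis X G (.ofTy (.var i) (G.get i)))
  | metaApp (X : MCtx Sg) {n : ℕ} (G : Ctx Sg n) (M : MV) (B : Bdry Sg 0 M.ar.cls M.ar.num)
      (hM : ⟨M, B⟩ ∈ X) (t : Fin M.ar.num → Tm Sg n) :
      ClosureRule T
        ({p | ∃ j, p = .thesis X G (.ofTy (t j) (B.argTy Fin.elim0 t j))} ∪
          {.bdry X G (.thesis (B.apply Fin.elim0 t))})
        (.thesis X G ((B.apply Fin.elim0 t).plug (M.app t)))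
  | metaCongr (X : MCtx Sg) {n : ℕ} (G : Ctx Sg n) (s : Srt) (m x : ℕ) (B : Bdry Sg 0 (.obj s) m)
      (hM : ⟨⟨⟨.obj s, m⟩, x⟩, B⟩ ∈ X) (t t' : Fin m → Tm Sg n) :
      ClosureRule T
        ({p | ∃ j, p = .thesis X G (.ofTy (t j) (B.argTy Fin.elim0 t j))} ∪
          {p | ∃ j, p = .thesis X G (.ofTy (t' j) (B.argTy Fin.elim0 t' j))} ∪
          {p | ∃ j, p = .thesis X G (.eqTm (t j) (t' j) (B.argTy Fin.elim0 t j))} ∪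
          {p | ∃ E, (B.apply Fin.elim0 t).tyEq (B.apply Fin.elim0 t') = some E ∧ p = .thesis X G E})
        (.thesis X G ((B.apply Fin.elim0 t).plugEq (.mvar s m x t) (.mvar s m x t')))
  | abstr (X : MCtx Sg) {n : ℕ} (G : Ctx Sg n) (A : Ty Sg n) {c : Cls} {m : ℕ} (J : Judg Sg (n + 1) c m) :
      ClosureRule T {.thesis X G (.isTy A), .judg X (G.snoc A) J} (.judg X G (.abs A J))
  | tyRefl (X : MCtx Sg) {n : ℕ} (G : Ctx Sg n) (A : Ty Sg n) :
      ClosureRule T {.thesis X G (.isTy A)} (.thesis X G (.eqTy A A))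
  | tySym (X : MCtx Sg) {n : ℕ} (G : Ctx Sg n) (A B : Ty Sg n) :
      ClosureRule T {.thesis X G (.eqTy A B)} (.thesis X G (.eqTy B A))
  | tyTran (X : MCtx Sg) {n : ℕ} (G : Ctx Sg n) (A B C : Ty Sg n) :
      ClosureRule T {.thesis X G (.eqTy A B), .thesis X G (.eqTy B C)} (.thesis X G (.eqTy A C))
  | tmRefl (X : MCtx Sg) {n : ℕ} (G : Ctx Sg n) (t : Tm Sg n) (A : Ty Sg n) :
      ClosureRule T {.thesis X G (.ofTy t A)} (.thesis X G (.eqTm t t A))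
  | tmSym (X : MCtx Sg) {n : ℕ} (G : Ctx Sg n) (s t : Tm Sg n) (A : Ty Sg n) :
      ClosureRule T {.thesis X G (.eqTm s t A)} (.thesis X G (.eqTm t s A))
  | tmTran (X : MCtx Sg) {n : ℕ} (G : Ctx Sg n) (s t w : Tm Sg n) (A : Ty Sg n) :
      ClosureRule T {.thesis X G (.eqTm s t A), .thesis X G (.eqTm t w A)} (.thesis X G (.eqTm s w A))
  | convTm (X : MCtx Sg) {n : ℕ} (G : Ctx Sg n) (t : Tm Sg n) (A B : Ty Sg n) :
      ClosureRule T {.thesis X G (.ofTy t A), .thesis X G (.eqTy A B)} (.thesis X G (.ofTy t B))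
  | convEq (X : MCtx Sg) {n : ℕ} (G : Ctx Sg n) (s t : Tm Sg n) (A B : Ty Sg n) :
      ClosureRule T {.thesis X G (.eqTm s t A), .thesis X G (.eqTy A B)} (.thesis X G (.eqTm s t B))
  | bdryTy (X : MCtx Sg) {n : ℕ} (G : Ctx Sg n) :
      ClosureRule T ∅ (.bdry X G (.thesis .isTy))
  | bdryTm (X : MCtx Sg) {n : ℕ} (G : Ctx Sg n) (A : Ty Sg n) :
      ClosureRule T {.thesis X G (.isTy A)} (.bdry X G (.thesis (.ofTy A)))
  | bdryEqTy (X : MCtx Sg) {n : ℕ} (G : Ctx Sg n) (A B : Ty Sg n) :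
      ClosureRule T {.thesis X G (.isTy A), .thesis X G (.isTy B)} (.bdry X G (.thesis (.eqTy A B)))
  | bdryEqTm (X : MCtx Sg) {n : ℕ} (G : Ctx Sg n) (s t : Tm Sg n) (A : Ty Sg n) :
      ClosureRule T {.thesis X G (.isTy A), .thesis X G (.ofTy s A), .thesis X G (.ofTy t A)}
        (.bdry X G (.thesis (.eqTm s t A)))
  | bdryAbstr (X : MCtx Sg) {n : ℕ} (G : Ctx Sg n) (A : Ty Sg n) {c : Cls} {m : ℕ}
      (B : Bdry Sg (n + 1) c m) :
      ClosureRule T {.thesis X G (.isTy A), .bdry X (G.snoc A) B} (.bdry X G (.abs A B))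
  /-- The instantiations of the specific rules. -/
  | specific {c : Cls} (i : T.Idx c) (X : MCtx Sg) {n : ℕ} (G : Ctx Sg n) (I : Inst Sg n)
      (hI : I.Over (T.rule i).prem X) :
      ClosureRule T
        (I.premises (T.rule i).prem X G ∪ {.bdry X G (.thesis (I.onBThesis (T.rule i).bdry))})
        (.thesis X G ((I.onBThesis (T.rule i).bdry).plug (I.onArg (T.rule i).head)))
  /-- The congruence rules associated with the specific object rules. -/
  | congr {s : Srt} (i : T.Idx (.obj s)) (X : MCtx Sg) {n : ℕ} (G : Ctx Sg n) (I J : Inst Sg n)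
      (hI : I.Over (T.rule i).prem X) (hJ : J.Over (T.rule i).prem X) :
      ClosureRule T
        (I.premises (T.rule i).prem X G ∪ J.premises (T.rule i).prem X G ∪
          I.eqPremises J (T.rule i).prem X G ∪
          {p | ∃ E, (I.onBThesis (T.rule i).bdry).tyEq (J.onBThesis (T.rule i).bdry) = some E ∧
            p = .thesis X G E})
        (.thesis X G ((I.onBThesis (T.rule i).bdry).plugEq (I.onArg (T.rule i).head)
          (J.onArg (T.rule i).head)))

/-- Derivability: the least set of syntactically valid hypothetical judgements and boundaries that is
closed under the closure rules between such. -/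
inductive Derivable (T : RawTheory.{u, v} Sg) : Hyp Sg → Prop where
  | mk {P : Set (Hyp Sg)} {q : Hyp Sg} (hr : ClosureRule T P q) (hP : ∀ p ∈ P, p.Valid) (hq : q.Valid)
      (h : ∀ p ∈ P, Derivable T p) : Derivable T q

/-- `⊢ X mctx`: well-formed metavariable contexts. -/
inductive MCtxDerivable (T : RawTheory.{u, v} Sg) : MCtx Sg → Prop where
  | nil : MCtxDerivable T []
  | extend (X : MCtx Sg) (M : MV) (B : Bdry Sg 0 M.ar.cls M.ar.num) (hX : MCtxDerivable T X)
      (hB : Derivable T (.bdry X .nil B)) (hM : M ∉ X.names) : MCtxDerivable T (X ++ [⟨M, B⟩])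

/-- A derivable instantiation of `Y` over `X; G`. -/
def Inst.IsDerivable (T : RawTheory.{u, v} Sg) {g : ℕ} (I : Inst Sg g) (Y X : MCtx Sg) (G : Ctx Sg g) :
    Prop :=
  I.Over Y X ∧ ∀ p ∈ I.premises Y X G, Derivable T p

/-! ### Finitary and standard type theories -/

/-- A raw rule is derivable when it is so as a judgement. -/
def RawRule.IsDerivable (T : RawTheory.{u, v} Sg) {c : Cls} (R : RawRule Sg c) : Prop :=
  Derivable T R.judgement

/-- Finitary rules with respect to `T`. -/
def RawRule.IsFinitary (T : RawTheory.{u, v} Sg) {c : Cls} (R : RawRule Sg c) : Prop :=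
  MCtxDerivable T R.prem ∧ Derivable T (.bdry R.prem .nil (.thesis R.bdry))

/-- Finitary type theories. -/
def RawTheory.IsFinitary (T : RawTheory.{u, v} Sg) : Prop :=
  ∀ (c : Cls) (i : T.Idx c), (T.rule i).IsFinitary T

/-- `R` is a symbol rule for `S`: its head is `S(q₁, …, qₙ)`, where `q₁, …, qₙ` are the generic
applications of its premises (in particular, `S` has the arity given by the premises). -/
def RawRule.IsSymbolRule {s : Srt} (R : RawRule Sg (.obj s)) (S : Sg.Sym) : Prop :=
  ∃ q : (i : Fin (Sg.num S)) → Arg Sg 0 (Sg.arg S i).cls (Sg.arg S i).num,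
    (⟨.obj s, R.head⟩ : Σ c : Cls, Arg Sg 0 c 0) = ⟨.obj (Sg.srt S), .symb S q⟩ ∧
    R.prem.map (fun p => (⟨p.1.ar, p.1.gen⟩ : Σ a : Arity, Arg Sg 0 a.cls a.num)) =
      List.ofFn (fun i => ⟨Sg.arg S i, q i⟩)

/-- Standard type theories: finitary ones whose specific object rules are symbol rules, with precisely
one rule for each symbol. -/
def RawTheory.IsStandard (T : RawTheory.{u, v} Sg) : Prop :=
  T.IsFinitary ∧
  (∀ (s : Srt) (i : T.Idx (.obj s)), ∃ S : Sg.Sym, (T.rule i).IsSymbolRule S) ∧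
  ∀ S : Sg.Sym, ∃! i : (Σ s : Srt, T.Idx (.obj s)), (T.rule i.2).IsSymbolRule S

/-! ### Naturality for variables, patterns, object-invertibility -/

/-- The relation that defines the object judgements `X; G ⊢ J` that are natural for variables. -/
inductive Natural (T : RawTheory.{u, v} Sg) (X : MCtx Sg) :
    {n : ℕ} → Ctx Sg n → {c : Cls} → {m : ℕ} → Judg Sg n c m → Prop where
  | var {n : ℕ} (G : Ctx Sg n) (i : Fin n) : Natural T X G (.thesis (.ofTy (.var i) (G.get i)))
  | abs {n : ℕ} (G : Ctx Sg n) (A : Ty Sg n) {c : Cls} {m : ℕ} (J : Judg Sg (n + 1) c m)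
      (h : Natural T X (G.snoc A) J) : Natural T X G (.abs A J)
  | metaApp {n : ℕ} (G : Ctx Sg n) (s : Srt) (m x : ℕ) (B : Bdry Sg 0 (.obj s) m)
      (hM : ⟨⟨⟨.obj s, m⟩, x⟩, B⟩ ∈ X) (t : Fin m → Tm Sg n)
      (h : ∀ j, Natural T X G (.thesis (.ofTy (t j) (B.argTy Fin.elim0 t j)))) :
      Natural T X G (.thesis ((B.apply Fin.elim0 t).plug (.mvar s m x t)))
  /-- Here `i` is the rule for `S`, and `I` maps its premises to `e₁, …, eₙ`, in this order. -/
  | symb {n : ℕ} (G : Ctx Sg n) (S : Sg.Sym)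
      (e : (i : Fin (Sg.num S)) → Arg Sg n (Sg.arg S i).cls (Sg.arg S i).num)
      {s : Srt} (i : T.Idx (.obj s)) (hi : (T.rule i).IsSymbolRule S) (I : Inst Sg n)
      (hI : I.Over (T.rule i).prem X)
      (he : (T.rule i).prem.map
          (fun p => (⟨p.1.ar, I p.1⟩ : Σ a : Arity, Option (Arg Sg n a.cls a.num))) =
        List.ofFn (fun j => ⟨Sg.arg S j, some (e j)⟩))
      (h : ∀ (Y₁ : MCtx Sg) (M : MV) (B : Bdry Sg 0 M.ar.cls M.ar.num) (Y₂ : MCtx Sg)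
        (f : Arg Sg n M.ar.cls M.ar.num), (T.rule i).prem = Y₁ ++ ⟨M, B⟩ :: Y₂ → M.isObj = true →
        I M = some f → Natural T X G (((I.restrict Y₁).onBdry B).plug f))
      (B' : BThesis Sg n (.obj (Sg.srt S))) :
      Natural T X G (.thesis (B'.plug (.symb S e)))

/-- A rule is natural for variables when it is so as a judgement. -/
def RawRule.IsNatural (T : RawTheory.{u, v} Sg) {c : Cls} (R : RawRule Sg c) : Prop :=
  Natural T R.prem .nil (.thesis (R.bdry.plug R.head))

/-- Argument patterns: generic applications `{x₁}⋯{xₘ} M(x₁, …, xₘ)` (the dummy arguments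
`{x₁}⋯{xₘ} ⋆` included), and linear applications of symbols to argument patterns. A type pattern `M()`
is a generic application with `m = 0`. -/
inductive IsArgPattern : {n : ℕ} → {c : Cls} → {m : ℕ} → Arg Sg n c m → Prop where
  | gen {n : ℕ} (M : MV) : IsArgPattern (M.gen : Arg Sg n M.ar.cls M.ar.num)
  | symb {n : ℕ} (S : Sg.Sym) (q : (i : Fin (Sg.num S)) → Arg Sg n (Sg.arg S i).cls (Sg.arg S i).num)
      (hq : ∀ i, IsArgPattern (q i)) (hd : ∀ i j, i ≠ j → Disjoint (q i).mv (q j).mv) :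
      IsArgPattern (.symb S q)

/-- Patterns: type metavariables `M()`, and linear applications of type or term symbols to argument
patterns. -/
inductive IsPattern : {n : ℕ} → {c : Cls} → Arg Sg n c 0 → Prop where
  | mvar {n : ℕ} (x : ℕ) (t : Fin 0 → Tm Sg n) : IsPattern (.mvar .ty 0 x t)
  | symb {n : ℕ} (S : Sg.Sym) (q : (i : Fin (Sg.num S)) → Arg Sg n (Sg.arg S i).cls (Sg.arg S i).num)
      (hq : ∀ i, IsArgPattern (q i)) (hd : ∀ i j, i ≠ j → Disjoint (q i).mv (q j).mv) :
      IsPattern (.symb S q)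

/-- The declarations `M : I₍ₖ₎ 𝓑ₖ` for the equality metavariables of `Y`, where `Y` is preceded
by `Y₀`. -/
def residueTail (I : Inst Sg 0) : MCtx Sg → MCtx Sg → MCtx Sg
  | _, [] => []
  | Y₀, ⟨M, B⟩ :: Y =>
      if M.isObj = true then residueTail I (Y₀ ++ [⟨M, B⟩]) Y
      else ⟨M, (I.restrict Y₀).onBdry B⟩ :: residueTail I (Y₀ ++ [⟨M, B⟩]) Y

/-- The equational residue of an instantiation `I` of `Y` over `X` and the empty variable context. -/
def residue (I : Inst Sg 0) (Y X : MCtx Sg) : MCtx Sg := X ++ residueTail I [] Y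

/-- The residual instantiation of `Y`: it agrees with `I` on object metavariables and maps equality
metavariables to their generic applications. -/
def residueInst (I : Inst Sg 0) (Y : MCtx Sg) : Inst Sg 0 :=
  fun M => if M ∈ Y.names then (if M.isObj = true then I M else some M.gen) else none

/-- Object-invertible rules. -/
def RawRule.IsObjectInvertible (T : RawTheory.{u, v} Sg) {c : Cls} (R : RawRule Sg c) : Prop :=
  R.IsDerivable T ∧
  ∀ (X : MCtx Sg) (I : Inst Sg 0), I.Over R.prem X → MCtxDerivable T X → Disjoint R.prem.dom X.dom →
    Derivable T (.thesis X .nil ((I.onBThesis R.bdry).plug (I.onArg R.head))) →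
    (residueInst I R.prem).IsDerivable T R.prem (residue I R.prem X) .nil

end FTT

/-! Inversion in a standard type theory says that a derivation of a judgement with head `S(e₁, …,
eₙ)` ends, up to conversions, in the unique rule for `S`. It therefore derives every premise of that
rule with `e₁, …, eₙ` filled in (`Derivable.symbInv`). Applied repeatedly to the head `I_* p`, this
descends along the symbols of the pattern `p` and ends at the values `I(M)` of the metavariables of
`p`. Each value comes with a derivable boundary, but that boundary is computed from the rules for
the symbols, whereas the boundary needed is the one that `Ξ` declares for `M`.

Naturality for variables closes this gap. Its derivation passes through the same symbols with the
same rules. Applying `I` to the boundary it assigns to an argument of a symbol gives the boundary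
found by inversion. At a leaf, naturality of `C[M̂]` forces `C = Ξ(M)`: the bound variables of `M̂`
are natural only at their declared types, and a boundary is recovered from its instance at distinct
fresh variables (`Natural.plug_gen`). Hence `(I_* Ξ(M))[I(M)]` is derivable for every `M` occurring
in `p`, that is, for every object metavariable (`Derivable.of_isArgPattern`).

For an equality metavariable the residue declares exactly the instantiated boundary, so its generic
application is derivable once this boundary is (`Derivable.plug_gen`). The boundary follows by
induction along `Ξ`: it is derivable over the preceding metavariables, and the residual
instantiation of these is derivable already (`residueInst_isDerivable`). Replacing `I` by the
residual instantiation does not change boundaries, because equality metavariables never occur in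
expressions.

The induction uses admissibility of instantiation (`Derivable.derivableInst`). The metavariable rule
then turns into substitution (`Derivable.derivableTypedSub`) and metavariable congruence into
substitution of equal terms (`Derivable.derivableSubEq`). Weakening of the metavariable context
carries the results for object metavariables over to the residue. -/

namespace FTT

variable {Sg : Signature.{u}}

/-! ### The calculus of substitutions -/

@[simp] theorem extend_castSucc {α : Type*} {n : ℕ} (f : Fin n → α) (a : α) (i : Fin n) :
    extend f a i.castSucc = f i := by simp [extend]

@[simp] theorem extend_last {α : Type*} {n : ℕ} (f : Fin n → α) (a : α) :
    extend f a (Fin.last n) = a := by simp [extend]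

theorem funext_last {α : Type*} {n : ℕ} {f g : Fin (n + 1) → α}
    (h : ∀ i : Fin n, f i.castSucc = g i.castSucc) (hl : f (Fin.last n) = g (Fin.last n)) : f = g :=
  funext fun i => Fin.lastCases hl h i

theorem comp_extend {α β : Type*} {n : ℕ} (φ : α → β) (f : Fin n → α) (a : α) :
    (fun i => φ (extend f a i)) = extend (fun i => φ (f i)) (φ a) :=
  funext_last (by simp) (by simp)

@[simp] theorem liftRen_castSucc {n k : ℕ} (r : Fin n → Fin k) (i : Fin n) :
    liftRen r i.castSucc = (r i).castSucc := by simp [liftRen]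

@[simp] theorem liftRen_last {n k : ℕ} (r : Fin n → Fin k) :
    liftRen r (Fin.last n) = Fin.last k := by simp [liftRen]

@[simp] theorem liftRen_id {n : ℕ} : liftRen (id : Fin n → Fin n) = id :=
  funext_last (by simp) (by simp)

@[simp] theorem liftSub_castSucc {n k : ℕ} (f : Fin n → Tm Sg k) (i : Fin n) :
    liftSub f i.castSucc = (f i).wk := by simp [liftSub]

@[simp] theorem liftSub_last {n k : ℕ} (f : Fin n → Tm Sg k) :
    liftSub f (Fin.last n) = .var (Fin.last k) := by simp [liftSub]

@[simp] theorem liftSub_var {n k : ℕ} (r : Fin n → Fin k) :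
    liftSub (Sg := Sg) (fun i => .var (r i)) = fun i => .var (liftRen r i) :=
  funext_last (by simp [Arg.wk, Arg.ren]) (by simp)

theorem Arg.ren_eq_sub {n : ℕ} {c : Cls} {m : ℕ} (e : Arg Sg n c m) {k : ℕ} (r : Fin n → Fin k) :
    e.ren r = e.sub (fun i => .var (r i)) := by
  induction e generalizing k with
  | var i => rfl
  | symb S e ih => simp [Arg.ren, Arg.sub, ih]
  | mvar s m x t ih => simp [Arg.ren, Arg.sub, ih]
  | dummy s => rfl
  | abs e ih => simp [Arg.ren, Arg.sub, ih]

/-- Lifting a substitution weakens its entries, so `Arg.sub_sub` needs the two mixed laws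
`Arg.ren_sub` and `Arg.sub_ren` beforehand. -/
theorem Arg.ren_sub {n : ℕ} {c : Cls} {m : ℕ} (e : Arg Sg n c m) {k l : ℕ} (r : Fin n → Fin k)
    (f : Fin k → Tm Sg l) : (e.ren r).sub f = e.sub (fun i => f (r i)) := by
  induction e generalizing k l with
  | var i => rfl
  | symb S e ih => simp [Arg.ren, Arg.sub, ih]
  | mvar s m x t ih => simp [Arg.ren, Arg.sub, ih]
  | dummy s => rfl
  | abs e ih =>
    simp only [Arg.ren, Arg.sub, ih, Arg.abs.injEq]
    congr 1
    exact funext_last (by simp) (by simp)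

theorem Arg.ren_ren {n : ℕ} {c : Cls} {m : ℕ} (e : Arg Sg n c m) {k l : ℕ} (r : Fin n → Fin k)
    (r' : Fin k → Fin l) : (e.ren r).ren r' = e.ren (fun i => r' (r i)) := by
  rw [ren_eq_sub _ r', ren_sub, ren_eq_sub]

theorem Arg.sub_ren {n : ℕ} {c : Cls} {m : ℕ} (e : Arg Sg n c m) {k l : ℕ} (f : Fin n → Tm Sg k)
    (r : Fin k → Fin l) : (e.sub f).ren r = e.sub (fun i => (f i).ren r) := by
  induction e generalizing k l with
  | var i => rfl
  | symb S e ih => simp [Arg.ren, Arg.sub, ih]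
  | mvar s m x t ih => simp [Arg.ren, Arg.sub, ih]
  | dummy s => rfl
  | abs e ih =>
    simp only [Arg.ren, Arg.sub, ih, Arg.abs.injEq]
    congr 1
    exact funext_last (by simp [Arg.wk, Arg.ren_ren]) (by simp [Arg.ren])

theorem Arg.wk_sub {n : ℕ} {c : Cls} {m : ℕ} (e : Arg Sg n c m) {k : ℕ} (f : Fin (n + 1) → Tm Sg k) :
    e.wk.sub f = e.sub (fun i => f i.castSucc) := ren_sub _ _ _

@[simp] theorem Arg.wk_sub_liftSub {n : ℕ} {c : Cls} {m : ℕ} (e : Arg Sg n c m) {k : ℕ}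
    (f : Fin n → Tm Sg k) : e.wk.sub (liftSub f) = (e.sub f).wk := by
  rw [wk_sub, wk, sub_ren]; simp [wk]

@[simp] theorem Arg.wk_sub_extend {n : ℕ} {c : Cls} {m : ℕ} (e : Arg Sg n c m) {k : ℕ}
    (f : Fin n → Tm Sg k) (t : Tm Sg k) : e.wk.sub (extend f t) = e.sub f := by
  simp [wk_sub]

theorem Arg.sub_sub {n : ℕ} {c : Cls} {m : ℕ} (e : Arg Sg n c m) {k l : ℕ} (f : Fin n → Tm Sg k)
    (g : Fin k → Tm Sg l) : (e.sub f).sub g = e.sub (fun i => (f i).sub g) := by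
  induction e generalizing k l with
  | var i => rfl
  | symb S e ih => simp [Arg.sub, ih]
  | mvar s m x t ih => simp [Arg.sub, ih]
  | dummy s => rfl
  | abs e ih =>
    simp only [Arg.sub, ih, Arg.abs.injEq]
    congr 1
    exact funext_last (by simp) (by simp [Arg.sub])

@[simp] theorem Arg.sub_var {n : ℕ} {c : Cls} {m : ℕ} (e : Arg Sg n c m) :
    e.sub (fun i => .var i) = e := by
  induction e with
  | var i => rfl
  | symb S e ih => simp [Arg.sub, ih]
  | mvar s m x t ih => simp [Arg.sub, ih]
  | dummy s => rfl
  | abs e ih =>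
    have h : ∀ k, liftSub (Sg := Sg) (fun i : Fin k => .var i) = fun i => .var i := fun k =>
      funext_last (by simp [Arg.wk, Arg.ren]) (by simp)
    simp [Arg.sub, h, ih]

open Classical in
/-- The partial inverse of renaming, along a partial inverse of a map between variables. -/
noncomputable def Arg.unren : {n : ℕ} → {c : Cls} → {m : ℕ} → Arg Sg n c m → {k : ℕ} →
    (Fin n → Option (Fin k)) → Option (Arg Sg k c m)
  | _, _, _, .var i, _, r => (r i).map .var
  | _, _, _, .symb S e, _, r =>
      if h : ∀ i, ((e i).unren r).isSome then some (.symb S (fun i => ((e i).unren r).get (h i))) else none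
  | _, _, _, .mvar s m x t, _, r =>
      if h : ∀ i, ((t i).unren r).isSome then some (.mvar s m x (fun i => ((t i).unren r).get (h i)))
      else none
  | _, _, _, .dummy s, _, _ => some (.dummy s)
  | _, _, _, .abs e, k, r =>
      (e.unren (extend (fun i => (r i).map Fin.castSucc) (some (Fin.last k)))).map .abs

theorem Arg.unren_ren {n : ℕ} {c : Cls} {m : ℕ} (e : Arg Sg n c m) {k : ℕ} {r : Fin n → Fin k}
    {r' : Fin k → Option (Fin n)} (hr : ∀ i, r' (r i) = some i) : (e.ren r).unren r' = some e := by
  induction e generalizing k with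
  | var i => simp [ren, unren, hr]
  | symb S e ih => simp [ren, unren, fun i => ih i hr]
  | mvar s m x t ih => simp [ren, unren, fun i => ih i hr]
  | dummy s => rfl
  | abs e ih =>
    simp only [ren, unren]
    rw [ih fun i => Fin.lastCases (by simp) (by simp [hr]) i]
    rfl

/-- A left inverse reduces this to an induction on a single expression; comparing two expressions
directly would require matching their class indices at every symbol. -/
theorem Arg.ren_injective {n : ℕ} {c : Cls} {m : ℕ} {k : ℕ} {r : Fin n → Fin k}
    (hr : Function.Injective r) : Function.Injective fun e : Arg Sg n c m => e.ren r := by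
  have hp := hr.isPartialInv
  have h (e : Arg Sg n c m) := e.unren_ren (r := r) (r' := Function.partialInv r) fun i => (hp i _).2 rfl
  intro e e' he
  have := congrArg (fun x => x.unren (Function.partialInv r)) he
  simpa [h] using this

/-! ### Application of abstractions -/

theorem Arg.apply_sub {c : Cls} {m n : ℕ} (e : Arg Sg n c m) {k l : ℕ} (f : Fin n → Tm Sg k)
    (t : Fin m → Tm Sg k) (g : Fin k → Tm Sg l) :
    (e.apply f t).sub g = e.apply (fun i => (f i).sub g) (fun j => (t j).sub g) := by
  induction m generalizing n with
  | zero => simp [Arg.apply, sub_sub]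
  | succ m ih =>
    cases e with
    | abs e => simp only [Arg.apply, ih, comp_extend (fun t : Tm Sg k => t.sub g)]

theorem Arg.sub_apply {c : Cls} {m n : ℕ} (e : Arg Sg n c m) {k l : ℕ} (h : Fin n → Tm Sg k)
    (f : Fin k → Tm Sg l) (t : Fin m → Tm Sg l) :
    (e.sub h).apply f t = e.apply (fun i => (h i).sub f) t := by
  induction m generalizing n k with
  | zero => simp [Arg.apply, sub_sub]
  | succ m ih =>
    cases e with
    | abs e =>
      simp only [Arg.sub, Arg.apply, ih]
      congr 1
      exact funext_last (by simp) (by simp [Arg.sub])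

/-- Substitution into abstracted boundaries. -/
def Bdry.sub : {n : ℕ} → {c : Cls} → {m : ℕ} → Bdry Sg n c m → {k : ℕ} → (Fin n → Tm Sg k) →
    Bdry Sg k c m
  | _, _, _, .thesis B, _, f => .thesis (B.sub f)
  | _, _, _, .abs A B, _, f => .abs (A.sub f) (B.sub (liftSub f))

/-- Substitution into judgement theses. -/
def Thesis.sub {n k : ℕ} (f : Fin n → Tm Sg k) : {c : Cls} → Thesis Sg n c → Thesis Sg k c
  | _, .isTy A => .isTy (A.sub f)
  | _, .ofTy t A => .ofTy (t.sub f) (A.sub f)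
  | _, .eqTy A B => .eqTy (A.sub f) (B.sub f)
  | _, .eqTm s t A => .eqTm (s.sub f) (t.sub f) (A.sub f)

/-- Substitution into abstracted judgements. -/
def Judg.sub : {n : ℕ} → {c : Cls} → {m : ℕ} → Judg Sg n c m → {k : ℕ} → (Fin n → Tm Sg k) →
    Judg Sg k c m
  | _, _, _, .thesis J, _, f => .thesis (J.sub f)
  | _, _, _, .abs A J, _, f => .abs (A.sub f) (J.sub (liftSub f))

theorem BThesis.sub_sub {n : ℕ} {c : Cls} (B : BThesis Sg n c) {k l : ℕ} (f : Fin n → Tm Sg k)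
    (g : Fin k → Tm Sg l) : (B.sub f).sub g = B.sub (fun i => (f i).sub g) := by
  cases B <;> simp [sub, Arg.sub_sub]

@[simp] theorem BThesis.sub_var {n : ℕ} {c : Cls} (B : BThesis Sg n c) :
    B.sub (fun i => .var i) = B := by
  cases B <;> simp [sub]

theorem BThesis.plug_sub {n : ℕ} {c : Cls} (B : BThesis Sg n c) (e : Arg Sg n c 0) {k : ℕ}
    (f : Fin n → Tm Sg k) : (B.plug e).sub f = (B.sub f).plug (e.sub f) := by
  cases B <;> rfl

theorem BThesis.plugEq_sub {n : ℕ} {s : Srt} (B : BThesis Sg n (.obj s)) (e e' : Arg Sg n (.obj s) 0)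
    {k : ℕ} (f : Fin n → Tm Sg k) :
    (B.plugEq e e').sub f = (B.sub f).plugEq (e.sub f) (e'.sub f) := by
  cases B <;> rfl

theorem BThesis.tyEq_sub {n : ℕ} {c : Cls} (B B' : BThesis Sg n c) {k : ℕ} (f : Fin n → Tm Sg k) :
    (B.sub f).tyEq (B'.sub f) = (B.tyEq B').map (Thesis.sub f) := by
  cases B <;> cases B' <;> rfl

theorem Bdry.plug_sub {n : ℕ} {c : Cls} {m : ℕ} (B : Bdry Sg n c m) (e : Arg Sg n c m) {k : ℕ}
    (f : Fin n → Tm Sg k) : (B.plug e).sub f = (B.sub f).plug (e.sub f) := by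
  induction B generalizing k with
  | thesis B => simp [plug, sub, Judg.sub, BThesis.plug_sub]
  | abs A B ih => cases e; simp [plug, sub, Judg.sub, Arg.sub, ih]

theorem Bdry.plugEq_sub {s : Srt} {m n : ℕ} (B : Bdry Sg n (.obj s) m) (e e' : Arg Sg n (.obj s) m)
    {k : ℕ} (f : Fin n → Tm Sg k) :
    (B.plugEq e e').sub f = (B.sub f).plugEq (e.sub f) (e'.sub f) := by
  induction m generalizing n k with
  | zero => cases B; simp [plugEq, sub, Judg.sub, BThesis.plugEq_sub]
  | succ m ih => cases B; cases e; cases e'; simp [plugEq, sub, Judg.sub, Arg.sub, ih]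

theorem Bdry.apply_sub {c : Cls} {m n : ℕ} (B : Bdry Sg n c m) {k l : ℕ} (f : Fin n → Tm Sg k)
    (t : Fin m → Tm Sg k) (g : Fin k → Tm Sg l) :
    (B.apply f t).sub g = B.apply (fun i => (f i).sub g) (fun j => (t j).sub g) := by
  induction B with
  | thesis B => simp [apply, BThesis.sub_sub]
  | abs A B ih => simp only [apply, ih, comp_extend (fun t : Tm Sg k => t.sub g)]

theorem Bdry.argTy_sub {c : Cls} {m n : ℕ} (B : Bdry Sg n c m) {k l : ℕ} (f : Fin n → Tm Sg k)
    (t : Fin m → Tm Sg k) (g : Fin k → Tm Sg l) (j : Fin m) :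
    (B.argTy f t j).sub g = B.argTy (fun i => (f i).sub g) (fun j => (t j).sub g) j := by
  induction B with
  | thesis B => exact j.elim0
  | abs A B ih =>
    refine Fin.cases ?_ (fun j => ?_) j
    · simp [argTy, Arg.sub_sub]
    · simp [argTy, ih, comp_extend (fun t : Tm Sg k => t.sub g)]

theorem sub_elim0 {k l : ℕ} (g : Fin k → Tm Sg l) :
    (fun i => ((Fin.elim0 : Fin 0 → Tm Sg k) i).sub g) = Fin.elim0 := funext fun i => i.elim0

/-! ### The action of instantiations -/

/-- Post-composition of an instantiation with a substitution. -/
def Inst.sub {g k : ℕ} (I : Inst Sg g) (f : Fin g → Tm Sg k) : Inst Sg k :=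
  fun M => (I M).map (fun e => e.sub f)

/-- The substitution may change the variables of `I` arbitrarily, through `h`, but must only rename
those of `e`. The embeddings `a'` and `r'` let the ambient scope grow under binders while the scope
of `I` stays fixed. -/
theorem Arg.act_sub {g : ℕ} (I : Inst Sg g) {d : ℕ} {c : Cls} {m : ℕ} (e : Arg Sg d c m) {n k g' : ℕ}
    {a : Fin g → Fin n} {r : Fin d → Fin n} {f : Fin n → Tm Sg k} {h : Fin g → Tm Sg g'}
    {a' : Fin g' → Fin k} {r' : Fin d → Fin k} (hr : ∀ i, f (r i) = .var (r' i))
    (ha : ∀ i, f (a i) = (h i).ren a') :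
    (e.act I a r).sub f = e.act (I.sub h) a' r' := by
  induction e generalizing n k with
  | var i => simp [act, sub, hr]
  | symb S e ih => simp only [act, sub, Arg.symb.injEq]; exact funext fun i => ih i hr ha
  | mvar s m x t ih =>
    simp only [act, Inst.sub]
    cases I ⟨⟨.obj s, m⟩, x⟩ with
    | none =>
      simp only [Option.map_none, sub, Arg.mvar.injEq, heq_eq_eq, true_and]
      exact funext fun i => ih i hr ha
    | some e =>
      simp only [Option.map_some, apply_sub, sub_apply, sub]
      congr 1
      · exact funext fun i => by rw [ha, ren_eq_sub]
      · exact funext fun i => ih i hr ha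
  | dummy s => rfl
  | abs e ih =>
    simp only [act, sub, Arg.abs.injEq]
    exact ih (Fin.lastCases (by simp) fun i => by simp [hr, wk, ren])
      (fun i => by simp [ha, wk, ren_ren])

theorem BThesis.act_sub {g : ℕ} (I : Inst Sg g) {d : ℕ} {c : Cls} (B : BThesis Sg d c) {n k g' : ℕ}
    {a : Fin g → Fin n} {r : Fin d → Fin n} {f : Fin n → Tm Sg k} {h : Fin g → Tm Sg g'}
    {a' : Fin g' → Fin k} {r' : Fin d → Fin k} (hr : ∀ i, f (r i) = .var (r' i))
    (ha : ∀ i, f (a i) = (h i).ren a') :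
    (B.act I a r).sub f = B.act (I.sub h) a' r' := by
  cases B <;> simp [act, sub, Arg.act_sub I _ hr ha]

theorem Bdry.act_sub {g : ℕ} (I : Inst Sg g) {d : ℕ} {c : Cls} {m : ℕ} (B : Bdry Sg d c m) {n k g' : ℕ}
    {a : Fin g → Fin n} {r : Fin d → Fin n} {f : Fin n → Tm Sg k} {h : Fin g → Tm Sg g'}
    {a' : Fin g' → Fin k} {r' : Fin d → Fin k} (hr : ∀ i, f (r i) = .var (r' i))
    (ha : ∀ i, f (a i) = (h i).ren a') :
    (B.act I a r).sub f = B.act (I.sub h) a' r' := by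
  induction B generalizing n k with
  | thesis B => simp [act, sub, BThesis.act_sub I _ hr ha]
  | abs A B ih =>
    simp only [act, sub, Arg.act_sub I _ hr ha, Bdry.abs.injEq, true_and]
    exact ih (Fin.lastCases (by simp) fun i => by simp [hr, Arg.wk, Arg.ren])
      (fun i => by simp [ha, Arg.wk, Arg.ren_ren])

theorem Arg.ren_id {n : ℕ} {c : Cls} {m : ℕ} (e : Arg Sg n c m) : e.ren id = e := by
  rw [ren_eq_sub]; exact sub_var e

theorem Inst.onArg_sub {g k : ℕ} (I : Inst Sg g) {c : Cls} {m : ℕ} (e : Arg Sg 0 c m)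
    (f : Fin g → Tm Sg k) : (I.onArg e).sub f = (I.sub f).onArg e :=
  Arg.act_sub I e (fun i => i.elim0) fun _ => (Arg.ren_id _).symm

theorem Inst.onBThesis_sub {g k : ℕ} (I : Inst Sg g) {c : Cls} (B : BThesis Sg 0 c)
    (f : Fin g → Tm Sg k) : (I.onBThesis B).sub f = (I.sub f).onBThesis B :=
  BThesis.act_sub I B (fun i => i.elim0) fun _ => (Arg.ren_id _).symm

theorem Inst.onBdry_sub {g k : ℕ} (I : Inst Sg g) {c : Cls} {m : ℕ} (B : Bdry Sg 0 c m)
    (f : Fin g → Tm Sg k) : (I.onBdry B).sub f = (I.sub f).onBdry B :=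
  Bdry.act_sub I B (fun i => i.elim0) fun _ => (Arg.ren_id _).symm

theorem Inst.restrict_sub {g k : ℕ} (I : Inst Sg g) (Y : MCtx Sg) (f : Fin g → Tm Sg k) :
    (I.restrict Y).sub f = (I.sub f).restrict Y := by
  funext M; simp only [sub, restrict]; split <;> rfl

theorem Arg.act_congr {g : ℕ} {I J : Inst Sg g} {d : ℕ} {c : Cls} {m : ℕ} (e : Arg Sg d c m) {n : ℕ}
    (a : Fin g → Fin n) (r : Fin d → Fin n) (h : ∀ M ∈ e.mv, I M = J M) :
    e.act I a r = e.act J a r := by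
  induction e generalizing n with
  | var i => rfl
  | symb S e ih =>
    simp only [act, Arg.symb.injEq]
    exact funext fun i => ih i _ _ fun M hM => h M (by simp only [mv, Set.mem_iUnion]; exact ⟨i, hM⟩)
  | mvar s m x t ih =>
    have : (fun i => (t i).act I a r) = fun i => (t i).act J a r := funext fun i =>
      ih i _ _ fun M hM => h M (by simp only [mv, Set.mem_insert_iff, Set.mem_iUnion]; exact .inr ⟨i, hM⟩)
    simp only [act, h _ (Set.mem_insert _ _), this]
  | dummy s => rfl
  | abs e ih => simp only [act, ih _ _ h]

theorem BThesis.act_congr {g : ℕ} {I J : Inst Sg g} {d : ℕ} {c : Cls} (B : BThesis Sg d c) {n : ℕ}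
    (a : Fin g → Fin n) (r : Fin d → Fin n) (h : ∀ M ∈ B.mv, I M = J M) :
    B.act I a r = B.act J a r := by
  cases B with
  | isTy => rfl
  | ofTy A => simp only [act, A.act_congr a r h]
  | eqTy A B =>
    simp only [act, A.act_congr a r fun M hM => h M (.inl hM), B.act_congr a r fun M hM => h M (.inr hM)]
  | eqTm s t A =>
    simp only [act, s.act_congr a r fun M hM => h M (.inl (.inl hM)),
      t.act_congr a r fun M hM => h M (.inl (.inr hM)), A.act_congr a r fun M hM => h M (.inr hM)]

theorem Bdry.act_congr {g : ℕ} {I J : Inst Sg g} {d : ℕ} {c : Cls} {m : ℕ} (B : Bdry Sg d c m) {n : ℕ}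
    (a : Fin g → Fin n) (r : Fin d → Fin n) (h : ∀ M ∈ B.mv, I M = J M) :
    B.act I a r = B.act J a r := by
  induction B generalizing n with
  | thesis B => simp only [act, B.act_congr a r h]
  | abs A B ih =>
    simp only [act, A.act_congr a r fun M hM => h M (.inl hM), ih _ _ fun M hM => h M (.inr hM)]

/-- The action of an instantiation over the empty variable context, in any scope. -/
def Arg.inst (I : Inst Sg 0) {n : ℕ} {c : Cls} {m : ℕ} (e : Arg Sg n c m) : Arg Sg n c m :=
  e.act I Fin.elim0 id

section inst
variable (I : Inst Sg 0)

@[simp] theorem Arg.inst_var {n : ℕ} (i : Fin n) : (Arg.var i : Tm Sg n).inst I = .var i := rfl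

@[simp] theorem Arg.inst_symb {n : ℕ} (S : Sg.Sym)
    (e : (i : Fin (Sg.num S)) → Arg Sg n (Sg.arg S i).cls (Sg.arg S i).num) :
    (Arg.symb S e).inst I = .symb S (fun i => (e i).inst I) := rfl

@[simp] theorem Arg.inst_abs {n : ℕ} {c : Cls} {m : ℕ} (e : Arg Sg (n + 1) c m) :
    (Arg.abs e).inst I = .abs (e.inst I) := by
  have : (fun i : Fin 0 => (Fin.elim0 i : Fin n).castSucc) = Fin.elim0 := funext fun i => i.elim0
  simp [inst, act, this]

theorem Arg.inst_mvar_some {n : ℕ} {s : Srt} {m x : ℕ} {e : Arg Sg 0 (.obj s) m} (t : Fin m → Tm Sg n)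
    (h : I ⟨⟨.obj s, m⟩, x⟩ = some e) :
    (Arg.mvar s m x t).inst I = e.apply Fin.elim0 (fun j => (t j).inst I) := by
  have : (fun i : Fin 0 => Arg.var (Sg := Sg) (Fin.elim0 i : Fin n)) = Fin.elim0 :=
    funext fun i => i.elim0
  simp only [inst, act, h, this]

theorem Arg.inst_mvar_none {n : ℕ} {s : Srt} {m x : ℕ} (t : Fin m → Tm Sg n)
    (h : I ⟨⟨.obj s, m⟩, x⟩ = none) :
    (Arg.mvar s m x t).inst I = .mvar s m x (fun j => (t j).inst I) := by
  simp only [inst, act, h]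

/-- One induction used twice: for renamings, where the lifting condition is immediate, and then for
all substitutions, where the lifting condition is commutation with weakening, an instance of the
first use. -/
theorem Arg.inst_sub_of_comm {n : ℕ} {c : Cls} {m : ℕ} (e : Arg Sg n c m) {k : ℕ} (f : Fin n → Tm Sg k)
    (P : ∀ n k, (Fin n → Tm Sg k) → Prop) (hP : P n k f)
    (hl : ∀ n k f, P n k f → P _ _ (liftSub f) ∧
      (fun i => (liftSub f i).inst I) = liftSub (fun i => (f i).inst I)) :
    (e.sub f).inst I = (e.inst I).sub (fun i => (f i).inst I) := by
  induction e generalizing k with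
  | var i => rfl
  | symb S e ih => simp only [sub, inst_symb, Arg.symb.injEq]; exact funext fun i => ih i f hP
  | mvar s m x t ih =>
    rcases h : I ⟨⟨.obj s, m⟩, x⟩ with _ | e
    · simp only [sub, inst_mvar_none I _ h]
      congr 1
      exact funext fun i => ih i f hP
    · simp only [sub, inst_mvar_some I _ h, apply_sub]
      congr 1
      · exact funext fun i => i.elim0
      · exact funext fun i => ih i f hP
  | dummy s => rfl
  | abs e ih => simp only [sub, inst_abs, ih _ (hl _ _ _ hP).1, (hl _ _ _ hP).2]

theorem Arg.inst_ren {n : ℕ} {c : Cls} {m : ℕ} (e : Arg Sg n c m) {k : ℕ} (r : Fin n → Fin k) :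
    (e.ren r).inst I = (e.inst I).ren r := by
  rw [ren_eq_sub, ren_eq_sub]
  refine inst_sub_of_comm I e _ (fun n k f => ∃ r : Fin n → Fin k, f = fun i => .var (r i)) ⟨r, rfl⟩ ?_
  rintro n k f ⟨r, rfl⟩
  exact ⟨⟨liftRen r, by simp⟩, by simp⟩

@[simp] theorem Arg.inst_wk {n : ℕ} {c : Cls} {m : ℕ} (e : Arg Sg n c m) : e.wk.inst I = (e.inst I).wk :=
  e.inst_ren I _

theorem inst_liftSub {n k : ℕ} (f : Fin n → Tm Sg k) :
    (fun i => (liftSub f i).inst I) = liftSub (fun i => (f i).inst I) :=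
  funext_last (by simp) (by simp)

theorem Arg.inst_sub {n : ℕ} {c : Cls} {m : ℕ} (e : Arg Sg n c m) {k : ℕ} (f : Fin n → Tm Sg k) :
    (e.sub f).inst I = (e.inst I).sub (fun i => (f i).inst I) :=
  inst_sub_of_comm I e f (fun _ _ _ => True) trivial fun _ _ f _ => ⟨trivial, inst_liftSub I f⟩

theorem Arg.inst_apply {c : Cls} {m n : ℕ} (e : Arg Sg n c m) {k : ℕ} (f : Fin n → Tm Sg k)
    (t : Fin m → Tm Sg k) :
    (e.apply f t).inst I = (e.inst I).apply (fun i => (f i).inst I) (fun j => (t j).inst I) := by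
  induction m generalizing n with
  | zero => simp [apply, inst_sub]
  | succ m ih =>
    cases e with
    | abs e => simp only [apply, ih, inst_abs, comp_extend (fun t : Tm Sg k => t.inst I)]

/-- Post-composition of an instantiation with an instantiation over the empty variable context. -/
def Inst.comp {g : ℕ} (J : Inst Sg g) : Inst Sg g := fun M => (J M).map (fun e => e.inst I)

/-- Totality of `J` on `e` matters: a metavariable outside the domain of `J` could still be replaced
by `I` on the left, but never by the composite on the right. -/
theorem Arg.inst_act {g : ℕ} (J : Inst Sg g) {d : ℕ} {c : Cls} {m : ℕ} (e : Arg Sg d c m) {n : ℕ}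
    (a : Fin g → Fin n) (r : Fin d → Fin n) (h : ∀ M ∈ e.mv, (J M).isSome) :
    (e.act J a r).inst I = e.act (Inst.comp I J) a r := by
  induction e generalizing n with
  | var i => rfl
  | symb S e ih =>
    simp only [act, inst_symb, Arg.symb.injEq]
    exact funext fun i => ih i _ _ fun M hM => h M (by simp only [mv, Set.mem_iUnion]; exact ⟨i, hM⟩)
  | mvar s m x t ih =>
    obtain ⟨e, he⟩ := Option.isSome_iff_exists.1 (h _ (Set.mem_insert _ _))
    simp only [act, he, Inst.comp, Option.map_some, inst_apply, inst_var]
    congr 1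
    exact funext fun i => ih i _ _ fun M hM =>
      h M (by simp only [mv, Set.mem_insert_iff, Set.mem_iUnion]; exact .inr ⟨i, hM⟩)
  | dummy s => rfl
  | abs e ih => simp only [act, inst_abs, ih _ _ h]

end inst

/-! ### The action on boundaries, judgements and variable contexts -/

section inst
variable (I : Inst Sg 0)

def BThesis.inst {n : ℕ} : {c : Cls} → BThesis Sg n c → BThesis Sg n c
  | _, .isTy => .isTy
  | _, .ofTy A => .ofTy (A.inst I)
  | _, .eqTy A B => .eqTy (A.inst I) (B.inst I)
  | _, .eqTm s t A => .eqTm (s.inst I) (t.inst I) (A.inst I)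

def Bdry.inst : {n : ℕ} → {c : Cls} → {m : ℕ} → Bdry Sg n c m → Bdry Sg n c m
  | _, _, _, .thesis B => .thesis (B.inst I)
  | _, _, _, .abs A B => .abs (A.inst I) (B.inst)

def Thesis.inst {n : ℕ} : {c : Cls} → Thesis Sg n c → Thesis Sg n c
  | _, .isTy A => .isTy (A.inst I)
  | _, .ofTy t A => .ofTy (t.inst I) (A.inst I)
  | _, .eqTy A B => .eqTy (A.inst I) (B.inst I)
  | _, .eqTm s t A => .eqTm (s.inst I) (t.inst I) (A.inst I)

def Judg.inst : {n : ℕ} → {c : Cls} → {m : ℕ} → Judg Sg n c m → Judg Sg n c m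
  | _, _, _, .thesis J => .thesis (J.inst I)
  | _, _, _, .abs A J => .abs (A.inst I) (J.inst)

def Ctx.inst : {n : ℕ} → Ctx Sg n → Ctx Sg n
  | _, .nil => .nil
  | _, .snoc G A => .snoc G.inst (A.inst I)

theorem BThesis.inst_eq_act {n : ℕ} {c : Cls} (B : BThesis Sg n c) : B.inst I = B.act I Fin.elim0 id := by
  cases B <;> rfl

theorem Bdry.inst_eq_act {n : ℕ} {c : Cls} {m : ℕ} (B : Bdry Sg n c m) :
    B.inst I = B.act I Fin.elim0 id := by
  induction B with
  | thesis B => simp [inst, act, BThesis.inst_eq_act]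
  | @abs n _ _ A B ih =>
    have : (fun i : Fin 0 => (Fin.elim0 i : Fin n).castSucc) = Fin.elim0 := funext fun i => i.elim0
    simp [inst, act, ih, this, Arg.inst]

theorem Inst.onArg_eq_inst {c : Cls} {m : ℕ} (e : Arg Sg 0 c m) : I.onArg e = e.inst I := by
  simp only [onArg, Arg.inst]; congr 1 <;> exact Subsingleton.elim _ _

theorem Inst.onBThesis_eq_inst {c : Cls} (B : BThesis Sg 0 c) : I.onBThesis B = B.inst I := by
  rw [BThesis.inst_eq_act, onBThesis]; congr 1 <;> exact Subsingleton.elim _ _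

theorem Inst.onBdry_eq_inst {c : Cls} {m : ℕ} (B : Bdry Sg 0 c m) : I.onBdry B = B.inst I := by
  rw [Bdry.inst_eq_act, onBdry]; congr 1 <;> exact Subsingleton.elim _ _

theorem Ctx.get_inst {n : ℕ} (G : Ctx Sg n) (i : Fin n) : (G.inst I).get i = (G.get i).inst I := by
  induction G with
  | nil => exact i.elim0
  | snoc G A ih => exact Fin.lastCases (by simp [inst, get]) (fun i => by simp [inst, get, ih]) i

theorem BThesis.inst_sub {n : ℕ} {c : Cls} (B : BThesis Sg n c) {k : ℕ} (f : Fin n → Tm Sg k) :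
    (B.sub f).inst I = (B.inst I).sub (fun i => (f i).inst I) := by
  cases B <;> simp [inst, sub, Arg.inst_sub]

theorem Bdry.inst_apply {c : Cls} {m n : ℕ} (B : Bdry Sg n c m) {k : ℕ} (f : Fin n → Tm Sg k)
    (t : Fin m → Tm Sg k) :
    (B.apply f t).inst I = (B.inst I).apply (fun i => (f i).inst I) (fun j => (t j).inst I) := by
  induction B with
  | thesis B => simp [apply, inst, BThesis.inst_sub]
  | abs A B ih => simp only [apply, inst, ih, comp_extend (fun t : Tm Sg k => t.inst I)]

theorem Bdry.inst_argTy {c : Cls} {m n : ℕ} (B : Bdry Sg n c m) {k : ℕ} (f : Fin n → Tm Sg k)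
    (t : Fin m → Tm Sg k) (j : Fin m) :
    (B.argTy f t j).inst I =
      (B.inst I).argTy (fun i => (f i).inst I) (fun j => (t j).inst I) j := by
  induction B with
  | thesis B => exact j.elim0
  | abs A B ih =>
    refine Fin.cases ?_ (fun j => ?_) j
    · simp [argTy, inst, Arg.inst_sub]
    · simp [argTy, inst, ih, comp_extend (fun t : Tm Sg k => t.inst I)]

theorem BThesis.inst_plug {n : ℕ} {c : Cls} (B : BThesis Sg n c) (e : Arg Sg n c 0) :
    (B.plug e).inst I = (B.inst I).plug (e.inst I) := by
  cases B <;> rfl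

theorem BThesis.inst_plugEq {n : ℕ} {s : Srt} (B : BThesis Sg n (.obj s)) (e e' : Arg Sg n (.obj s) 0) :
    (B.plugEq e e').inst I = (B.inst I).plugEq (e.inst I) (e'.inst I) := by
  cases B <;> rfl

theorem BThesis.inst_tyEq {n : ℕ} {c : Cls} (B B' : BThesis Sg n c) :
    (B.inst I).tyEq (B'.inst I) = (B.tyEq B').map (Thesis.inst I) := by
  cases B <;> cases B' <;> rfl

theorem Bdry.inst_plug {n : ℕ} {c : Cls} {m : ℕ} (B : Bdry Sg n c m) (e : Arg Sg n c m) :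
    (B.plug e).inst I = (B.inst I).plug (e.inst I) := by
  induction B with
  | thesis B => simp [plug, inst, Judg.inst, BThesis.inst_plug]
  | abs A B ih => cases e; simp [plug, inst, Judg.inst, ih]

theorem Bdry.inst_plugEq {s : Srt} {m n : ℕ} (B : Bdry Sg n (.obj s) m) (e e' : Arg Sg n (.obj s) m) :
    (B.plugEq e e').inst I = (B.inst I).plugEq (e.inst I) (e'.inst I) := by
  induction m generalizing n with
  | zero => cases B; simp [plugEq, inst, Judg.inst, BThesis.inst_plugEq]
  | succ m ih => cases B; cases e; cases e'; simp [plugEq, inst, Judg.inst, ih]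

theorem BThesis.inst_act {g : ℕ} (J : Inst Sg g) {d : ℕ} {c : Cls} (B : BThesis Sg d c) {n : ℕ}
    (a : Fin g → Fin n) (r : Fin d → Fin n) (h : ∀ M ∈ B.mv, (J M).isSome) :
    (B.act J a r).inst I = B.act (Inst.comp I J) a r := by
  cases B with
  | isTy => rfl
  | ofTy A => simp only [act, inst, A.inst_act I J a r h]
  | eqTy A B =>
    simp only [act, inst, A.inst_act I J a r fun M hM => h M (.inl hM),
      B.inst_act I J a r fun M hM => h M (.inr hM)]
  | eqTm s t A =>
    simp only [act, inst, s.inst_act I J a r fun M hM => h M (.inl (.inl hM)),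
      t.inst_act I J a r fun M hM => h M (.inl (.inr hM)),
      A.inst_act I J a r fun M hM => h M (.inr hM)]

theorem Bdry.inst_act {g : ℕ} (J : Inst Sg g) {d : ℕ} {c : Cls} {m : ℕ} (B : Bdry Sg d c m) {n : ℕ}
    (a : Fin g → Fin n) (r : Fin d → Fin n) (h : ∀ M ∈ B.mv, (J M).isSome) :
    (B.act J a r).inst I = B.act (Inst.comp I J) a r := by
  induction B generalizing n with
  | thesis B => simp only [act, inst, B.inst_act I J a r h]
  | abs A B ih =>
    simp only [act, inst, A.inst_act I J a r fun M hM => h M (.inl hM),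
      ih _ _ fun M hM => h M (.inr hM)]

end inst

/-! ### Generic applications -/

theorem Arg.inst_lams (I : Inst Sg 0) {c : Cls} (m : ℕ) {n : ℕ}
    (f : (k : ℕ) → (Fin n → Fin k) → (Fin m → Fin k) → Arg Sg k c 0) :
    (lams m f).inst I = lams m (fun k r xs => (f k r xs).inst I) := by
  induction m generalizing n with
  | zero => rfl
  | succ m ih => simp [lams, ih]

/-- An η-law for abstractions. It is what makes an instantiation send the generic application of `M`
back to its value at `M`. -/
theorem lams_apply {c : Cls} {m n : ℕ} (e : Arg Sg n c m) :
    lams m (fun _ r xs => e.apply (fun i => .var (r i)) (fun j => .var (xs j))) = e := by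
  induction m generalizing n with
  | zero => simp [lams, Arg.apply]
  | succ m ih =>
    cases e with
    | abs e =>
      simp only [lams, Arg.abs.injEq]
      rw [← ih e]
      congr 1
      funext k r xs
      rw [ih e, Arg.apply]
      congr 1
      exact funext_last (by simp) (by simp)

theorem Arg.eq_dummy {n : ℕ} {s : Srt} (e : Arg Sg n (.eq s) 0) : e = .dummy s := by
  cases e; rfl

theorem MV.inst_gen {I : Inst Sg 0} {M : MV} {e : Arg Sg 0 M.ar.cls M.ar.num} (h : I M = some e) :
    (M.gen : Arg Sg 0 M.ar.cls M.ar.num).inst I = e := by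
  rw [gen, Arg.inst_lams]
  conv_rhs => rw [← lams_apply e]
  congr 1
  funext k r xs
  obtain ⟨⟨⟨s⟩ | ⟨s⟩, m⟩, x⟩ := M
  · simp only [app, Arg.inst_mvar_some I _ h, Arg.inst_var]
    congr 1
    exact funext fun i => i.elim0
  · exact ((Arg.eq_dummy _)).trans (Arg.eq_dummy _).symm

/-! ### Occurrences of metavariables -/

section mv
variable {D : Set MV}

@[simp] theorem Arg.mv_symb_subset {n : ℕ} {S : Sg.Sym}
    {e : (i : Fin (Sg.num S)) → Arg Sg n (Sg.arg S i).cls (Sg.arg S i).num} :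
    (Arg.symb S e).mv ⊆ D ↔ ∀ i, (e i).mv ⊆ D := by simp [mv]

@[simp] theorem Arg.mv_mvar_subset {n : ℕ} {s : Srt} {m x : ℕ} {t : Fin m → Tm Sg n} :
    (Arg.mvar s m x t).mv ⊆ D ↔ ⟨⟨.obj s, m⟩, x⟩ ∈ D ∧ ∀ i, (t i).mv ⊆ D := by
  simp [mv, Set.insert_subset_iff]

@[simp] theorem Arg.mv_ren {n : ℕ} {c : Cls} {m : ℕ} (e : Arg Sg n c m) {k : ℕ} (r : Fin n → Fin k) :
    (e.ren r).mv = e.mv := by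
  induction e generalizing k with
  | var i => rfl
  | symb S e ih => simp [mv, ren, ih]
  | mvar s m x t ih => simp [mv, ren, ih]
  | dummy s => rfl
  | abs e ih => simp [mv, ren, ih]

@[simp] theorem Arg.mv_wk {n : ℕ} {c : Cls} {m : ℕ} (e : Arg Sg n c m) : e.wk.mv = e.mv := mv_ren _ _

theorem Arg.mv_sub {n : ℕ} {c : Cls} {m : ℕ} {e : Arg Sg n c m} {k : ℕ} {f : Fin n → Tm Sg k}
    (he : e.mv ⊆ D) (hf : ∀ i, (f i).mv ⊆ D) : (e.sub f).mv ⊆ D := by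
  induction e generalizing k with
  | var i => exact hf i
  | symb S e ih => simp only [sub, mv_symb_subset] at he ⊢; exact fun i => ih i (he i) hf
  | mvar s m x t ih => simp only [sub, mv_mvar_subset] at he ⊢; exact ⟨he.1, fun i => ih i (he.2 i) hf⟩
  | dummy s => exact he
  | abs e ih => exact ih he (Fin.lastCases (by simp [mv]) (by simpa using hf))

theorem extend_mv {n k : ℕ} {f : Fin n → Tm Sg k} {t : Tm Sg k} (hf : ∀ i, (f i).mv ⊆ D)
    (ht : t.mv ⊆ D) : ∀ i, (extend f t i).mv ⊆ D :=
  Fin.lastCases (by simpa) (by simpa)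

theorem Arg.mv_apply {c : Cls} {m n : ℕ} {e : Arg Sg n c m} {k : ℕ} {f : Fin n → Tm Sg k}
    {t : Fin m → Tm Sg k} (he : e.mv ⊆ D) (hf : ∀ i, (f i).mv ⊆ D) (ht : ∀ j, (t j).mv ⊆ D) :
    (e.apply f t).mv ⊆ D := by
  induction m generalizing n with
  | zero => simpa only [apply] using mv_sub he hf
  | succ m ih =>
    cases e with
    | abs e => exact ih he (extend_mv hf (ht 0)) fun j => ht j.succ

theorem Arg.mv_act {g : ℕ} {I : Inst Sg g} {d : ℕ} {c : Cls} {m : ℕ} {e : Arg Sg d c m} {n : ℕ}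
    (a : Fin g → Fin n) (r : Fin d → Fin n) (hI : ∀ M e', I M = some e' → e'.mv ⊆ D)
    (he : ∀ M ∈ e.mv, I M = none → M ∈ D) : (e.act I a r).mv ⊆ D := by
  induction e generalizing n with
  | var i => simp [act, mv]
  | symb S e ih =>
    simp only [act, mv_symb_subset]
    exact fun i => ih i _ _ fun M hM => he M (by simp only [mv, Set.mem_iUnion]; exact ⟨i, hM⟩)
  | mvar s m x t ih =>
    have ih' : ∀ i, ((t i).act I a r).mv ⊆ D := fun i => ih i _ _ fun M hM =>
      he M (by simp only [mv, Set.mem_insert_iff, Set.mem_iUnion]; exact .inr ⟨i, hM⟩)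
    simp only [act]
    rcases h : I ⟨⟨.obj s, m⟩, x⟩ with _ | e
    · exact mv_mvar_subset.2 ⟨he _ (Set.mem_insert _ _) h, ih'⟩
    · exact mv_apply (hI _ _ h) (by simp [mv]) ih'
  | dummy s => simp [act, mv]
  | abs e ih => exact ih _ _ he

theorem BThesis.mv_sub {n : ℕ} {c : Cls} {B : BThesis Sg n c} {k : ℕ} {f : Fin n → Tm Sg k}
    (hB : B.mv ⊆ D) (hf : ∀ i, (f i).mv ⊆ D) : (B.sub f).mv ⊆ D := by
  cases B <;> simp only [sub, mv, Set.union_subset_iff] at hB ⊢ <;>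
    simp [hB, Arg.mv_sub, hf]

theorem Bdry.mv_apply {c : Cls} {m n : ℕ} {B : Bdry Sg n c m} {k : ℕ} {f : Fin n → Tm Sg k}
    {t : Fin m → Tm Sg k} (hB : B.mv ⊆ D) (hf : ∀ i, (f i).mv ⊆ D) (ht : ∀ j, (t j).mv ⊆ D) :
    (B.apply f t).mv ⊆ D := by
  induction B with
  | thesis B => exact BThesis.mv_sub hB hf
  | abs A B ih =>
    simp only [mv, Set.union_subset_iff] at hB
    exact ih hB.2 (extend_mv hf (ht 0)) fun j => ht j.succ

theorem BThesis.mv_act {g : ℕ} {I : Inst Sg g} {d : ℕ} {c : Cls} {B : BThesis Sg d c} {n : ℕ}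
    (a : Fin g → Fin n) (r : Fin d → Fin n) (hI : ∀ M e', I M = some e' → e'.mv ⊆ D)
    (hB : ∀ M ∈ B.mv, I M = none → M ∈ D) : (B.act I a r).mv ⊆ D := by
  cases B with
  | isTy => simp [act, mv]
  | ofTy A => exact Arg.mv_act a r hI hB
  | eqTy A B =>
    simp only [act, mv, Set.union_subset_iff]
    exact ⟨Arg.mv_act a r hI fun M hM => hB M (.inl hM), Arg.mv_act a r hI fun M hM => hB M (.inr hM)⟩
  | eqTm s t A =>
    simp only [act, mv, Set.union_subset_iff]
    exact ⟨⟨Arg.mv_act a r hI fun M hM => hB M (.inl (.inl hM)),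
      Arg.mv_act a r hI fun M hM => hB M (.inl (.inr hM))⟩,
      Arg.mv_act a r hI fun M hM => hB M (.inr hM)⟩

theorem Bdry.mv_act {g : ℕ} {I : Inst Sg g} {d : ℕ} {c : Cls} {m : ℕ} {B : Bdry Sg d c m} {n : ℕ}
    (a : Fin g → Fin n) (r : Fin d → Fin n) (hI : ∀ M e', I M = some e' → e'.mv ⊆ D)
    (hB : ∀ M ∈ B.mv, I M = none → M ∈ D) : (B.act I a r).mv ⊆ D := by
  induction B generalizing n with
  | thesis B => exact BThesis.mv_act a r hI hB
  | abs A B ih =>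
    simp only [act, mv, Set.union_subset_iff]
    exact ⟨Arg.mv_act a r hI fun M hM => hB M (.inl hM), ih _ _ fun M hM => hB M (.inr hM)⟩

theorem Ctx.mv_get {n : ℕ} (G : Ctx Sg n) (i : Fin n) : (G.get i).mv ⊆ G.mv := by
  induction G with
  | nil => exact i.elim0
  | snoc G A ih =>
    exact Fin.lastCases (by simp [get, mv])
      (fun i => by simpa [get, mv] using (ih i).trans Set.subset_union_left) i

theorem BThesis.mv_plug {n : ℕ} {c : Cls} {B : BThesis Sg n c} {e : Arg Sg n c 0} (hB : B.mv ⊆ D)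
    (he : e.mv ⊆ D) : (B.plug e).mv ⊆ D := by
  cases B <;> simp_all [mv, plug, Thesis.mv]

theorem BThesis.mv_plugEq {n : ℕ} {s : Srt} {B : BThesis Sg n (.obj s)} {e e' : Arg Sg n (.obj s) 0}
    (hB : B.mv ⊆ D) (he : e.mv ⊆ D) (he' : e'.mv ⊆ D) : (B.plugEq e e').mv ⊆ D := by
  cases B <;> simp_all [mv, plugEq, Thesis.mv]

theorem MV.mv_app {n : ℕ} {M : MV} {t : Fin M.ar.num → Tm Sg n} (hM : M ∈ D) (ht : ∀ j, (t j).mv ⊆ D) :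
    (M.app t).mv ⊆ D := by
  obtain ⟨⟨⟨s⟩ | ⟨s⟩, m⟩, x⟩ := M
  · exact Arg.mv_mvar_subset.2 ⟨hM, ht⟩
  · simp [app, Arg.mv]

theorem mv_lams {c : Cls} {m n : ℕ} {f : (k : ℕ) → (Fin n → Fin k) → (Fin m → Fin k) → Arg Sg k c 0}
    (h : ∀ k r xs, (f k r xs).mv ⊆ D) : (lams m f).mv ⊆ D := by
  induction m generalizing n with
  | zero => exact h _ _ _
  | succ m ih => exact ih fun _ _ _ => h _ _ _

theorem MV.mv_gen_of_isObj_eq_false {n : ℕ} {M : MV} (h : M.isObj = false) :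
    (M.gen : Arg Sg n M.ar.cls M.ar.num).mv = ∅ := by
  refine Set.subset_empty_iff.1 (mv_lams fun k r xs => ?_)
  obtain ⟨⟨⟨s⟩ | ⟨s⟩, m⟩, x⟩ := M
  · simp [isObj] at h
  · simp [app, Arg.mv]

theorem MV.mv_gen {n : ℕ} (M : MV) : (M.gen : Arg Sg n M.ar.cls M.ar.num).mv ⊆ {M} :=
  mv_lams fun _ _ _ => mv_app rfl (by simp [Arg.mv])

/-- Applications of equality metavariables are dummies and leave no trace in the syntax. Hence
values at equality metavariables never influence how an instantiation acts. -/
theorem Arg.isObj_of_mem_mv {n : ℕ} {c : Cls} {m : ℕ} (e : Arg Sg n c m) {M : MV} (hM : M ∈ e.mv) :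
    M.isObj = true := by
  induction e with
  | var i => simp [mv] at hM
  | symb S e ih => simp only [mv, Set.mem_iUnion] at hM; obtain ⟨i, hi⟩ := hM; exact ih i hi
  | mvar s m x t ih =>
    simp only [mv, Set.mem_insert_iff, Set.mem_iUnion] at hM
    obtain rfl | ⟨i, hi⟩ := hM
    · rfl
    · exact ih i hi
  | dummy s => simp [mv] at hM
  | abs e ih => exact ih hM

theorem BThesis.isObj_of_mem_mv {n : ℕ} {c : Cls} (B : BThesis Sg n c) {M : MV} (hM : M ∈ B.mv) :
    M.isObj = true := by
  cases B with
  | isTy => simp [mv] at hM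
  | ofTy A => exact A.isObj_of_mem_mv hM
  | eqTy A B => exact hM.elim A.isObj_of_mem_mv B.isObj_of_mem_mv
  | eqTm s t A => exact hM.elim (·.elim s.isObj_of_mem_mv t.isObj_of_mem_mv) A.isObj_of_mem_mv

theorem Bdry.isObj_of_mem_mv {n : ℕ} {c : Cls} {m : ℕ} (B : Bdry Sg n c m) {M : MV} (hM : M ∈ B.mv) :
    M.isObj = true := by
  induction B with
  | thesis B => exact B.isObj_of_mem_mv hM
  | abs A B ih => exact hM.elim A.isObj_of_mem_mv ih

end mv

/-! ### Closure rules with validity of the conclusion inferred -/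

theorem MCtx.mem_dom {X : MCtx Sg} {M : MV} {B : Bdry Sg 0 M.ar.cls M.ar.num} (h : ⟨M, B⟩ ∈ X) :
    M ∈ X.dom := List.mem_map.2 ⟨_, h, rfl⟩

theorem MCtx.Valid.mv_bdry {X : MCtx Sg} (hX : X.Valid) {M : MV} {B : Bdry Sg 0 M.ar.cls M.ar.num}
    (h : ⟨M, B⟩ ∈ X) : B.mv ⊆ X.dom := by
  obtain ⟨X₁, X₂, rfl⟩ := List.append_of_mem h
  refine (hX.2 _ _ _ _ rfl).trans fun N hN => ?_
  simp only [dom, names, Set.mem_ofPred_eq, List.map_append, List.mem_append] at hN ⊢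
  exact .inl hN

theorem Inst.Over.eq_none {g : ℕ} {I : Inst Sg g} {Y X : MCtx Sg} (hI : I.Over Y X) {M : MV}
    (h : I M = none) : M ∉ Y.dom := fun hM => by
  have := (hI.1 M).2 hM
  simp [h] at this

theorem Inst.Over.mv_onArg {g : ℕ} {I : Inst Sg g} {Y X : MCtx Sg} (hI : I.Over Y X) {c : Cls} {m : ℕ}
    {e : Arg Sg 0 c m} (he : e.mv ⊆ Y.dom) : (I.onArg e).mv ⊆ X.dom :=
  Arg.mv_act _ _ hI.2 fun _ hM h => absurd (he hM) (hI.eq_none h)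

theorem Inst.Over.mv_onBThesis {g : ℕ} {I : Inst Sg g} {Y X : MCtx Sg} (hI : I.Over Y X) {c : Cls}
    {B : BThesis Sg 0 c} (hB : B.mv ⊆ Y.dom) : (I.onBThesis B).mv ⊆ X.dom :=
  BThesis.mv_act _ _ hI.2 fun _ hM h => absurd (hB hM) (hI.eq_none h)

theorem BThesis.mv_subset_plug {n : ℕ} {c : Cls} (B : BThesis Sg n c) (e : Arg Sg n c 0) :
    B.mv ⊆ (B.plug e).mv := by
  cases B <;> simp [mv, plug, Thesis.mv]

theorem BThesis.head_mv_subset_plug {n : ℕ} {s : Srt} (B : BThesis Sg n (.obj s)) (e : Arg Sg n (.obj s) 0) :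
    e.mv ⊆ (B.plug e).mv := by
  cases B <;> simp [plug, Thesis.mv]

theorem RawRule.mv_bdry {c : Cls} (R : RawRule Sg c) : R.bdry.mv ⊆ R.prem.dom :=
  (R.bdry.mv_subset_plug _).trans R.valid.2.2

theorem Arg.mv_of_eq {n m : ℕ} {s : Srt} (e : Arg Sg n (.eq s) m) : e.mv = ∅ := by
  induction m generalizing n with
  | zero => cases e; rfl
  | succ m ih => cases e with | abs e => exact ih e

theorem RawRule.mv_head {c : Cls} (R : RawRule Sg c) : R.head.mv ⊆ R.prem.dom := by
  cases c with
  | obj s => exact (R.bdry.head_mv_subset_plug _).trans R.valid.2.2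
  | eq s => simp [Arg.mv_of_eq]

variable {T : RawTheory.{u, v} Sg} {X : MCtx Sg} {n : ℕ} {G : Ctx Sg n}

namespace Derivable

theorem valid {q : Hyp Sg} (h : Derivable T q) : q.Valid := by cases h; assumption

/-- Derivable premises are valid, so only validity of the conclusion remains to be checked; the
lemmas below discharge it rule by rule. -/
theorem intro {P : Set (Hyp Sg)} {q : Hyp Sg} (hr : ClosureRule T P q) (hq : q.Valid)
    (h : ∀ p ∈ P, Derivable T p) : Derivable T q := .mk hr (fun p hp => (h p hp).valid) hq h

theorem var (hX : X.Valid) (hG : G.mv ⊆ X.dom) (i : Fin n) :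
    Derivable T (.thesis X G (.ofTy (.var i) (G.get i))) :=
  intro (.var X G i) ⟨hX, hG, by
    simpa [Judg.mv, Thesis.mv, Arg.mv] using (G.mv_get i).trans hG⟩ (by simp)

theorem metaApp {M : MV} {B : Bdry Sg 0 M.ar.cls M.ar.num} (hM : ⟨M, B⟩ ∈ X) {t : Fin M.ar.num → Tm Sg n}
    (ht : ∀ j, Derivable T (.thesis X G (.ofTy (t j) (B.argTy Fin.elim0 t j))))
    (hb : Derivable T (.bdry X G (.thesis (B.apply Fin.elim0 t)))) :
    Derivable T (.thesis X G ((B.apply Fin.elim0 t).plug (M.app t))) := by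
  refine intro (.metaApp X G M B hM t) ⟨hb.valid.1, hb.valid.2.1, ?_⟩ ?_
  · exact BThesis.mv_plug hb.valid.2.2 (MV.mv_app (MCtx.mem_dom hM) fun j =>
      Set.subset_union_left.trans (ht j).valid.2.2)
  · rintro p (⟨j, rfl⟩ | rfl)
    exacts [ht j, hb]

/-- For a type metavariable without arguments there are no premises from which validity of the
contexts could be read off, so it is assumed. The same applies to `congr`. -/
theorem metaCongr (hX : X.Valid) (hG : G.mv ⊆ X.dom) {s : Srt} {m x : ℕ} {B : Bdry Sg 0 (.obj s) m}
    (hM : ⟨⟨⟨.obj s, m⟩, x⟩, B⟩ ∈ X) {t t' : Fin m → Tm Sg n}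
    (ht : ∀ j, Derivable T (.thesis X G (.ofTy (t j) (B.argTy Fin.elim0 t j))))
    (ht' : ∀ j, Derivable T (.thesis X G (.ofTy (t' j) (B.argTy Fin.elim0 t' j))))
    (he : ∀ j, Derivable T (.thesis X G (.eqTm (t j) (t' j) (B.argTy Fin.elim0 t j))))
    (hb : ∀ E, (B.apply Fin.elim0 t).tyEq (B.apply Fin.elim0 t') = some E →
      Derivable T (.thesis X G E)) :
    Derivable T (.thesis X G ((B.apply Fin.elim0 t).plugEq (.mvar s m x t) (.mvar s m x t'))) := by
  have h1 j : (t j).mv ⊆ X.dom := Set.subset_union_left.trans (ht j).valid.2.2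
  have h2 j : (t' j).mv ⊆ X.dom := Set.subset_union_left.trans (ht' j).valid.2.2
  refine intro (.metaCongr X G s m x B hM t t') ⟨hX, hG, ?_⟩ ?_
  · exact BThesis.mv_plugEq (Bdry.mv_apply (hX.mv_bdry hM) (fun i => i.elim0) h1)
      (Arg.mv_mvar_subset.2 ⟨MCtx.mem_dom hM, h1⟩) (Arg.mv_mvar_subset.2 ⟨MCtx.mem_dom hM, h2⟩)
  · rintro p (((⟨j, rfl⟩ | ⟨j, rfl⟩) | ⟨j, rfl⟩) | ⟨E, hE, rfl⟩)
    exacts [ht j, ht' j, he j, hb E hE]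

theorem abstr {A : Ty Sg n} {c : Cls} {m : ℕ} {J : Judg Sg (n + 1) c m}
    (hA : Derivable T (.thesis X G (.isTy A))) (hJ : Derivable T (.judg X (G.snoc A) J)) :
    Derivable T (.judg X G (.abs A J)) :=
  intro (.abstr X G A J) ⟨hA.valid.1, hA.valid.2.1, Set.union_subset hA.valid.2.2 hJ.valid.2.2⟩
    (by rintro p (rfl | rfl); exacts [hA, hJ])

theorem tyRefl {A : Ty Sg n} (hA : Derivable T (.thesis X G (.isTy A))) :
    Derivable T (.thesis X G (.eqTy A A)) :=
  intro (.tyRefl X G A) ⟨hA.valid.1, hA.valid.2.1, Set.union_subset hA.valid.2.2 hA.valid.2.2⟩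
    (by rintro p rfl; exact hA)

theorem tySym {A B : Ty Sg n} (h : Derivable T (.thesis X G (.eqTy A B))) :
    Derivable T (.thesis X G (.eqTy B A)) :=
  intro (.tySym X G A B) ⟨h.valid.1, h.valid.2.1, (Set.union_comm _ _).subset.trans h.valid.2.2⟩
    (by rintro p rfl; exact h)

theorem tyTran {A B C : Ty Sg n} (h : Derivable T (.thesis X G (.eqTy A B)))
    (h' : Derivable T (.thesis X G (.eqTy B C))) : Derivable T (.thesis X G (.eqTy A C)) :=
  intro (.tyTran X G A B C) ⟨h.valid.1, h.valid.2.1, Set.union_subset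
    (Set.subset_union_left.trans h.valid.2.2) (Set.subset_union_right.trans h'.valid.2.2)⟩
    (by rintro p (rfl | rfl); exacts [h, h'])

theorem thesis_eqTm_mv {s t : Tm Sg n} {A : Ty Sg n} {D : Set MV} :
    (Judg.thesis (.eqTm s t A)).mv ⊆ D ↔ s.mv ⊆ D ∧ t.mv ⊆ D ∧ A.mv ⊆ D := by
  simp [Judg.mv, Thesis.mv, and_assoc]

theorem thesis_ofTy_mv {t : Tm Sg n} {A : Ty Sg n} {D : Set MV} :
    (Judg.thesis (.ofTy t A)).mv ⊆ D ↔ t.mv ⊆ D ∧ A.mv ⊆ D := by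
  simp [Judg.mv, Thesis.mv]

theorem tmRefl {t : Tm Sg n} {A : Ty Sg n} (h : Derivable T (.thesis X G (.ofTy t A))) :
    Derivable T (.thesis X G (.eqTm t t A)) :=
  intro (.tmRefl X G t A) ⟨h.valid.1, h.valid.2.1, by
    have := thesis_ofTy_mv.1 h.valid.2.2; exact thesis_eqTm_mv.2 ⟨this.1, this⟩⟩
    (by rintro p rfl; exact h)

theorem tmSym {s t : Tm Sg n} {A : Ty Sg n} (h : Derivable T (.thesis X G (.eqTm s t A))) :
    Derivable T (.thesis X G (.eqTm t s A)) :=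
  intro (.tmSym X G s t A) ⟨h.valid.1, h.valid.2.1, by
    have := thesis_eqTm_mv.1 h.valid.2.2; exact thesis_eqTm_mv.2 ⟨this.2.1, this.1, this.2.2⟩⟩
    (by rintro p rfl; exact h)

theorem tmTran {s t w : Tm Sg n} {A : Ty Sg n} (h : Derivable T (.thesis X G (.eqTm s t A)))
    (h' : Derivable T (.thesis X G (.eqTm t w A))) : Derivable T (.thesis X G (.eqTm s w A)) :=
  intro (.tmTran X G s t w A) ⟨h.valid.1, h.valid.2.1, thesis_eqTm_mv.2
      ⟨(thesis_eqTm_mv.1 h.valid.2.2).1, (thesis_eqTm_mv.1 h'.valid.2.2).2⟩⟩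
    (by rintro p (rfl | rfl); exacts [h, h'])

theorem convTm {t : Tm Sg n} {A B : Ty Sg n} (h : Derivable T (.thesis X G (.ofTy t A)))
    (h' : Derivable T (.thesis X G (.eqTy A B))) : Derivable T (.thesis X G (.ofTy t B)) :=
  intro (.convTm X G t A B) ⟨h.valid.1, h.valid.2.1, thesis_ofTy_mv.2
      ⟨(thesis_ofTy_mv.1 h.valid.2.2).1, Set.subset_union_right.trans h'.valid.2.2⟩⟩
    (by rintro p (rfl | rfl); exacts [h, h'])

theorem convEq {s t : Tm Sg n} {A B : Ty Sg n} (h : Derivable T (.thesis X G (.eqTm s t A)))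
    (h' : Derivable T (.thesis X G (.eqTy A B))) : Derivable T (.thesis X G (.eqTm s t B)) :=
  intro (.convEq X G s t A B) ⟨h.valid.1, h.valid.2.1, thesis_eqTm_mv.2
      ⟨(thesis_eqTm_mv.1 h.valid.2.2).1, (thesis_eqTm_mv.1 h.valid.2.2).2.1,
        Set.subset_union_right.trans h'.valid.2.2⟩⟩
    (by rintro p (rfl | rfl); exacts [h, h'])

theorem bdryTy (hX : X.Valid) (hG : G.mv ⊆ X.dom) : Derivable T (.bdry X G (.thesis .isTy)) :=
  intro (.bdryTy X G) ⟨hX, hG, by simp [Bdry.mv, BThesis.mv]⟩ (by simp)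

theorem bdryTm {A : Ty Sg n} (h : Derivable T (.thesis X G (.isTy A))) :
    Derivable T (.bdry X G (.thesis (.ofTy A))) :=
  intro (.bdryTm X G A) h.valid (by rintro p rfl; exact h)

theorem bdryEqTy {A B : Ty Sg n} (h : Derivable T (.thesis X G (.isTy A)))
    (h' : Derivable T (.thesis X G (.isTy B))) : Derivable T (.bdry X G (.thesis (.eqTy A B))) :=
  intro (.bdryEqTy X G A B) ⟨h.valid.1, h.valid.2.1, Set.union_subset h.valid.2.2 h'.valid.2.2⟩
    (by rintro p (rfl | rfl); exacts [h, h'])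

theorem bdryEqTm {s t : Tm Sg n} {A : Ty Sg n} (h : Derivable T (.thesis X G (.isTy A)))
    (hs : Derivable T (.thesis X G (.ofTy s A))) (ht : Derivable T (.thesis X G (.ofTy t A))) :
    Derivable T (.bdry X G (.thesis (.eqTm s t A))) :=
  intro (.bdryEqTm X G s t A) ⟨h.valid.1, h.valid.2.1, Set.union_subset (Set.union_subset
    (thesis_ofTy_mv.1 hs.valid.2.2).1 (thesis_ofTy_mv.1 ht.valid.2.2).1) h.valid.2.2⟩
    (by rintro p (rfl | rfl | rfl); exacts [h, hs, ht])

theorem bdryAbstr {A : Ty Sg n} {c : Cls} {m : ℕ} {B : Bdry Sg (n + 1) c m}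
    (hA : Derivable T (.thesis X G (.isTy A))) (hB : Derivable T (.bdry X (G.snoc A) B)) :
    Derivable T (.bdry X G (.abs A B)) :=
  intro (.bdryAbstr X G A B) ⟨hA.valid.1, hA.valid.2.1, Set.union_subset hA.valid.2.2 hB.valid.2.2⟩
    (by rintro p (rfl | rfl); exacts [hA, hB])

theorem specific {c : Cls} {i : T.Idx c} {I : Inst Sg n} (hI : I.Over (T.rule i).prem X)
    (hp : ∀ p ∈ I.premises (T.rule i).prem X G, Derivable T p)
    (hb : Derivable T (.bdry X G (.thesis (I.onBThesis (T.rule i).bdry)))) :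
    Derivable T (.thesis X G ((I.onBThesis (T.rule i).bdry).plug (I.onArg (T.rule i).head))) := by
  refine intro (.specific i X G I hI) ⟨hb.valid.1, hb.valid.2.1, ?_⟩ ?_
  · exact BThesis.mv_plug hb.valid.2.2 (hI.mv_onArg (T.rule i).mv_head)
  · rintro p (h | rfl)
    exacts [hp p h, hb]

theorem congr (hX : X.Valid) (hG : G.mv ⊆ X.dom) {s : Srt} {i : T.Idx (.obj s)} {I J : Inst Sg n}
    (hI : I.Over (T.rule i).prem X) (hJ : J.Over (T.rule i).prem X)
    (hp : ∀ p ∈ I.premises (T.rule i).prem X G, Derivable T p)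
    (hp' : ∀ p ∈ J.premises (T.rule i).prem X G, Derivable T p)
    (he : ∀ p ∈ I.eqPremises J (T.rule i).prem X G, Derivable T p)
    (hb : ∀ E, (I.onBThesis (T.rule i).bdry).tyEq (J.onBThesis (T.rule i).bdry) = some E →
      Derivable T (.thesis X G E)) :
    Derivable T (.thesis X G ((I.onBThesis (T.rule i).bdry).plugEq (I.onArg (T.rule i).head)
      (J.onArg (T.rule i).head))) := by
  refine intro (.congr i X G I J hI hJ) ⟨hX, hG, ?_⟩ ?_
  · exact BThesis.mv_plugEq (hI.mv_onBThesis (T.rule i).mv_bdry) (hI.mv_onArg (T.rule i).mv_head)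
      (hJ.mv_onArg (T.rule i).mv_head)
  · rintro p (((h | h) | h) | ⟨E, hE, rfl⟩)
    exacts [hp p h, hp' p h, he p h, hb E hE]

/-- Abstraction is the only closure rule with an abstracted judgement as conclusion. -/
theorem abs_inv {c : Cls} {m : ℕ} {A : Ty Sg n} {J : Judg Sg (n + 1) c m}
    (h : Derivable T (.judg X G (.abs A J))) :
    Derivable T (.thesis X G (.isTy A)) ∧ Derivable T (.judg X (G.snoc A) J) := by
  generalize hq : Hyp.judg X G (.abs A J) = q at h
  obtain ⟨hr, -, -, h⟩ := h
  cases hr <;> cases hq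
  exact ⟨h _ (by simp), h _ (by simp)⟩

theorem bdry_abs_inv {c : Cls} {m : ℕ} {A : Ty Sg n} {B : Bdry Sg (n + 1) c m}
    (h : Derivable T (.bdry X G (.abs A B))) :
    Derivable T (.thesis X G (.isTy A)) ∧ Derivable T (.bdry X (G.snoc A) B) := by
  generalize hq : Hyp.bdry X G (.abs A B) = q at h
  obtain ⟨hr, -, -, h⟩ := h
  cases hr <;> cases hq
  exact ⟨h _ (by simp), h _ (by simp)⟩

end Derivable

/-! ### Weakening of the metavariable context -/

/-- Derivability over all valid extensions of the metavariable context. -/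
def Hyp.DerivableOver (T : RawTheory.{u, v} Sg) (X' : MCtx Sg) : Hyp Sg → Prop
  | .judg X G J => X ⊆ X' → Derivable T (.judg X' G J)
  | .bdry X G B => X ⊆ X' → Derivable T (.bdry X' G B)

theorem MCtx.dom_mono {X X' : MCtx Sg} (h : X ⊆ X') : X.dom ⊆ X'.dom :=
  fun _ hM => List.map_subset _ h hM

theorem Inst.Over.mono {g : ℕ} {I : Inst Sg g} {Y X X' : MCtx Sg} (hI : I.Over Y X) (h : X ⊆ X') :
    I.Over Y X' := ⟨hI.1, fun M e he => (hI.2 M e he).trans (MCtx.dom_mono h)⟩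

/-- The rules consult the metavariable context only through membership of declarations, so inclusion
of lists suffices and the order of entries plays no role. -/
theorem Derivable.derivableOver {q : Hyp Sg} (h : Derivable T q) {X' : MCtx Sg} (hX' : X'.Valid) :
    q.DerivableOver T X' := by
  induction h with
  | @mk P q hr hP hq h ih =>
    cases hr with
    | var X G i => exact fun hs => .var hX' (hq.2.1.trans (MCtx.dom_mono hs)) i
    | metaApp X G M B hM t =>
      exact fun hs => .metaApp (hs hM) (fun j => ih _ (.inl ⟨j, rfl⟩) hs) (ih _ (.inr rfl) hs)
    | metaCongr X G s m x B hM t t' =>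
      exact fun hs => .metaCongr hX' (hq.2.1.trans (MCtx.dom_mono hs)) (hs hM)
        (fun j => ih _ (.inl (.inl (.inl ⟨j, rfl⟩))) hs) (fun j => ih _ (.inl (.inl (.inr ⟨j, rfl⟩))) hs)
        (fun j => ih _ (.inl (.inr ⟨j, rfl⟩)) hs) (fun E hE => ih _ (.inr ⟨E, hE, rfl⟩) hs)
    | abstr X G A J => exact fun hs => .abstr (ih _ (.inl rfl) hs) (ih _ (.inr rfl) hs)
    | tyRefl X G A => exact fun hs => .tyRefl (ih _ rfl hs)
    | tySym X G A B => exact fun hs => .tySym (ih _ rfl hs)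
    | tyTran X G A B C => exact fun hs => .tyTran (ih _ (.inl rfl) hs) (ih _ (.inr rfl) hs)
    | tmRefl X G t A => exact fun hs => .tmRefl (ih _ rfl hs)
    | tmSym X G s t A => exact fun hs => .tmSym (ih _ rfl hs)
    | tmTran X G s t w A => exact fun hs => .tmTran (ih _ (.inl rfl) hs) (ih _ (.inr rfl) hs)
    | convTm X G t A B => exact fun hs => .convTm (ih _ (.inl rfl) hs) (ih _ (.inr rfl) hs)
    | convEq X G s t A B => exact fun hs => .convEq (ih _ (.inl rfl) hs) (ih _ (.inr rfl) hs)
    | bdryTy X G => exact fun hs => .bdryTy hX' (hq.2.1.trans (MCtx.dom_mono hs))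
    | bdryTm X G A => exact fun hs => .bdryTm (ih _ rfl hs)
    | bdryEqTy X G A B => exact fun hs => .bdryEqTy (ih _ (.inl rfl) hs) (ih _ (.inr rfl) hs)
    | bdryEqTm X G s t A =>
      exact fun hs => .bdryEqTm (ih _ (.inl rfl) hs) (ih _ (.inr (.inl rfl)) hs) (ih _ (.inr (.inr rfl)) hs)
    | bdryAbstr X G A B => exact fun hs => .bdryAbstr (ih _ (.inl rfl) hs) (ih _ (.inr rfl) hs)
    | specific i X G I hI =>
      refine fun hs => .specific (hI.mono hs) ?_ (ih _ (.inr rfl) hs)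
      rintro p ⟨Y₁, M, B, Y₂, e, hY, he, rfl⟩
      exact ih _ (.inl ⟨Y₁, M, B, Y₂, e, hY, he, rfl⟩) hs
    | congr i X G I J hI hJ =>
      refine fun hs => .congr hX' (hq.2.1.trans (MCtx.dom_mono hs)) (hI.mono hs) (hJ.mono hs) ?_ ?_ ?_
        (fun E hE => ih _ (.inr ⟨E, hE, rfl⟩) hs)
      · rintro p ⟨Y₁, M, B, Y₂, e, hY, he, rfl⟩
        exact ih _ (.inl (.inl (.inl ⟨Y₁, M, B, Y₂, e, hY, he, rfl⟩))) hs
      · rintro p ⟨Y₁, M, B, Y₂, e, hY, he, rfl⟩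
        exact ih _ (.inl (.inl (.inr ⟨Y₁, M, B, Y₂, e, hY, he, rfl⟩))) hs
      · rintro p ⟨Y₁, s, m, x, B, Y₂, e, e', hY, he, he', rfl⟩
        exact ih _ (.inl (.inr ⟨Y₁, s, m, x, B, Y₂, e, e', hY, he, he', rfl⟩)) hs

theorem Derivable.weaken {c : Cls} {m : ℕ} {J : Judg Sg n c m} (h : Derivable T (.judg X G J))
    {X' : MCtx Sg} (hX' : X'.Valid) (hs : X ⊆ X') : Derivable T (.judg X' G J) :=
  h.derivableOver hX' hs

/-! ### Substitution -/

/-- Substitutions of derivable terms of the required types. -/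
structure TypedSub (T : RawTheory.{u, v} Sg) (X : MCtx Sg) {n k : ℕ} (G : Ctx Sg n) (D : Ctx Sg k)
    (f : Fin n → Tm Sg k) : Prop where
  valid : X.Valid
  ctx : D.mv ⊆ X.dom
  typed : ∀ i, Derivable T (.thesis X D (.ofTy (f i) ((G.get i).sub f)))

/-- Derivability under all substitutions from a class `W`. -/
def Hyp.DerivableSub (T : RawTheory.{u, v} Sg)
    (W : MCtx Sg → ∀ {n k : ℕ}, Ctx Sg n → Ctx Sg k → (Fin n → Tm Sg k) → Prop) : Hyp Sg → Prop
  | @Hyp.judg _ X _ G _ _ J => ∀ {k : ℕ} (D : Ctx Sg k) f, W X G D f → Derivable T (.judg X D (J.sub f))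
  | @Hyp.bdry _ X _ G _ _ B => ∀ {k : ℕ} (D : Ctx Sg k) f, W X G D f → Derivable T (.bdry X D (B.sub f))

theorem TypedSub.mv_le {n k : ℕ} {G : Ctx Sg n} {D : Ctx Sg k} {f : Fin n → Tm Sg k}
    (h : TypedSub T X G D f) (i : Fin n) : (f i).mv ⊆ X.dom :=
  (Derivable.thesis_ofTy_mv.1 (h.typed i).valid.2.2).1

theorem Inst.Over.sub {g k : ℕ} {I : Inst Sg g} {Y X : MCtx Sg} (hI : I.Over Y X) {f : Fin g → Tm Sg k}
    (hf : ∀ i, (f i).mv ⊆ X.dom) : (I.sub f).Over Y X := by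
  refine ⟨fun M => by simpa [Inst.sub] using hI.1 M, fun M e he => ?_⟩
  obtain ⟨e, h, rfl⟩ := Option.map_eq_some_iff.1 he
  exact Arg.mv_sub (hI.2 M e h) hf

theorem Bdry.apply_sub' {c : Cls} {m n k : ℕ} (B : Bdry Sg 0 c m) (t : Fin m → Tm Sg n) (f : Fin n → Tm Sg k) :
    (B.apply Fin.elim0 t).sub f = B.apply Fin.elim0 (fun j => (t j).sub f) := by
  rw [apply_sub, sub_elim0]

theorem Bdry.argTy_sub' {c : Cls} {m n k : ℕ} (B : Bdry Sg 0 c m) (t : Fin m → Tm Sg n) (f : Fin n → Tm Sg k)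
    (j : Fin m) : (B.argTy Fin.elim0 t j).sub f = B.argTy Fin.elim0 (fun j => (t j).sub f) j := by
  rw [argTy_sub, sub_elim0]

theorem MV.app_sub {n k : ℕ} (M : MV) (t : Fin M.ar.num → Tm Sg n) (f : Fin n → Tm Sg k) :
    (M.app t).sub f = M.app (fun j => (t j).sub f) := by
  obtain ⟨⟨⟨s⟩ | ⟨s⟩, m⟩, x⟩ := M <;> rfl

theorem Inst.premises_sub {g k : ℕ} {I : Inst Sg g} {Y X : MCtx Sg} {G : Ctx Sg g} {D : Ctx Sg k}
    {f : Fin g → Tm Sg k}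
    (h : ∀ {c : Cls} {m : ℕ} {J : Judg Sg g c m}, .judg X G J ∈ I.premises Y X G →
      Derivable T (.judg X D (J.sub f))) :
    ∀ p ∈ (I.sub f).premises Y X D, Derivable T p := by
  rintro p ⟨Y₁, M, B, Y₂, e, hY, he, rfl⟩
  obtain ⟨e, he₁, rfl⟩ := Option.map_eq_some_iff.1 he
  have := h ⟨Y₁, M, B, Y₂, e, hY, he₁, rfl⟩
  rwa [Bdry.plug_sub, onBdry_sub, restrict_sub] at this

/-- The class `W` is a parameter because lifting a typed substitution under a binder needs
derivability to be stable under weakening. The lemma is used first for renamings, which provide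
weakening, and then for `TypedSub`. -/
theorem Derivable.derivableSub {W : MCtx Sg → ∀ {n k : ℕ}, Ctx Sg n → Ctx Sg k → (Fin n → Tm Sg k) → Prop}
    (hW : ∀ {X : MCtx Sg} {n k : ℕ} {G : Ctx Sg n} {D : Ctx Sg k} {f}, W X G D f → TypedSub T X G D f)
    (hl : ∀ {X : MCtx Sg} {n k : ℕ} {G : Ctx Sg n} {D : Ctx Sg k} {f} {A : Ty Sg n}, W X G D f →
      Derivable T (.thesis X D (.isTy (A.sub f))) → W X (G.snoc A) (D.snoc (A.sub f)) (liftSub f))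
    {q : Hyp Sg} (h : Derivable T q) : q.DerivableSub T W := by
  induction h with
  | @mk P q hr hP hq h ih =>
    cases hr with
    | var X G i => exact fun D f hf => (hW hf).typed i
    | metaApp X G M B hM t =>
      intro k D f hf
      have h1 := fun j => ih _ (.inl ⟨j, rfl⟩) D f hf
      have h2 := ih _ (.inr rfl) D f hf
      simp only [Judg.sub, Bdry.sub, Thesis.sub, Bdry.argTy_sub', Bdry.apply_sub'] at h1 h2
      simp only [Judg.sub, BThesis.plug_sub, Bdry.apply_sub', MV.app_sub]
      exact .metaApp hM h1 h2
    | metaCongr X G s m x B hM t t' =>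
      intro k D f hf
      have h1 := fun j => ih _ (.inl (.inl (.inl ⟨j, rfl⟩))) D f hf
      have h2 := fun j => ih _ (.inl (.inl (.inr ⟨j, rfl⟩))) D f hf
      have h3 := fun j => ih _ (.inl (.inr ⟨j, rfl⟩)) D f hf
      have h4 := fun E hE => ih _ (.inr ⟨E, hE, rfl⟩) D f hf
      simp only [Judg.sub, Thesis.sub, Bdry.argTy_sub'] at h1 h2 h3
      simp only [Judg.sub, BThesis.plugEq_sub, Bdry.apply_sub', Arg.sub]
      refine .metaCongr (hW hf).valid (hW hf).ctx hM h1 h2 h3 fun E hE => ?_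
      rw [← Bdry.apply_sub', ← Bdry.apply_sub', BThesis.tyEq_sub] at hE
      obtain ⟨E, hE₁, rfl⟩ := Option.map_eq_some_iff.1 hE
      exact h4 E hE₁
    | abstr X G A J =>
      intro k D f hf
      have hA := ih _ (.inl rfl) D f hf
      exact .abstr hA (ih _ (.inr rfl) _ _ (hl hf hA))
    | tyRefl X G A => exact fun D f hf => .tyRefl (ih _ rfl D f hf)
    | tySym X G A B => exact fun D f hf => .tySym (ih _ rfl D f hf)
    | tyTran X G A B C => exact fun D f hf => .tyTran (ih _ (.inl rfl) D f hf) (ih _ (.inr rfl) D f hf)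
    | tmRefl X G t A => exact fun D f hf => .tmRefl (ih _ rfl D f hf)
    | tmSym X G s t A => exact fun D f hf => .tmSym (ih _ rfl D f hf)
    | tmTran X G s t w A => exact fun D f hf => .tmTran (ih _ (.inl rfl) D f hf) (ih _ (.inr rfl) D f hf)
    | convTm X G t A B => exact fun D f hf => .convTm (ih _ (.inl rfl) D f hf) (ih _ (.inr rfl) D f hf)
    | convEq X G s t A B => exact fun D f hf => .convEq (ih _ (.inl rfl) D f hf) (ih _ (.inr rfl) D f hf)
    | bdryTy X G => exact fun D f hf => .bdryTy (hW hf).valid (hW hf).ctx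
    | bdryTm X G A => exact fun D f hf => .bdryTm (ih _ rfl D f hf)
    | bdryEqTy X G A B =>
      exact fun D f hf => .bdryEqTy (ih _ (.inl rfl) D f hf) (ih _ (.inr rfl) D f hf)
    | bdryEqTm X G s t A =>
      exact fun D f hf => .bdryEqTm (ih _ (.inl rfl) D f hf) (ih _ (.inr (.inl rfl)) D f hf)
        (ih _ (.inr (.inr rfl)) D f hf)
    | bdryAbstr X G A B =>
      intro k D f hf
      have hA := ih _ (.inl rfl) D f hf
      exact .bdryAbstr hA (ih _ (.inr rfl) _ _ (hl hf hA))
    | specific i X G I hI =>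
      intro k D f hf
      have hb := ih _ (.inr rfl) D f hf
      simp only [Judg.sub, Bdry.sub, BThesis.plug_sub, Inst.onBThesis_sub, Inst.onArg_sub] at hb ⊢
      exact .specific (hI.sub (hW hf).mv_le) (Inst.premises_sub fun hp => ih _ (.inl hp) D f hf) hb
    | congr i X G I J hI hJ =>
      intro k D f hf
      simp only [Judg.sub, BThesis.plugEq_sub, Inst.onBThesis_sub, Inst.onArg_sub]
      refine .congr (hW hf).valid (hW hf).ctx (hI.sub (hW hf).mv_le) (hJ.sub (hW hf).mv_le)
        (Inst.premises_sub fun hp => ih _ (.inl (.inl (.inl hp))) D f hf)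
        (Inst.premises_sub fun hp => ih _ (.inl (.inl (.inr hp))) D f hf) ?_ fun E hE => ?_
      · rintro p ⟨Y₁, s, m, x, B, Y₂, e, e', hY, he, he', rfl⟩
        obtain ⟨e, he₁, rfl⟩ := Option.map_eq_some_iff.1 he
        obtain ⟨e', he₂, rfl⟩ := Option.map_eq_some_iff.1 he'
        have := ih _ (.inl (.inr ⟨Y₁, s, m, x, B, Y₂, e, e', hY, he₁, he₂, rfl⟩)) D f hf
        rwa [Bdry.plugEq_sub, Inst.onBdry_sub, Inst.restrict_sub] at this
      · rw [← Inst.onBThesis_sub, ← Inst.onBThesis_sub, BThesis.tyEq_sub] at hE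
        obtain ⟨E, hE₁, rfl⟩ := Option.map_eq_some_iff.1 hE
        exact ih _ (.inr ⟨E, hE₁, rfl⟩) D f hf

/-- Renamings of variables that respect types. -/
def TypedRen (X : MCtx Sg) {n k : ℕ} (G : Ctx Sg n) (D : Ctx Sg k) (f : Fin n → Tm Sg k) : Prop :=
  X.Valid ∧ D.mv ⊆ X.dom ∧ ∃ r : Fin n → Fin k, f = (fun i => .var (r i)) ∧
    ∀ i, D.get (r i) = (G.get i).ren r

theorem Derivable.derivableRen {q : Hyp Sg} (h : Derivable T q) : q.DerivableSub T TypedRen := by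
  refine h.derivableSub ?_ ?_
  · rintro X n k G D f ⟨hX, hD, r, rfl, hr⟩
    refine ⟨hX, hD, fun i => ?_⟩
    rw [← Arg.ren_eq_sub, ← hr]
    exact .var hX hD _
  · rintro X n k G D f A ⟨hX, hD, r, rfl, hr⟩ hA
    refine ⟨hX, Set.union_subset hD hA.valid.2.2, liftRen r, by simp, ?_⟩
    refine Fin.lastCases ?_ fun i => ?_
    · simp [Ctx.get, ← Arg.ren_eq_sub, Arg.wk, Arg.ren_ren]
    · simp [Ctx.get, hr, Arg.wk, Arg.ren_ren]

theorem Derivable.wk_ofTy {t : Tm Sg n} {A B : Ty Sg n} (h : Derivable T (.thesis X G (.ofTy t A)))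
    (hB : Derivable T (.thesis X G (.isTy B))) :
    Derivable T (.thesis X (G.snoc B) (.ofTy t.wk A.wk)) := by
  have := h.derivableRen (G.snoc B) _ ⟨hB.valid.1, Set.union_subset hB.valid.2.1 hB.valid.2.2,
    Fin.castSucc, rfl, fun i => by simp [Ctx.get, Arg.wk]⟩
  simp only [Judg.sub, Thesis.sub, ← Arg.ren_eq_sub] at this
  exact this

theorem Derivable.wk_eqTm {s t : Tm Sg n} {A B : Ty Sg n} (h : Derivable T (.thesis X G (.eqTm s t A)))
    (hB : Derivable T (.thesis X G (.isTy B))) :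
    Derivable T (.thesis X (G.snoc B) (.eqTm s.wk t.wk A.wk)) := by
  have := h.derivableRen (G.snoc B) _ ⟨hB.valid.1, Set.union_subset hB.valid.2.1 hB.valid.2.2,
    Fin.castSucc, rfl, fun i => by simp [Ctx.get, Arg.wk]⟩
  simp only [Judg.sub, Thesis.sub, ← Arg.ren_eq_sub] at this
  exact this

theorem Derivable.wk_eqTy {A A' B : Ty Sg n} (h : Derivable T (.thesis X G (.eqTy A A')))
    (hB : Derivable T (.thesis X G (.isTy B))) :
    Derivable T (.thesis X (G.snoc B) (.eqTy A.wk A'.wk)) := by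
  have := h.derivableRen (G.snoc B) _ ⟨hB.valid.1, Set.union_subset hB.valid.2.1 hB.valid.2.2,
    Fin.castSucc, rfl, fun i => by simp [Ctx.get, Arg.wk]⟩
  simp only [Judg.sub, Thesis.sub, ← Arg.ren_eq_sub] at this
  exact this

theorem Derivable.var_last {A : Ty Sg n} (hA : Derivable T (.thesis X G (.isTy A))) :
    Derivable T (.thesis X (G.snoc A) (.ofTy (.var (Fin.last n)) A.wk)) := by
  have := Derivable.var (T := T) (G := G.snoc A) hA.valid.1
    (Set.union_subset hA.valid.2.1 hA.valid.2.2) (Fin.last n)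
  simpa [Ctx.get] using this

theorem TypedSub.lift {n k : ℕ} {G : Ctx Sg n} {D : Ctx Sg k} {f : Fin n → Tm Sg k} {A : Ty Sg n}
    (h : TypedSub T X G D f) (hA : Derivable T (.thesis X D (.isTy (A.sub f)))) :
    TypedSub T X (G.snoc A) (D.snoc (A.sub f)) (liftSub f) := by
  refine ⟨h.valid, Set.union_subset h.ctx hA.valid.2.2, Fin.lastCases ?_ fun i => ?_⟩
  · simpa [Ctx.get] using hA.var_last
  · simpa [Ctx.get] using (h.typed i).wk_ofTy hA

theorem Derivable.derivableTypedSub {q : Hyp Sg} (h : Derivable T q) :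
    q.DerivableSub T (TypedSub T) := h.derivableSub (fun h => h) TypedSub.lift

theorem TypedSub.extend {n k : ℕ} {G : Ctx Sg n} {D : Ctx Sg k} {f : Fin n → Tm Sg k}
    (h : TypedSub T X G D f) {A : Ty Sg n} {t : Tm Sg k}
    (ht : Derivable T (.thesis X D (.ofTy t (A.sub f)))) :
    TypedSub T X (G.snoc A) D (FTT.extend f t) := by
  refine ⟨h.valid, h.ctx, Fin.lastCases ?_ fun i => ?_⟩
  · simpa [Ctx.get] using ht
  · simpa [Ctx.get] using h.typed i

/-- Substitution for all abstracted variables at once; this is what the metavariable rule becomes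
under an instantiation. -/
theorem Derivable.plug_apply {c : Cls} {m n k : ℕ} {G : Ctx Sg n} {D : Ctx Sg k} {B : Bdry Sg n c m}
    {e : Arg Sg n c m} (h : Derivable T (.judg X G (B.plug e))) {f : Fin n → Tm Sg k}
    (hf : TypedSub T X G D f) {t : Fin m → Tm Sg k}
    (ht : ∀ j, Derivable T (.thesis X D (.ofTy (t j) (B.argTy f t j)))) :
    Derivable T (.thesis X D ((B.apply f t).plug (e.apply f t))) := by
  induction B with
  | thesis B =>
    have := h.derivableTypedSub D f hf
    simp only [Bdry.plug, Judg.sub, BThesis.plug_sub] at this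
    simpa only [Bdry.apply, Arg.apply] using this
  | abs A B ih =>
    cases e with
    | abs e => exact ih h.abs_inv.2 (hf.extend (ht 0)) fun j => ht j.succ

/-! ### Substitution of equal terms -/

/-- Pairs of judgementally equal substitutions. -/
structure EqSub (T : RawTheory.{u, v} Sg) (X : MCtx Sg) {n k : ℕ} (G : Ctx Sg n) (D : Ctx Sg k)
    (f g : Fin n → Tm Sg k) : Prop where
  left : TypedSub T X G D f
  right : TypedSub T X G D g
  eq : ∀ i, Derivable T (.thesis X D (.eqTm (f i) (g i) ((G.get i).sub f)))

/-- The class of the equations between objects of a given class. -/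
def Cls.toEq : Cls → Cls
  | .obj s => .eq s
  | .eq s => .eq s

/-- The equation between two substitution instances of an object judgement; the first substitution
instance in the case of an equation. -/
def Thesis.subEq {n k : ℕ} (f g : Fin n → Tm Sg k) : {c : Cls} → Thesis Sg n c → Thesis Sg k c.toEq
  | _, .isTy A => .eqTy (A.sub f) (A.sub g)
  | _, .ofTy t A => .eqTm (t.sub f) (t.sub g) (A.sub f)
  | _, .eqTy A B => .eqTy (A.sub f) (B.sub f)
  | _, .eqTm s t A => .eqTm (s.sub f) (t.sub f) (A.sub f)

def Judg.subEq : {n : ℕ} → {c : Cls} → {m : ℕ} → Judg Sg n c m → {k : ℕ} → (Fin n → Tm Sg k) →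
    (Fin n → Tm Sg k) → Judg Sg k c.toEq m
  | _, _, _, .thesis J, _, f, g => .thesis (J.subEq f g)
  | _, _, _, .abs A J, _, f, g => .abs (A.sub f) (J.subEq (liftSub f) (liftSub g))

/-- Congruence with respect to equal substitutions; for a boundary `□ : A`, the equation between the
substitution instances of `A`. -/
def Hyp.DerivableSubEq (T : RawTheory.{u, v} Sg) : Hyp Sg → Prop
  | @Hyp.judg _ X _ G _ _ J => ∀ {k : ℕ} (D : Ctx Sg k) f g, EqSub T X G D f g →
      Derivable T (.judg X D (J.subEq f g))
  | @Hyp.bdry _ X _ G _ _ (.thesis B) => ∀ {k : ℕ} (D : Ctx Sg k) f g, EqSub T X G D f g →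
      ∀ E, (B.sub f).tyEq (B.sub g) = some E → Derivable T (.thesis X D E)
  | _ => True

/-- Both lifted substitutions live over the extension by `A.sub f`. The new variable must have type
`A.sub g` for the second one, and conversion along `hE` provides this. -/
theorem EqSub.lift {n k : ℕ} {G : Ctx Sg n} {D : Ctx Sg k} {f g : Fin n → Tm Sg k} {A : Ty Sg n}
    (h : EqSub T X G D f g) (hA : Derivable T (.thesis X D (.isTy (A.sub f))))
    (hE : Derivable T (.thesis X D (.eqTy (A.sub f) (A.sub g)))) :
    EqSub T X (G.snoc A) (D.snoc (A.sub f)) (liftSub f) (liftSub g) := by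
  have hl := h.left.lift hA
  refine ⟨hl, ⟨h.left.valid, hl.ctx, Fin.lastCases ?_ fun i => ?_⟩, Fin.lastCases ?_ fun i => ?_⟩
  · simpa [Ctx.get] using hA.var_last.convTm (hE.wk_eqTy hA)
  · simpa [Ctx.get] using (h.right.typed i).wk_ofTy hA
  · simpa [Ctx.get] using hA.var_last.tmRefl
  · simpa [Ctx.get] using (h.eq i).wk_eqTm hA

theorem EqSub.extend {n k : ℕ} {G : Ctx Sg n} {D : Ctx Sg k} {f g : Fin n → Tm Sg k}
    (h : EqSub T X G D f g) {A : Ty Sg n} {t t' : Tm Sg k}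
    (ht : Derivable T (.thesis X D (.ofTy t (A.sub f))))
    (ht' : Derivable T (.thesis X D (.ofTy t' (A.sub g))))
    (he : Derivable T (.thesis X D (.eqTm t t' (A.sub f)))) :
    EqSub T X (G.snoc A) D (FTT.extend f t) (FTT.extend g t') := by
  refine ⟨h.left.extend ht, h.right.extend ht', Fin.lastCases ?_ fun i => ?_⟩
  · simpa [Ctx.get] using he
  · simpa [Ctx.get] using h.eq i

theorem Thesis.subEq_of_eq {n k : ℕ} (f g : Fin n → Tm Sg k) {s : Srt} (J : Thesis Sg n (.eq s)) :
    J.subEq f g = J.sub f := by cases J <;> rfl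

theorem BThesis.subEq_plug {n k : ℕ} (f g : Fin n → Tm Sg k) {s : Srt} (B : BThesis Sg n (.obj s))
    (e : Arg Sg n (.obj s) 0) : (B.plug e).subEq f g = (B.sub f).plugEq (e.sub f) (e.sub g) := by
  cases B <;> rfl

theorem Bdry.subEq_plug {s : Srt} {m n : ℕ} (B : Bdry Sg n (.obj s) m) (e : Arg Sg n (.obj s) m) {k : ℕ}
    (f g : Fin n → Tm Sg k) : (B.plug e).subEq f g = (B.sub f).plugEq (e.sub f) (e.sub g) := by
  induction m generalizing n k with
  | zero => cases B; simp only [plug, plugEq, sub, Judg.subEq, BThesis.subEq_plug]; rfl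
  | succ m ih => cases B; cases e; simp only [plug, plugEq, sub, Judg.subEq, Arg.sub, ih]; rfl

/-- Each metavariable or specific rule with an object conclusion is answered by its congruence rule.
The two sides are covered by ordinary substitution, the equational premises by the induction
hypothesis, and the type equation by the clause for boundaries. -/
theorem Derivable.derivableSubEq {q : Hyp Sg} (h : Derivable T q) : q.DerivableSubEq T := by
  induction h with
  | @mk P q hr hP hq h ih =>
    have hd : Derivable T q := .mk hr hP hq h
    -- For an equation the claim is just its instance under the first substitution, which settles
    -- all rules concluding an equation at once.
    have heq : ∀ {X : MCtx Sg} {n : ℕ} {G : Ctx Sg n} {s : Srt} {J : Thesis Sg n (.eq s)},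
        q = .thesis X G J → q.DerivableSubEq T := by
      rintro X n G s J rfl k D f g hf
      have := hd.derivableTypedSub D f hf.left
      simp only [Judg.subEq, Thesis.subEq_of_eq]
      exact this
    cases hr with
    | var X G i => intro k D f g hf; exact hf.eq i
    | metaApp X G M B hM t =>
      obtain ⟨⟨⟨s⟩ | ⟨s⟩, m⟩, x⟩ := M
      · intro k D f g hf
        simp only [Judg.subEq, BThesis.subEq_plug, Bdry.apply_sub', MV.app_sub]
        refine .metaCongr hf.left.valid hf.left.ctx hM (fun j => ?_) (fun j => ?_) (fun j => ?_)
          fun E hE => ?_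
        · have := (h _ (.inl ⟨j, rfl⟩)).derivableTypedSub D f hf.left
          simp only [Judg.sub, Thesis.sub, Bdry.argTy_sub'] at this
          exact this
        · have := (h _ (.inl ⟨j, rfl⟩)).derivableTypedSub D g hf.right
          simp only [Judg.sub, Thesis.sub, Bdry.argTy_sub'] at this
          exact this
        · have := ih _ (.inl ⟨j, rfl⟩) D f g hf
          simp only [Judg.subEq, Thesis.subEq, Bdry.argTy_sub'] at this
          exact this
        · rw [← Bdry.apply_sub', ← Bdry.apply_sub'] at hE
          exact ih _ (.inr rfl) D f g hf E hE
      · exact @heq _ _ _ _ _ rfl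
    | metaCongr => exact @heq _ _ _ _ _ rfl
    | abstr X G A J =>
      intro k D f g hf
      have hA := (h _ (.inl rfl)).derivableTypedSub D f hf.left
      exact .abstr hA (ih _ (.inr rfl) _ _ _ (hf.lift hA (ih _ (.inl rfl) D f g hf)))
    | convTm X G t A B =>
      intro k D f g hf
      exact .convEq (ih _ (.inl rfl) D f g hf) ((h _ (.inr rfl)).derivableTypedSub D f hf.left)
    | bdryTm X G A =>
      intro k D f g hf E hE
      obtain rfl := Option.some.inj hE
      exact ih _ rfl D f g hf
    | bdryTy | bdryEqTy | bdryEqTm => intro k D f g hf E hE; cases hE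
    | bdryAbstr => trivial
    | @specific c i X _ G I hI =>
      cases c with
      | eq s => exact @heq _ _ _ _ _ rfl
      | obj s =>
        intro k D f g hf
        simp only [Judg.subEq, BThesis.subEq_plug, Inst.onBThesis_sub, Inst.onArg_sub]
        refine .congr hf.left.valid hf.left.ctx (hI.sub hf.left.mv_le) (hI.sub hf.right.mv_le)
          (Inst.premises_sub fun hp => (h _ (.inl hp)).derivableTypedSub D f hf.left)
          (Inst.premises_sub fun hp => (h _ (.inl hp)).derivableTypedSub D g hf.right) ?_ fun E hE => ?_
        · rintro p ⟨Y₁, s, m, x, B, Y₂, e, e', hY, he, he', rfl⟩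
          obtain ⟨e, he₁, rfl⟩ := Option.map_eq_some_iff.1 he
          obtain ⟨e', he₂, rfl⟩ := Option.map_eq_some_iff.1 he'
          -- Both arguments are substitution instances of the same value of `I`, so the induction
          -- hypothesis for this one premise gives their equality.
          obtain rfl : e = e' := Option.some.inj (he₁.symm.trans he₂)
          have := ih _ (.inl ⟨Y₁, _, B, Y₂, e, hY, he₁, rfl⟩) D f g hf
          rwa [Bdry.subEq_plug, Inst.onBdry_sub, Inst.restrict_sub] at this
        · rw [← Inst.onBThesis_sub, ← Inst.onBThesis_sub] at hE
          exact ih _ (.inr rfl) D f g hf E hE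
    | _ => exact @heq _ _ _ _ _ rfl

/-- The counterpart of `Derivable.plug_apply` for equal arguments; metavariable congruence turns
into it under an instantiation. -/
theorem Derivable.plugEq_apply {s : Srt} {m n k : ℕ} {G : Ctx Sg n} {D : Ctx Sg k}
    {B : Bdry Sg n (.obj s) m} {e : Arg Sg n (.obj s) m} (h : Derivable T (.judg X G (B.plug e)))
    {f g : Fin n → Tm Sg k} (hf : EqSub T X G D f g) {t t' : Fin m → Tm Sg k}
    (ht : ∀ j, Derivable T (.thesis X D (.ofTy (t j) (B.argTy f t j))))
    (ht' : ∀ j, Derivable T (.thesis X D (.ofTy (t' j) (B.argTy g t' j))))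
    (he : ∀ j, Derivable T (.thesis X D (.eqTm (t j) (t' j) (B.argTy f t j)))) :
    Derivable T (.thesis X D ((B.apply f t).plugEq (e.apply f t) (e.apply g t'))) := by
  induction m generalizing n with
  | zero =>
    cases B with
    | thesis B =>
      have := h.derivableSubEq D f g hf
      simp only [Bdry.plug, Judg.subEq, BThesis.subEq_plug] at this
      simp only [Bdry.apply, Arg.apply]
      exact this
  | succ m ih =>
    cases B with
    | abs A B =>
      cases e with
      | abs e =>
        exact ih h.abs_inv.2 (hf.extend (ht 0) (ht' 0) (he 0)) (fun j => ht j.succ)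
          (fun j => ht' j.succ) fun j => he j.succ

/-! ### Derivable instantiations -/

/-- In a valid context each boundary mentions only earlier metavariables, so the restrictions in the
premises of a rule can be dropped. -/
theorem Inst.restrict_onBdry {g : ℕ} (I : Inst Sg g) {Y : MCtx Sg} {c : Cls} {m : ℕ} {B : Bdry Sg 0 c m}
    (hB : B.mv ⊆ Y.dom) : (I.restrict Y).onBdry B = I.onBdry B :=
  B.act_congr _ _ fun _ hM => if_pos (hB hM)

theorem Inst.onArg_inst {Y Z : MCtx Sg} (I : Inst Sg 0) {g : ℕ} {J : Inst Sg g} (hJ : J.Over Z Y) {c : Cls}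
    {m : ℕ} {e : Arg Sg 0 c m} (he : e.mv ⊆ Z.dom) : (J.onArg e).inst I = (comp I J).onArg e :=
  e.inst_act I J _ _ fun M hM => (hJ.1 M).2 (he hM)

theorem Inst.onBThesis_inst {Y Z : MCtx Sg} (I : Inst Sg 0) {g : ℕ} {J : Inst Sg g} (hJ : J.Over Z Y)
    {c : Cls} {B : BThesis Sg 0 c} (hB : B.mv ⊆ Z.dom) :
    (J.onBThesis B).inst I = (comp I J).onBThesis B :=
  B.inst_act I J _ _ fun M hM => (hJ.1 M).2 (hB hM)

theorem MCtx.dom_append_left (X Y : MCtx Sg) : X.dom ⊆ dom (X ++ Y) :=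
  dom_mono (List.subset_append_left _ _)

theorem Inst.restrict_onBdry_inst {Y Z : MCtx Sg} (I : Inst Sg 0) {g : ℕ} {J : Inst Sg g} (hJ : J.Over Z Y)
    (hZ : Z.Valid) {Z₁ Z₂ : MCtx Sg} {M : MV} {B : Bdry Sg 0 M.ar.cls M.ar.num}
    (h : Z = Z₁ ++ ⟨M, B⟩ :: Z₂) :
    ((J.restrict Z₁).onBdry B).inst I = ((comp I J).restrict Z₁).onBdry B := by
  have hB := hZ.2 _ _ _ _ h
  rw [restrict_onBdry _ hB, restrict_onBdry _ hB]
  exact B.inst_act I J _ _ fun N hN => (hJ.1 N).2 (h ▸ MCtx.dom_append_left _ _ (hB hN))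

theorem Inst.Over.mv_inst {I : Inst Sg 0} {Y X : MCtx Sg} (hI : I.Over Y X) {n : ℕ} {c : Cls} {m : ℕ}
    {e : Arg Sg n c m} (he : e.mv ⊆ Y.dom) : (e.inst I).mv ⊆ X.dom :=
  Arg.mv_act _ _ hI.2 fun _ hM h => absurd (he hM) (hI.eq_none h)

theorem Inst.Over.mv_ctx_inst {I : Inst Sg 0} {Y X : MCtx Sg} (hI : I.Over Y X) {n : ℕ} {G : Ctx Sg n}
    (hG : G.mv ⊆ Y.dom) : (G.inst I).mv ⊆ X.dom := by
  induction G with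
  | nil => simp [Ctx.inst, Ctx.mv]
  | snoc G A ih =>
    simp only [Ctx.mv, Ctx.inst, Set.union_subset_iff] at hG ⊢
    exact ⟨ih hG.1, hI.mv_inst hG.2⟩

theorem Inst.Over.comp {I : Inst Sg 0} {Y X Z : MCtx Sg} (hI : I.Over Y X) {g : ℕ} {J : Inst Sg g}
    (hJ : J.Over Z Y) : (Inst.comp I J).Over Z X := by
  refine ⟨fun M => by simpa [Inst.comp] using hJ.1 M, fun M e he => ?_⟩
  obtain ⟨e, he₁, rfl⟩ := Option.map_eq_some_iff.1 he
  exact hI.mv_inst (hJ.2 M e he₁)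

theorem inst_elim0 {k : ℕ} (I : Inst Sg 0) :
    (fun i => ((Fin.elim0 : Fin 0 → Tm Sg k) i).inst I) = Fin.elim0 := funext fun i => i.elim0

theorem MV.app_inst {I : Inst Sg 0} {M : MV} {e : Arg Sg 0 M.ar.cls M.ar.num} (h : I M = some e) {n : ℕ}
    (t : Fin M.ar.num → Tm Sg n) : (M.app t).inst I = e.apply Fin.elim0 (fun j => (t j).inst I) := by
  obtain ⟨⟨⟨s⟩ | ⟨s⟩, m⟩, x⟩ := M
  · exact Arg.inst_mvar_some I t h
  · exact (Arg.eq_dummy _).trans (Arg.eq_dummy _).symm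

theorem Inst.IsDerivable.plug {I : Inst Sg 0} {Y : MCtx Sg} (hI : I.IsDerivable T Y X .nil) (hY : Y.Valid)
    {M : MV} {B : Bdry Sg 0 M.ar.cls M.ar.num} (hM : ⟨M, B⟩ ∈ Y) :
    ∃ e, I M = some e ∧ Derivable T (.judg X .nil ((B.inst I).plug e)) := by
  obtain ⟨e, he⟩ := Option.isSome_iff_exists.1 ((hI.1.1 M).2 (MCtx.mem_dom hM))
  obtain ⟨Y₁, Y₂, rfl⟩ := List.append_of_mem hM
  refine ⟨e, he, ?_⟩
  rw [← Inst.onBdry_eq_inst, ← Inst.restrict_onBdry I (hY.2 _ _ _ _ rfl)]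
  exact hI.2 _ ⟨Y₁, M, B, Y₂, e, rfl, he, rfl⟩

/-- Derivability after the action of an instantiation of `Y` over `X`. -/
def Hyp.DerivableInst (T : RawTheory.{u, v} Sg) (I : Inst Sg 0) (Y X : MCtx Sg) : Hyp Sg → Prop
  | .judg Y' G J => Y' = Y → Derivable T (.judg X (G.inst I) (J.inst I))
  | .bdry Y' G B => Y' = Y → Derivable T (.bdry X (G.inst I) (B.inst I))

theorem Inst.premises_inst {I : Inst Sg 0} {Y X Z : MCtx Sg} {g : ℕ} {J : Inst Sg g} {G : Ctx Sg g}
    (hJ : J.Over Z Y) (hZ : Z.Valid)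
    (h : ∀ p ∈ J.premises Z Y G, p.DerivableInst T I Y X) :
    ∀ p ∈ (Inst.comp I J).premises Z X (G.inst I), Derivable T p := by
  rintro p ⟨Z₁, M, B, Z₂, e, hZ₁, he, rfl⟩
  obtain ⟨e, he₁, rfl⟩ := Option.map_eq_some_iff.1 he
  have := h _ ⟨Z₁, M, B, Z₂, e, hZ₁, he₁, rfl⟩ rfl
  rwa [Bdry.inst_plug, restrict_onBdry_inst I hJ hZ hZ₁] at this

theorem TypedSub.nil (hX : X.Valid) (hG : G.mv ⊆ X.dom) : TypedSub T X .nil G Fin.elim0 :=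
  ⟨hX, hG, fun i => i.elim0⟩

/-- Only the two metavariable rules need an argument: a derivation of the value of `I` takes their
place, with the arguments substituted into it. Every other rule is mapped to an instance of itself.
-/
theorem Derivable.derivableInst {I : Inst Sg 0} {Y X : MCtx Sg} (hI : I.IsDerivable T Y X .nil)
    (hX : X.Valid) {q : Hyp Sg} (h : Derivable T q) : q.DerivableInst T I Y X := by
  induction h with
  | @mk P q hr hP hq h ih =>
    cases hr with
    | var Y G i =>
      rintro rfl
      simp only [Judg.inst, Thesis.inst, Arg.inst_var, ← Ctx.get_inst]
      exact .var hX (hI.1.mv_ctx_inst hq.2.1) i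
    | metaApp Y G M B hM t =>
      rintro rfl
      have h1 := fun j => ih _ (.inl ⟨j, rfl⟩) rfl
      obtain ⟨e, he, hd⟩ := hI.plug hq.1 hM
      simp only [Judg.inst, Thesis.inst, Bdry.inst_argTy, inst_elim0] at h1
      simp only [Judg.inst, BThesis.inst_plug, Bdry.inst_apply, inst_elim0, MV.app_inst he]
      exact hd.plug_apply (.nil hX (hI.1.mv_ctx_inst hq.2.1)) h1
    | metaCongr Y G s m x B hM t t' =>
      rintro rfl
      have h1 := fun j => ih _ (.inl (.inl (.inl ⟨j, rfl⟩))) rfl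
      have h2 := fun j => ih _ (.inl (.inl (.inr ⟨j, rfl⟩))) rfl
      have h3 := fun j => ih _ (.inl (.inr ⟨j, rfl⟩)) rfl
      obtain ⟨e, he, hd⟩ := hI.plug hq.1 hM
      simp only [Judg.inst, Thesis.inst, Bdry.inst_argTy, inst_elim0] at h1 h2 h3
      simp only [Judg.inst, BThesis.inst_plugEq, Bdry.inst_apply, inst_elim0, Arg.inst_mvar_some I _ he]
      have h0 : TypedSub T X .nil (G.inst I) Fin.elim0 := .nil hX (hI.1.mv_ctx_inst hq.2.1)
      exact Derivable.plugEq_apply hd ⟨h0, h0, fun i => i.elim0⟩ h1 h2 h3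
    | abstr Y G A J => exact fun hs => .abstr (ih _ (.inl rfl) hs) (ih _ (.inr rfl) hs)
    | tyRefl Y G A => exact fun hs => .tyRefl (ih _ rfl hs)
    | tySym Y G A B => exact fun hs => .tySym (ih _ rfl hs)
    | tyTran Y G A B C => exact fun hs => .tyTran (ih _ (.inl rfl) hs) (ih _ (.inr rfl) hs)
    | tmRefl Y G t A => exact fun hs => .tmRefl (ih _ rfl hs)
    | tmSym Y G s t A => exact fun hs => .tmSym (ih _ rfl hs)
    | tmTran Y G s t w A => exact fun hs => .tmTran (ih _ (.inl rfl) hs) (ih _ (.inr rfl) hs)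
    | convTm Y G t A B => exact fun hs => .convTm (ih _ (.inl rfl) hs) (ih _ (.inr rfl) hs)
    | convEq Y G s t A B => exact fun hs => .convEq (ih _ (.inl rfl) hs) (ih _ (.inr rfl) hs)
    | bdryTy Y G =>
      rintro rfl
      exact .bdryTy hX (hI.1.mv_ctx_inst hq.2.1)
    | bdryTm Y G A => exact fun hs => .bdryTm (ih _ rfl hs)
    | bdryEqTy Y G A B => exact fun hs => .bdryEqTy (ih _ (.inl rfl) hs) (ih _ (.inr rfl) hs)
    | bdryEqTm Y G s t A =>
      exact fun hs => .bdryEqTm (ih _ (.inl rfl) hs) (ih _ (.inr (.inl rfl)) hs) (ih _ (.inr (.inr rfl)) hs)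
    | bdryAbstr Y G A B => exact fun hs => .bdryAbstr (ih _ (.inl rfl) hs) (ih _ (.inr rfl) hs)
    | specific i Y G J hJ =>
      rintro rfl
      have hb := ih _ (.inr rfl) rfl
      simp only [Bdry.inst, Inst.onBThesis_inst I hJ (T.rule i).mv_bdry] at hb
      simp only [Judg.inst, BThesis.inst_plug, Inst.onBThesis_inst I hJ (T.rule i).mv_bdry,
        Inst.onArg_inst I hJ (T.rule i).mv_head]
      exact .specific (hI.1.comp hJ)
        (Inst.premises_inst hJ (T.rule i).valid.1 fun p hp => ih _ (.inl hp)) hb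
    | congr i Y G J K hJ hK =>
      rintro rfl
      simp only [Judg.inst, BThesis.inst_plugEq, Inst.onBThesis_inst I hJ (T.rule i).mv_bdry,
        Inst.onArg_inst I hJ (T.rule i).mv_head, Inst.onArg_inst I hK (T.rule i).mv_head]
      refine .congr hX (hI.1.mv_ctx_inst hq.2.1) (hI.1.comp hJ) (hI.1.comp hK)
        (Inst.premises_inst hJ (T.rule i).valid.1 fun p hp => ih _ (.inl (.inl (.inl hp))))
        (Inst.premises_inst hK (T.rule i).valid.1 fun p hp => ih _ (.inl (.inl (.inr hp)))) ?_
        fun E hE => ?_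
      · rintro p ⟨Z₁, s, m, x, B, Z₂, e, e', hZ, he, he', rfl⟩
        obtain ⟨e, he₁, rfl⟩ := Option.map_eq_some_iff.1 he
        obtain ⟨e', he₂, rfl⟩ := Option.map_eq_some_iff.1 he'
        have := ih _ (.inl (.inr ⟨Z₁, s, m, x, B, Z₂, e, e', hZ, he₁, he₂, rfl⟩)) rfl
        have h2 := Inst.restrict_onBdry_inst I hJ (T.rule i).valid.1 hZ
        rw [Bdry.inst_plugEq] at this
        rw [← h2]
        exact this
      · rw [← Inst.onBThesis_inst I hJ (T.rule i).mv_bdry, ← Inst.onBThesis_inst I hK (T.rule i).mv_bdry,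
          BThesis.inst_tyEq] at hE
        obtain ⟨E, hE₁, rfl⟩ := Option.map_eq_some_iff.1 hE
        exact ih _ (.inr ⟨E, hE₁, rfl⟩) rfl

/-! ### Derivability of generic applications -/

theorem extend_var {n k : ℕ} (r : Fin (n + 1) → Fin k) :
    extend (fun i : Fin n => Arg.var (Sg := Sg) (r i.castSucc)) (.var (r (Fin.last n))) =
      fun i => .var (r i) :=
  funext_last (by simp) (by simp)

/-- The body is treated in an arbitrary context `D` in which `r` and `xs` pick variables of the
right types. The induction on `C` can then move one variable at a time from the context into `xs`
without changing the ambient scope. -/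
theorem Derivable.plug_lams {c : Cls} {m n : ℕ} {G : Ctx Sg n} {C : Bdry Sg n c m}
    (h : Derivable T (.bdry X G C)) (f : (k : ℕ) → (Fin n → Fin k) → (Fin m → Fin k) → Arg Sg k c 0)
    (hf : ∀ (k : ℕ) (D : Ctx Sg k) (r : Fin n → Fin k) (xs : Fin m → Fin k),
      (∀ i, D.get (r i) = (G.get i).ren r) →
      (∀ j, D.get (xs j) = C.argTy (fun i => .var (r i)) (fun j => .var (xs j)) j) →
      Derivable T (.bdry X D (.thesis (C.apply (fun i => .var (r i)) (fun j => .var (xs j))))) →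
      Derivable T (.thesis X D
        ((C.apply (fun i => .var (r i)) (fun j => .var (xs j))).plug (f k r xs)))) :
    Derivable T (.judg X G (C.plug (lams m f))) := by
  induction C with
  | thesis B =>
    have := hf _ G id Fin.elim0 (fun i => (Arg.ren_id _).symm) (fun j => j.elim0)
    simp only [Bdry.apply, id, BThesis.sub_var] at this
    exact this h
  | abs A C ih =>
    obtain ⟨hA, hC⟩ := h.bdry_abs_inv
    refine .abstr hA (ih hC _ fun k D r xs hr hx hb => ?_)
    have := hf k D (fun i => r i.castSucc) (Fin.cons (α := fun _ => Fin k) (r (Fin.last _)) xs)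
      (fun i => by simpa [Ctx.get, Arg.wk, Arg.ren_ren] using hr i.castSucc)
    simp only [Bdry.apply, Bdry.argTy, Fin.cons_zero, Fin.cons_succ, extend_var] at this
    refine this (Fin.cases ?_ fun j => ?_) hb
    · simpa [Ctx.get, Arg.wk, Arg.ren_ren, Arg.ren_eq_sub, Arg.sub_sub, Arg.sub] using hr (Fin.last _)
    · simpa using hx j

theorem Derivable.plug_gen (hX : X.Valid) {M : MV} {B : Bdry Sg 0 M.ar.cls M.ar.num} (hM : ⟨M, B⟩ ∈ X)
    (h : Derivable T (.bdry X .nil B)) : Derivable T (.judg X .nil (B.plug M.gen)) := by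
  refine h.plug_lams _ fun k D r xs hr hx hb => ?_
  have hr0 : (fun i => Arg.var (Sg := Sg) (r i)) = Fin.elim0 := funext fun i => i.elim0
  rw [hr0] at hb hx ⊢
  refine .metaApp hM (fun j => ?_) hb
  rw [← hx j]
  exact .var hX hb.valid.2.1 _

/-! ### Inversion for naturality -/

/-- The premises of an application of the last rule in a derivation of naturality. -/
def Arg.NaturalInv (T : RawTheory.{u, v} Sg) (X : MCtx Sg) : {n : ℕ} → {c : Cls} → {m : ℕ} → Ctx Sg n →
    Arg Sg n c m → BThesis Sg n c → Prop
  | _, _, _, G, .var i, B => B = .ofTy (G.get i)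
  | _, _, _, G, .mvar s m x t, B => ∃ B' : Bdry Sg 0 (.obj s) m, ⟨⟨⟨.obj s, m⟩, x⟩, B'⟩ ∈ X ∧
      B = B'.apply Fin.elim0 t ∧ ∀ j, Natural T X G (.thesis (.ofTy (t j) (B'.argTy Fin.elim0 t j)))
  | n, _, _, G, .symb S e, _ => ∃ (s : Srt) (i : T.Idx (.obj s)) (I : Inst Sg n),
      (T.rule i).IsSymbolRule S ∧ I.Over (T.rule i).prem X ∧
      (T.rule i).prem.map (fun p => (⟨p.1.ar, I p.1⟩ : Σ a : Arity, Option (Arg Sg n a.cls a.num))) =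
        List.ofFn (fun j => ⟨Sg.arg S j, some (e j)⟩) ∧
      ∀ (Y₁ : MCtx Sg) (M : MV) (B : Bdry Sg 0 M.ar.cls M.ar.num) (Y₂ : MCtx Sg)
        (f : Arg Sg n M.ar.cls M.ar.num), (T.rule i).prem = Y₁ ++ ⟨M, B⟩ :: Y₂ → M.isObj = true →
        I M = some f → Natural T X G (((I.restrict Y₁).onBdry B).plug f)
  | _, _, _, _, _, _ => True

/-- Defined by recursion on the judgement, so that inversion applies to judgements of the form
`B.plug e`, which are not in constructor form until `B` is known. -/
def Judg.NaturalInv (T : RawTheory.{u, v} Sg) (X : MCtx Sg) {n : ℕ} (G : Ctx Sg n) :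
    {c : Cls} → {m : ℕ} → Judg Sg n c m → Prop
  | _, _, .thesis (.isTy A) => A.NaturalInv T X G .isTy
  | _, _, .thesis (.ofTy t A) => t.NaturalInv T X G (.ofTy A)
  | _, _, .thesis _ => True
  | _, _, .abs A J => Natural T X (G.snoc A) J

theorem Judg.naturalInv_plug {s : Srt} {B : BThesis Sg n (.obj s)} {e : Arg Sg n (.obj s) 0} :
    (Judg.thesis (B.plug e)).NaturalInv T X G ↔ e.NaturalInv T X G B := by
  cases B <;> rfl

theorem Natural.inv {c : Cls} {m : ℕ} {J : Judg Sg n c m} (h : Natural T X G J) :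
    J.NaturalInv T X G := by
  cases h with
  | var _ i => exact rfl
  | abs _ A J h => exact h
  | metaApp _ s m x B hM t h => exact Judg.naturalInv_plug.2 ⟨B, hM, rfl, h⟩
  | symb _ S e i hi I hI he h B' => exact Judg.naturalInv_plug.2 ⟨_, i, I, hi, hI, he, h⟩

/-- Opening all abstractions yields fresh variables. Their distinctness is recorded because it lets
`Bdry.eq_of_apply_eq` recover `C` from its instance. -/
theorem Natural.plug_lams {c : Cls} {m n : ℕ} {G : Ctx Sg n} {C : Bdry Sg n c m}
    {f : (k : ℕ) → (Fin n → Fin k) → (Fin m → Fin k) → Arg Sg k c 0}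
    (h : Natural T X G (C.plug (lams m f))) :
    ∃ (k : ℕ) (D : Ctx Sg k) (r : Fin n → Fin k) (xs : Fin m → Fin k),
      Function.Injective r ∧ Function.Injective xs ∧ (∀ i j, r i ≠ xs j) ∧
      (∀ i, D.get (r i) = (G.get i).ren r) ∧
      (∀ j, D.get (xs j) = C.argTy (fun i => .var (r i)) (fun j => .var (xs j)) j) ∧
      Natural T X D (.thesis ((C.apply (fun i => .var (r i)) (fun j => .var (xs j))).plug (f k r xs))) := by
  induction C with
  | thesis B =>
    refine ⟨_, G, id, Fin.elim0, Function.injective_id, fun i => i.elim0, fun _ j => j.elim0,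
      fun i => (Arg.ren_id _).symm, fun j => j.elim0, ?_⟩
    simp only [Bdry.apply, id, BThesis.sub_var]
    exact h
  | abs A C ih =>
    obtain ⟨k, D, r, xs, hr, hxs, hd, hG, hx, h⟩ := ih h.inv
    refine ⟨k, D, fun i => r i.castSucc, Fin.cons (α := fun _ => Fin k) (r (Fin.last _)) xs,
      hr.comp (Fin.castSucc_injective _), ?_, ?_, ?_, ?_, ?_⟩
    · exact Fin.cons_injective_iff.2 ⟨fun ⟨j, hj⟩ => hd _ j hj.symm, hxs⟩
    · exact fun i => Fin.cases (fun h => (Fin.castSucc_lt_last i).ne (hr h)) (fun j => hd _ j)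
    · exact fun i => by simpa [Ctx.get, Arg.wk, Arg.ren_ren] using hG i.castSucc
    · simp only [Bdry.argTy, Fin.cons_zero, Fin.cons_succ, extend_var]
      refine Fin.cases ?_ fun j => ?_
      · simpa [Ctx.get, Arg.wk, Arg.ren_ren, Arg.ren_eq_sub, Arg.sub_sub, Arg.sub] using hG (Fin.last _)
      · simpa using hx j
    · simpa only [Bdry.apply, Fin.cons_zero, Fin.cons_succ, extend_var] using h

theorem BThesis.ren_injective {c : Cls} {k : ℕ} {r : Fin n → Fin k} (hr : Function.Injective r)
    {B B' : BThesis Sg n c} (h : B.sub (fun i => .var (r i)) = B'.sub (fun i => .var (r i))) : B = B' := by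
  have key {c : Cls} {m : ℕ} {e e' : Arg Sg n c m}
      (h : e.sub (fun i => .var (r i)) = e'.sub (fun i => .var (r i))) : e = e' :=
    Arg.ren_injective hr (by simpa only [Arg.ren_eq_sub] using h)
  cases B <;> cases B' <;> simp only [sub, BThesis.ofTy.injEq, BThesis.eqTy.injEq, BThesis.eqTm.injEq] at h ⊢
  · exact key h
  · exact ⟨key h.1, key h.2⟩
  · exact ⟨key h.1, key h.2.1, key h.2.2⟩

/-- Instantiating at distinct variables is an injective renaming and loses no information; passing
under an abstraction extends this renaming by `xs 0`. -/
theorem Bdry.eq_of_apply_eq {c : Cls} {m n k : ℕ} {C C' : Bdry Sg n c m} {r : Fin n → Fin k}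
    {xs : Fin m → Fin k} (hr : Function.Injective r) (hxs : Function.Injective xs)
    (hd : ∀ i j, r i ≠ xs j)
    (hA : ∀ j, C.argTy (fun i => .var (r i)) (fun j => .var (xs j)) j =
      C'.argTy (fun i => .var (r i)) (fun j => .var (xs j)) j)
    (hB : C.apply (fun i => .var (r i)) (fun j => .var (xs j)) =
      C'.apply (fun i => .var (r i)) (fun j => .var (xs j))) : C = C' := by
  induction C with
  | thesis B =>
    cases C' with
    | thesis B' => rw [BThesis.ren_injective hr hB]
  | @abs n c m A C ih =>
    cases C' with
    | abs A' C' =>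
      obtain rfl : A = A' := Arg.ren_injective hr (by simpa [argTy, Arg.ren_eq_sub] using hA 0)
      have he : extend (fun i => Arg.var (Sg := Sg) (r i)) (.var (xs 0)) =
          fun i => .var (extend r (xs 0) i) := funext_last (by simp) (by simp)
      have hr' : Function.Injective (extend r (xs 0)) := by
        intro i j
        refine Fin.lastCases (fun h => ?_) (fun i => ?_) i
        · refine Fin.lastCases (fun _ => rfl) (fun j h => ?_) j h
          exact absurd (by simpa using h.symm) (hd j 0)
        · refine Fin.lastCases (fun h => ?_) (fun j h => ?_) j
          · exact absurd (by simpa using h) (hd i 0)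
          · exact congrArg Fin.castSucc (hr (by simpa using h))
      have hd' : ∀ i j, extend r (xs 0) i ≠ xs (Fin.succ j) := by
        intro i j
        refine Fin.lastCases ?_ (fun i => ?_) i
        · simpa using fun h => (Fin.succ_ne_zero j) (hxs h).symm
        · simpa using hd i j.succ
      refine congrArg _ (ih hr' (hxs.comp (Fin.succ_injective _)) hd' (fun j => ?_) ?_)
      · rw [← he]
        simpa [argTy] using hA j.succ
      · rw [← he]
        simpa [apply] using hB

/-- Naturality determines the boundary of a generic application. -/
theorem Natural.plug_gen {M : MV} (hM : M.isObj = true) {B : Bdry Sg 0 M.ar.cls M.ar.num}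
    (h : Natural T X .nil (B.plug M.gen)) : ⟨M, B⟩ ∈ X := by
  obtain ⟨k, D, r, xs, hr, hxs, hd, -, hx, h⟩ := h.plug_lams
  obtain ⟨⟨⟨s⟩ | ⟨s⟩, m⟩, x⟩ := M
  · obtain ⟨B', hB', h1, h2⟩ := Judg.naturalInv_plug.1 h.inv
    have hr0 : (fun i => Arg.var (Sg := Sg) (r i)) = Fin.elim0 := funext fun i => i.elim0
    rw [Bdry.eq_of_apply_eq (C := B) (C' := B') hr hxs hd (fun j => ?_) (by rw [h1, hr0])]
    · exact hB'
    -- A variable is natural only at the type given by its context, and for `xs j` that type comes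
    -- from `B`. This identifies the argument types of `B` with those of the declared boundary `B'`.
    · have := (h2 j).inv
      simp only [Judg.NaturalInv, Arg.NaturalInv, BThesis.ofTy.injEq] at this
      rw [← hx j, ← this, hr0]
  · simp [MV.isObj] at hM

/-! ### Inversion for symbols -/

/-- The premises of the rule for a symbol, when an argument over the empty variable context is an
application of that symbol. -/
def Arg.SymbInv (T : RawTheory.{u, v} Sg) (X : MCtx Sg) : {n : ℕ} → {c : Cls} → {m : ℕ} → Ctx Sg n →
    Arg Sg n c m → Prop
  | n, _, _, G, .symb S e => n = 0 → ∃ (s : Srt) (i : T.Idx (.obj s)) (I : Inst Sg n),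
      (T.rule i).IsSymbolRule S ∧ I.Over (T.rule i).prem X ∧
      (T.rule i).prem.map (fun p => (⟨p.1.ar, I p.1⟩ : Σ a : Arity, Option (Arg Sg n a.cls a.num))) =
        List.ofFn (fun j => ⟨Sg.arg S j, some (e j)⟩) ∧
      ∀ p ∈ I.premises (T.rule i).prem X G, Derivable T p
  | _, _, _, _, _ => True

/-- The type of a term is ignored, which makes the property invariant under conversion. -/
def Hyp.SymbInv (T : RawTheory.{u, v} Sg) : Hyp Sg → Prop
  | .judg X G (.thesis (.isTy A)) => A.SymbInv T X G
  | .judg X G (.thesis (.ofTy t _)) => t.SymbInv T X G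
  | _ => True

theorem Hyp.symbInv_plug {s : Srt} {B : BThesis Sg n (.obj s)} {e : Arg Sg n (.obj s) 0} :
    (Hyp.thesis X G (B.plug e)).SymbInv T ↔ e.SymbInv T X G := by
  cases B <;> rfl

theorem Hyp.symbInv_eq {s : Srt} (J : Thesis Sg n (.eq s)) : (Hyp.thesis X G J).SymbInv T := by
  cases J <;> trivial

/-- Specific object rules are symbol rules, so apart from conversion only they can produce a head
`S(e₁, …, eₙ)`, and the instantiation used there sends the premises to `e₁, …, eₙ`. Scope `0`
suffices, since patterns contain symbols only outside binders. -/
theorem Derivable.symbInv (hT : T.IsStandard) {q : Hyp Sg} (h : Derivable T q) : q.SymbInv T := by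
  induction h with
  | @mk P q hr hP hq h ih =>
    cases hr with
    | metaApp X G M B hM t =>
      obtain ⟨⟨⟨s⟩ | ⟨s⟩, m⟩, x⟩ := M
      · exact Hyp.symbInv_plug.2 trivial
      · exact Hyp.symbInv_eq _
    | metaCongr => exact Hyp.symbInv_eq _
    | congr => exact Hyp.symbInv_eq _
    | abstr => simp only [Hyp.SymbInv]
    | convTm X G t A B => exact ih (.thesis X G (.ofTy t A)) (.inl rfl)
    | @specific c i X n G I hI =>
      cases c with
      | eq s => exact Hyp.symbInv_eq _
      | obj s =>
        obtain ⟨S, hS⟩ := hT.2.1 s i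
        -- The form of the head is known only as an equality of pairs of class and expression;
        -- generalizing the pair allows it to be substituted.
        have key : ∀ p : Σ c : Cls, Arg Sg 0 c 0, ∀ q, p = ⟨.obj (Sg.srt S), .symb S q⟩ →
            (T.rule i).prem.map (fun p => (⟨p.1.ar, p.1.gen⟩ : Σ a : Arity, Arg Sg 0 a.cls a.num)) =
              List.ofFn (fun j => ⟨Sg.arg S j, q j⟩) → (I.onArg p.2).SymbInv T X G := by
          rintro _ q rfl hq₁ hn
          subst hn
          refine ⟨s, i, I, hS, hI, ?_, fun p hp => h p (.inl hp)⟩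
          -- Applying `I` to the list of generic applications gives the list of values of `I`, by
          -- `MV.inst_gen`.
          have := congrArg (List.map fun p : Σ a : Arity, Arg Sg 0 a.cls a.num =>
            (⟨p.1, some (p.2.inst I)⟩ : Σ a : Arity, Option (Arg Sg 0 a.cls a.num))) hq₁
          rw [List.map_map, List.map_ofFn] at this
          refine .trans (List.map_congr_left fun p hp => ?_) (this.trans ?_)
          · obtain ⟨e, he⟩ := Option.isSome_iff_exists.1 ((hI.1 p.1).2 (MCtx.mem_dom hp))
            simp only [Function.comp, MV.inst_gen he, he]
          · congr 1
            funext j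
            simp only [Function.comp]
            congr 2
            exact congrArg₂ (fun a r => (q j).act I a r) (Subsingleton.elim _ _) (Subsingleton.elim _ _)
        obtain ⟨q, hq, hq'⟩ := hS
        exact Hyp.symbInv_plug.2 (key _ q hq hq')
    | _ => trivial

/-! ### Patterns -/

theorem MCtx.Valid.bdry_unique {X : MCtx Sg} (hX : X.Valid) {M : MV} {B B' : Bdry Sg 0 M.ar.cls M.ar.num}
    (h : ⟨M, B⟩ ∈ X) (h' : ⟨M, B'⟩ ∈ X) : B = B' := by
  have := List.inj_on_of_nodup_map hX.1 h h' rfl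
  simpa using this

theorem IsPattern.isArgPattern {n : ℕ} {c : Cls} {p : Arg Sg n c 0} (h : IsPattern p) : IsArgPattern p := by
  cases h with
  | mvar x t =>
    obtain rfl : t = fun i => .var i.elim0 := funext fun i => i.elim0
    exact .gen ⟨⟨.obj .ty, 0⟩, x⟩
  | symb S q hq hd => exact .symb S q hq hd

/-- Simultaneous inversion of naturality of `q` and derivability of its instance under `I`. At each
symbol the premise of the first, acted on by `I`, is the premise of the second, so both pass to the
argument containing `M`. At the generic application of `M`, naturality identifies the boundary with
the declared one. -/
theorem Derivable.of_isArgPattern (hT : T.IsStandard) {Y : MCtx Sg} (hY : Y.Valid) {I : Inst Sg 0}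
    {c : Cls} {m : ℕ} {q : Arg Sg 0 c m} (hq : IsArgPattern q)
    {B : Bdry Sg 0 c m} (hN : Natural T Y .nil (B.plug q))
    (hD : Derivable T (.judg X .nil ((B.inst I).plug (q.inst I)))) {M : MV} (hM : M ∈ q.mv)
    {C : Bdry Sg 0 M.ar.cls M.ar.num} (hC : ⟨M, C⟩ ∈ Y) {e : Arg Sg 0 M.ar.cls M.ar.num}
    (he : I M = some e) : Derivable T (.judg X .nil ((I.onBdry C).plug e)) := by
  induction hq with
  | gen N =>
    obtain rfl : M = N := N.mv_gen hM
    rw [hY.bdry_unique hC (Natural.plug_gen (Arg.isObj_of_mem_mv _ hM) hN), Inst.onBdry_eq_inst]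
    rwa [MV.inst_gen he] at hD
  | symb S q hq _ ih =>
    cases B with
    | thesis B =>
    obtain ⟨s, i, J, hi, hJ, hJq, hJN⟩ := Judg.naturalInv_plug.1 hN.inv
    obtain ⟨s', i', K, hi', hK, hKq, hKD⟩ := Hyp.symbInv_plug.1 (hD.symbInv hT) rfl
    obtain ⟨_, -, hu⟩ := hT.2.2 S
    -- Since `S` has only one rule, both inversions used the same premises.
    cases (hu ⟨s, i⟩ hi).trans (hu ⟨s', i'⟩ hi').symm
    have hKJ : ∀ p ∈ (T.rule i).prem, K p.1 = Inst.comp I J p.1 := by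
      have := congrArg (List.map fun p : Σ a : Arity, Option (Arg Sg 0 a.cls a.num) =>
        (⟨p.1, p.2.map fun e => e.inst I⟩ : Σ a : Arity, Option (Arg Sg 0 a.cls a.num))) hJq
      rw [List.map_map, List.map_ofFn] at this
      intro p hp
      have := List.map_inj_left.1 (hKq.trans this.symm) p hp
      simpa [Inst.comp] using this
    simp only [Arg.mv, Set.mem_iUnion] at hM
    obtain ⟨j, hj⟩ := hM
    -- The induction hypothesis concerns `q j` at arity `Sg.arg S j`; this transports it to the
    -- arity of the corresponding premise of the rule.
    have key : ∀ (a : Arity) (f : Arg Sg 0 a.cls a.num),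
        (⟨a, some f⟩ : Σ a : Arity, Option (Arg Sg 0 a.cls a.num)) = ⟨Sg.arg S j, some (q j)⟩ →
        M ∈ f.mv ∧ ∀ B : Bdry Sg 0 a.cls a.num, Natural T Y .nil (B.plug f) →
          Derivable T (.judg X .nil ((B.inst I).plug (f.inst I))) →
          Derivable T (.judg X .nil ((I.onBdry C).plug e)) := by
      rintro a f h
      obtain ⟨rfl, h⟩ := Sigma.mk.inj h
      obtain rfl := Option.some.inj (eq_of_heq h)
      exact ⟨hj, fun B h1 h2 => ih j h1 h2 hj⟩
    have hmem : (⟨Sg.arg S j, some (q j)⟩ : Σ a : Arity, Option (Arg Sg 0 a.cls a.num)) ∈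
        List.ofFn (fun j => (⟨Sg.arg S j, some (q j)⟩ : Σ a : Arity, Option (Arg Sg 0 a.cls a.num))) :=
      List.mem_ofFn.2 ⟨j, rfl⟩
    rw [← hJq] at hmem
    obtain ⟨⟨N, E⟩, hNE, hNj⟩ := List.mem_map.1 hmem
    obtain ⟨f, hf⟩ := Option.isSome_iff_exists.1 ((hJ.1 N).2 (MCtx.mem_dom hNE))
    simp only [hf] at hNj
    obtain ⟨hMf, key⟩ := key _ _ hNj
    obtain ⟨Y₁, Y₂, hY₁⟩ := List.append_of_mem hNE
    -- Naturality covers object premises only; an argument that contains `M` cannot be of an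
    -- equality class.
    have hobj : N.isObj = true := by
      obtain ⟨⟨⟨s⟩ | ⟨s⟩, m⟩, x⟩ := N
      · rfl
      · rw [Arg.mv_of_eq] at hMf; exact hMf.elim
    have hKN : K N = some (f.inst I) := by rw [hKJ _ hNE]; simp [Inst.comp, hf]
    refine key _ (hJN Y₁ N E Y₂ f hY₁ hobj hf) ?_
    have := hKD _ ⟨Y₁, N, E, Y₂, _, hY₁, hKN, rfl⟩
    have hE := (T.rule i).valid.1.2 _ _ _ _ hY₁
    rw [Inst.restrict_onBdry_inst I hJ (T.rule i).valid.1 hY₁, Inst.restrict_onBdry _ hE]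
    rw [Inst.restrict_onBdry _ hE] at this
    -- The boundary `E` mentions only premises of the rule, and on these `K` agrees with `J`
    -- followed by `I`.
    have hc : K.onBdry E = (Inst.comp I J).onBdry E := E.act_congr _ _ fun M hM => by
      obtain ⟨p, hp, rfl⟩ := List.mem_map.1 (hE hM)
      exact hKJ p (by rw [hY₁]; exact List.mem_append_left _ hp)
    rwa [hc] at this

/-! ### Residues -/

theorem mem_residueTail {I : Inst Sg 0} {Y₀ Y : MCtx Sg} {M : MV} {B' : Bdry Sg 0 M.ar.cls M.ar.num} :
    ⟨M, B'⟩ ∈ residueTail I Y₀ Y ↔ ∃ (Y₁ : MCtx Sg) (B : Bdry Sg 0 M.ar.cls M.ar.num) (Y₂ : MCtx Sg),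
      Y = Y₁ ++ ⟨M, B⟩ :: Y₂ ∧ M.isObj = false ∧ B' = (I.restrict (Y₀ ++ Y₁)).onBdry B := by
  induction Y generalizing Y₀ with
  | nil => simp [residueTail]
  | cons p Y ih =>
    obtain ⟨N, C⟩ := p
    have hstep : (∃ (Y₁ : MCtx Sg) (B : Bdry Sg 0 M.ar.cls M.ar.num) (Y₂ : MCtx Sg),
        (⟨N, C⟩ :: Y : MCtx Sg) = Y₁ ++ ⟨M, B⟩ :: Y₂ ∧ M.isObj = false ∧
          B' = (I.restrict (Y₀ ++ Y₁)).onBdry B) ↔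
        (N.isObj = false ∧
          (⟨M, B'⟩ : Σ M : MV, Bdry Sg 0 M.ar.cls M.ar.num) = ⟨N, (I.restrict Y₀).onBdry C⟩) ∨
        ⟨M, B'⟩ ∈ residueTail I (Y₀ ++ [⟨N, C⟩]) Y := by
      rw [ih]
      constructor
      · rintro ⟨_ | ⟨p, Y₁⟩, B, Y₂, h, hM, rfl⟩
        · cases h
          exact .inl ⟨hM, by simp⟩
        · cases h
          exact .inr ⟨Y₁, B, Y₂, rfl, hM, by simp⟩
      · rintro (⟨hN, h⟩ | ⟨Y₁, B, Y₂, rfl, hM, rfl⟩)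
        · cases h
          exact ⟨[], C, Y, rfl, hN, by simp⟩
        · exact ⟨⟨N, C⟩ :: Y₁, B, Y₂, rfl, hM, by simp⟩
    rw [hstep, residueTail]
    split
    · simp_all
    · simp_all

theorem names_residueTail_sublist (I : Inst Sg 0) (Y₀ Y : MCtx Sg) :
    (MCtx.names (residueTail I Y₀ Y)).Sublist (MCtx.names Y) := by
  induction Y generalizing Y₀ with
  | nil => simp [residueTail]
  | cons p Y ih =>
    rw [residueTail]
    split
    · exact (ih _).cons _
    · exact (ih _).cons_cons _

/-- Distinctness of names comes from disjointness. The added boundaries mention metavariables of `X`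
only, since `I` replaces all those of `Y`. -/
theorem valid_residue {I : Inst Sg 0} {Y X : MCtx Sg} (hY : Y.Valid) (hX : X.Valid) (hI : I.Over Y X)
    (hd : Disjoint Y.dom X.dom) : (residue I Y X).Valid := by
  have hs := names_residueTail_sublist I [] Y
  refine ⟨?_, fun X₁ M B X₂ h => ?_⟩
  · rw [residue, MCtx.names, List.map_append]
    refine List.nodup_append'.2 ⟨hX.1, hs.nodup hY.1, fun M hM hM' => ?_⟩
    exact Set.disjoint_left.1 hd (hs.subset hM') hM
  · obtain ⟨Z, rfl, hZ⟩ | ⟨Z, rfl, hZ⟩ := List.append_eq_append_iff.1 h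
    · obtain ⟨Y₁, C, Y₂, rfl, -, rfl⟩ :=
        mem_residueTail.1 (show ⟨M, B⟩ ∈ residueTail I [] Y by rw [hZ]; simp)
      refine .trans ?_ (MCtx.dom_append_left X Z)
      have hC := hY.2 _ _ _ _ rfl
      rw [List.nil_append, Inst.restrict_onBdry _ hC]
      exact Bdry.mv_act _ _ hI.2 fun N hN h0 =>
        absurd (MCtx.dom_append_left _ _ (hC hN)) (hI.eq_none h0)
    -- With `Z` empty, the entry in question is the first one of the residue tail rather than an
    -- entry of `X`.
    · cases Z with
      | nil =>
        obtain ⟨Y₁, C, Y₂, rfl, -, rfl⟩ :=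
          mem_residueTail.1 (show ⟨M, B⟩ ∈ residueTail I [] Y by simp at hZ; rw [← hZ]; simp)
        have hC := hY.2 _ _ _ _ rfl
        rw [List.nil_append, Inst.restrict_onBdry _ hC]
        rw [List.append_nil] at hI
        exact Bdry.mv_act _ _ hI.2 fun N hN h0 =>
          absurd (MCtx.dom_append_left _ _ (hC hN)) (hI.eq_none h0)
      | cons p Z =>
        cases hZ
        exact hX.2 _ _ _ _ rfl

theorem MCtxDerivable.bdry {Y : MCtx Sg} (h : MCtxDerivable T Y) {Y₁ Y₂ : MCtx Sg} {M : MV}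
    {B : Bdry Sg 0 M.ar.cls M.ar.num} (hY : Y = Y₁ ++ ⟨M, B⟩ :: Y₂) :
    Derivable T (.bdry Y₁ .nil B) := by
  induction h generalizing Y₂ with
  | nil => simp at hY
  | extend X N C hX hB hN ih =>
    rcases List.eq_nil_or_concat Y₂ with rfl | ⟨Y₂, p, rfl⟩
    · obtain ⟨rfl, h⟩ := List.append_inj' hY rfl
      cases h
      exact hB
    · rw [List.concat_eq_append, ← List.cons_append, ← List.append_assoc] at hY
      exact ih (List.append_inj' hY rfl).1

theorem residueInst_eq {I : Inst Sg 0} {Y : MCtx Sg} {M : MV} (hM : M ∈ Y.names) (hobj : M.isObj = true) :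
    residueInst I Y M = I M := by
  simp [residueInst, hM, hobj]

theorem residueInst_over {I : Inst Sg 0} {Y X : MCtx Sg} (hI : I.Over Y X) :
    (residueInst I Y).Over Y (residue I Y X) := by
  refine ⟨fun M => ?_, fun M e he => ?_⟩
  · have := hI.1 M
    simp only [residueInst]
    split_ifs <;> simp_all
  · simp only [residueInst] at he
    split_ifs at he with h1 h2
    · exact (hI.2 M e he).trans (MCtx.dom_append_left _ _)
    · obtain rfl := Option.some.inj he
      rw [MV.mv_gen_of_isObj_eq_false (by simpa using h2)]
      exact Set.empty_subset _

/-- The residual instantiation differs from `I` only at equality metavariables, which do not occur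
in boundaries. -/
theorem residueInst_restrict_onBdry {I : Inst Sg 0} {Y Y₁ Y₂ : MCtx Sg} (hY : Y.Valid) {M : MV}
    {B : Bdry Sg 0 M.ar.cls M.ar.num} (h : Y = Y₁ ++ ⟨M, B⟩ :: Y₂) :
    ((residueInst I Y).restrict Y₁).onBdry B = I.onBdry B := by
  have hB := hY.2 _ _ _ _ h
  rw [Inst.restrict_onBdry _ hB]
  exact B.act_congr _ _ fun N hN => residueInst_eq
    (h ▸ MCtx.dom_append_left _ _ (hB hN)) (B.isObj_of_mem_mv hN)

theorem Inst.restrict_restrict {g : ℕ} (I : Inst Sg g) {Y Z : MCtx Sg} (h : Z ⊆ Y) :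
    (I.restrict Y).restrict Z = I.restrict Z := by
  funext M
  simp only [restrict]
  split_ifs with h1 h2
  · rfl
  · exact absurd (MCtx.dom_mono h h1) h2
  · rfl

/-- Object metavariables are handled by weakening `hobj`; equality metavariables hold by their
declaration in the residue, once the declared boundary is derivable. -/
theorem residueInst_isDerivable {I : Inst Sg 0} {Y : MCtx Sg} (hY : MCtxDerivable T Y) (hYv : Y.Valid)
    (hX : X.Valid) (hI : I.Over Y X) (hd : Disjoint Y.dom X.dom)
    (hobj : ∀ (M : MV) (B : Bdry Sg 0 M.ar.cls M.ar.num) (e : Arg Sg 0 M.ar.cls M.ar.num), ⟨M, B⟩ ∈ Y →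
      M.isObj = true → I M = some e → Derivable T (.judg X .nil ((I.onBdry B).plug e))) :
    (residueInst I Y).IsDerivable T Y (residue I Y X) .nil := by
  have hR := valid_residue hYv hX hI hd
  have hO := residueInst_over hI
  refine ⟨hO, ?_⟩
  rintro p ⟨Y₁, M, B, Y₂, e, h, he, rfl⟩
  -- The boundary of `M` lives over all of `Y₁`, so derivability at every earlier position is
  -- needed.
  induction hl : Y₁.length using Nat.strong_induction_on generalizing Y₁ M B Y₂ e with
  | _ l ih =>
  subst hl
  have hMY : ⟨M, B⟩ ∈ Y := by rw [h]; simp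
  have hK := residueInst_restrict_onBdry (I := I) hYv h
  rw [hK]
  cases hM : M.isObj with
  | true =>
    rw [residueInst_eq (MCtx.mem_dom hMY) hM] at he
    exact (hobj M B e hMY hM he).weaken hR (List.subset_append_left _ _)
  | false =>
    obtain rfl : M.gen = e := by
      have hn : M ∈ Y.names := MCtx.mem_dom hMY
      simpa [residueInst, hn, hM] using he
    have hB := hYv.2 _ _ _ _ h
    refine .plug_gen hR (List.mem_append_right _ (mem_residueTail.2 ⟨Y₁, B, Y₂, h, hM, ?_⟩)) ?_
    · rw [List.nil_append, Inst.restrict_onBdry _ hB]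
    · rw [← hK, Inst.onBdry_eq_inst]
      -- The boundary is derivable over `Y₁`; instantiating it needs the residual instantiation
      -- restricted to `Y₁`, whose premises come from the induction hypothesis at the shorter
      -- prefixes `Z₁`.
      refine Derivable.derivableInst (Y := Y₁) ⟨⟨fun N => ?_, fun N f hf => ?_⟩, ?_⟩ hR (hY.bdry h) rfl
      · simp only [Inst.restrict]
        split_ifs with h1
        · simpa [h1] using (hO.1 N).2 (h ▸ MCtx.dom_append_left _ _ h1)
        · simpa using h1
      · simp only [Inst.restrict] at hf
        split_ifs at hf
        exact hO.2 N f hf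
      · rintro p ⟨Z₁, N, C, Z₂, f, rfl, hf, rfl⟩
        rw [Inst.restrict_restrict _ (List.subset_append_left _ _)]
        refine ih _ (by simp) Z₁ N C (Z₂ ++ ⟨M, B⟩ :: Y₂) f (by simp [h]) ?_ rfl
        simp only [Inst.restrict] at hf
        split_ifs at hf
        exact hf

end FTT

/-! ### Object-invertibility of natural rules with pattern heads -/

theorem mainTheorem3 {Sg : FTT.Signature.{u}} (T : FTT.RawTheory.{u, v} Sg) (hT : T.IsStandard)
    {s : FTT.Srt} (R : FTT.RawRule Sg (.obj s)) (hder : R.IsDerivable T) (hfin : R.IsFinitary T)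
    (hnat : R.IsNatural T) (hpat : FTT.IsPattern R.head) (hmv : R.head.mv = R.prem.objmv) :
    R.IsObjectInvertible T := by
  refine ⟨hder, fun X I hI _ hd h => ?_⟩
  refine FTT.residueInst_isDerivable hfin.1 R.valid.1 h.valid.1 hI hd fun M B e hM hobj he => ?_
  -- By `hmv` every object metavariable occurs in the head, so the descent through the pattern
  -- reaches it.
  refine FTT.Derivable.of_isArgPattern (B := .thesis R.bdry) hT R.valid.1 hpat.isArgPattern hnat ?_
    (hmv ▸ ⟨FTT.MCtx.mem_dom hM, hobj⟩) hM he
  rwa [FTT.Inst.onBThesis_eq_inst, FTT.Inst.onArg_eq_inst] at h
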